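/- **Setting.** Let $d,n,k\ge 1$. Write $\mathbb S^n$, $\mathbb S^n_+$, $\mathbb M^n$ for the symmetric, the positive semidefinite and all real $n\times n$ matrices; matrix spaces carry the Frobenius inner product $A\cdot B=\mathrm{tr}(A^{T}B)$ and norm, and $A^\dagger$ is the pseudoinverse. Let $\Omega\subset\mathbb R^d$ be compact, $Q=[0,1]\times\Omega$, $\mathbb X=\mathbb S^n\times\mathbb R^{n\times k}\times\mathbb M^n$, and let $\mathcal M(\mathcal X,V)$ denote the finite $V$-valued Borel measures on $\mathcal X$. Let $\Lambda=(\Lambda_1,\Lambda_2)$ with $\Lambda_1\in\mathbb R^{k\times k}$ symmetric positive semidefinite and $\Lambda_2\in\mathbb R^{n\times n}$ symmetric positive definite. Put $$J_\Lambda(X,Y,Z)=\tfrac12 (Y\Lambda_1^\dagger)\cdot(X^\dagger Y\Lambda_1^\dagger)+\tfrac12(Z\Lambda_2^\dagger)\cdot(X^\dagger Z\Lambda_2^\dagger)$$ if $X\in\mathbb S^n_+$, $\mathrm{Ran}(Y^T)\subset\mathrm{Ran}(\Lambda_1)$, $\mathrm{Ran}(Z^T)\subset\mathrm{Ran}(\Lambda_2)$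 and $\mathrm{Ran}([Y,Z])\subset\mathrm{Ran}(X)$, and $J_\Lambda(X,Y,Z)=+\infty$ otherwise. For $\mu=(\mathsf G,\mathsf q,\mathsf R)\in\mathcal M(Q,\mathbb X)$ let $\mathcal J_{\Lambda,Q}(\mu)=\int_Q J_\Lambda\big(\frac{d\mu}{d\lambda}\big)\,d\lambda$, where $\lambda$ is any finite positive measure with $|\mu|\ll\lambda$. Let $\mathsf D^*$ be a constant coefficient linear differential operator of order at most one, mapping $\mathbb S^n$-valued to $\mathbb R^{n\times k}$-valued functions on $\mathbb R^d$, with $\mathsf D^*(I)=0$. For $\mathsf G_0,\mathsf G_1\in\mathcal M(\Omega,\mathbb S^n_+)$ let $\mathcal{CE}([0,1];\mathsf G_0,\mathsf G_1)$ be the set of $(\mathsf G,\mathsf q,\mathsf R)\in\mathcal M(Q,\mathbb X)$ with $$\int_Q \partial_t\Phi\cdot d\mathsf G+\mathsf D^*\Phi\cdot d\mathsf q+\Phi\cdot d\mathsf R=\int_\Omega\Phi(1,\cdot)\cdot d\mathsf G_1-\int_\Omega\Phi(0,\cdot)\cdot d\mathsf G_0\qquad\forall\,\Phi\in C^1(Q,\mathbb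 S^n),$$ let $\mathcal{CE}_\infty([0,1];\mathsf G_0,\mathsf G_1)$ be its subset with $\mathcal J_{\Lambda,Q}<\infty$, and let $\mathrm{WB}_\Lambda(\mathsf G_0,\mathsf G_1)=\big(\inf_{\mu\in\mathcal{CE}([0,1];\mathsf G_0,\mathsf G_1)}\mathcal J_{\Lambda,Q}(\mu)\big)^{1/2}$. **Proposition.** Assume * (C.1) $\Omega$ is star-shaped with respect to a set of its points that has nonempty interior; * (C.2) $k=k_1+k_2$ and $\mathsf D^*\Phi=(\mathsf D_0^*\Phi,\mathsf D_1^*\Phi)$, where $\mathsf D_0^*\Phi\in\mathbb R^{n\times k_1}$ and $\mathsf D_1^*\Phi\in\mathbb R^{n\times k_2}$ and $\mathsf D_0^*$, $\mathsf D_1^*$ are homogeneous of degree $0$ and $1$ (that is, $\mathsf D_0^*$ involves no derivatives and $\mathsf D_1^*$ only first derivatives). Let $\mathsf G_0,\mathsf G_1\in\mathcal M(\Omega,\mathbb S^n_+)$ and $\mu=(\mathsf G,\mathsf q,\mathsf R)\in\mathcal{CE}_\infty([0,1];\mathsf G_0,\mathsf G_1)$. Then, for all sufficiently small $\varepsilon>0$,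 there exist $\mathsf G_0^\varepsilon,\mathsf G_1^\varepsilon\in\mathcal M(\Omega,\mathbb S^n_+)$ and $\mu^\varepsilon=(\mathsf G^\varepsilon,\mathsf q^\varepsilon,\mathsf R^\varepsilon)\in\mathcal{CE}_\infty([0,1];\mathsf G_0^\varepsilon,\mathsf G_1^\varepsilon)$ such that: 1. $\mathsf G_0^\varepsilon$, $\mathsf G_1^\varepsilon$ and $\mu^\varepsilon$ have $C^\infty$ densities $G_0^\varepsilon$, $G_1^\varepsilon$ and $(G^\varepsilon,q^\varepsilon,R^\varepsilon)$ with respect to Lebesgue measure on $\Omega$ and $Q$ respectively (restrictions of $C^\infty$ functions on $\mathbb R^d$ and $\mathbb R^{1+d}$), and $G^\varepsilon-cI\in\mathbb S^n_+$ on $Q$ for some $c>0$ depending on $\varepsilon$; 2. as $\varepsilon\to0$, $\mu^\varepsilon$ converges weak* to $\mu$ and $\mathcal J_{\Lambda,Q}(\mu^\varepsilon)\to\mathcal J_{\Lambda,Q}(\mu)$; 3. as $\varepsilon\to 0$, $\mathsf G_i^\varepsilon$ converges weak* to $\mathsf G_i$ for $i=0,1$. If in addition (C.3) $\mathsf G_0$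 and $\mathsf G_1$ are absolutely continuous with respect to Lebesgue measure, then also $\mathrm{WB}_\Lambda(\mathsf G_i,\mathsf G_i^\varepsilon)\to0$ and $\|\mathsf G_i-\mathsf G_i^\varepsilon\|_{\mathrm{TV}}\to0$ for $i=0,1$. -/

import Mathlib

open MeasureTheory Filter Topology
open scoped ENNReal Matrix ContDiff

noncomputable section

namespace WBTransport

/-- Real `m × m'` matrices. -/
abbrev Mat (m m' : ℕ) : Type := Matrix (Fin m) (Fin m') ℝ

/-- The physical space `ℝᵈ` with its Euclidean norm. -/
abbrev Space (d : ℕ) : Type := EuclideanSpace ℝ (Fin d)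

/-! ### Matrix-valued measures -/

/-- Countably additive matrix-valued set functions on the measurable subsets of `X`
(automatically of finite total variation). -/
abbrev MatMeasure (X : Type) [MeasurableSpace X] (m m' : ℕ) : Type :=
  VectorMeasure X (Mat m m')

section MatMeasure

variable {X : Type} [MeasurableSpace X] {m m' : ℕ}

/-- The `(i, j)` entry of a matrix-valued measure, a finite signed measure. -/
def entry (ν : MatMeasure X m m') (i : Fin m) (j : Fin m') : SignedMeasure X :=
  ν.mapRange (Matrix.entryAddMonoidHom ℝ i j) (continuous_id.matrix_elem i j)

/-- `ν` lives on `S`. Measures on a closed subset `S` of `X` are identified with the measures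
on `X` that live on `S`. -/
def LivesOn (S : Set X) (ν : MatMeasure X m m') : Prop :=
  ∀ E, MeasurableSet E → ν E = ν (E ∩ S)

/-- The pairing `⟨ν, φ⟩ = ∫ φ · dν`, where `·` is the Frobenius inner product. -/
def pairing (ν : MatMeasure X m m') (φ : X → Mat m m') : ℝ :=
  ∑ i, ∑ j, ∫ᵛ x, φ x i j ∂•(entry ν i j)

/-- The Radon–Nikodym density of `ν` with respect to `lam`, entry by entry. -/
def density (ν : MatMeasure X m m') (lam : Measure X) (x : X) : Mat m m' :=
  Matrix.of fun i j => (entry ν i j).rnDeriv lam x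

/-- A positive finite measure that dominates the variation of `ν`: the sum of the total variations
of the entries. -/
def dominating (ν : MatMeasure X m m') : Measure X :=
  ∑ i, ∑ j, (entry ν i j).totalVariation

/-- The identification of `ℝ^{m × m'}` with the Euclidean space `ℝ^{mm'}`, under which the
Frobenius norm becomes the Euclidean norm. -/
def vec (m m' : ℕ) : Mat m m' →+ EuclideanSpace ℝ (Fin m × Fin m') where
  toFun A := WithLp.toLp 2 fun p => A p.1 p.2
  map_zero' := rfl
  map_add' _ _ := rfl

theorem continuous_vec (m m' : ℕ) : Continuous (vec m m') :=
  (PiLp.continuous_toLp 2 _).comp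
    (continuous_pi fun p => continuous_id.matrix_elem p.1 p.2)

/-- The total variation norm `‖ν‖_TV`, with respect to the Frobenius norm. -/
def tvNorm (ν : MatMeasure X m m') : ℝ≥0∞ :=
  (ν.mapRange (vec m m') (continuous_vec m m')).variation Set.univ

/-- `ν` takes values in the symmetric matrices. -/
def IsSymmValued (ν : MatMeasure X m m) : Prop := ∀ E, (ν E).IsSymm

/-- `ν ∈ 𝓜(S, 𝕊ᵐ₊)`. -/
def IsPSDMeasureOn (S : Set X) (ν : MatMeasure X m m) : Prop :=
  LivesOn S ν ∧ ∀ E, (ν E).PosSemidef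

/-- Weak* convergence in `𝓜(S, ℝ^{m × m'})`, as `ε ↓ 0`. -/
def WeakStarTendsto [TopologicalSpace X] (S : Set X) (ν : ℝ → MatMeasure X m m')
    (ν₀ : MatMeasure X m m') : Prop :=
  ∀ φ : X → Mat m m', ContinuousOn φ S →
    Tendsto (fun ε => pairing (ν ε) φ) (𝓝[>] 0) (𝓝 (pairing ν₀ φ))

end MatMeasure

/-- A `C^∞`-smooth matrix-valued function. -/
def IsSmooth {V : Type} [NormedAddCommGroup V] [NormedSpace ℝ V] {m m' : ℕ}
    (g : V → Mat m m') : Prop :=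
  ∀ i j, ContDiff ℝ ∞ fun z => g z i j

/-- `ν` is the measure on `S` with density `g` with respect to Lebesgue measure. -/
def HasDensityOn {X : Type} [MeasureSpace X] {m m' : ℕ} (S : Set X) (ν : MatMeasure X m m')
    (g : X → Mat m m') : Prop :=
  ∀ E, MeasurableSet E → ∀ i j, ν E i j = ∫ z in E ∩ S, g z i j

/-! ### The action functional -/

/-- The pseudoinverse of a symmetric matrix: invert the nonzero eigenvalues in an
orthogonal eigendecomposition (recall `0⁻¹ = 0`). -/
def pinv {m : ℕ} (A : Mat m m) : Mat m m :=
  open Classical in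
  if h : A.IsHermitian then
    (h.eigenvectorUnitary : Mat m m) * Matrix.diagonal (fun i => (h.eigenvalues i)⁻¹) *
      (h.eigenvectorUnitary : Mat m m)ᵀ
  else 0

/-- The range (column space) of a matrix. -/
def ran {m m' : Type} [Fintype m'] (A : Matrix m m' ℝ) : Submodule ℝ (m → ℝ) :=
  LinearMap.range A.mulVecLin

/-- The Frobenius inner product. -/
def frob {m m' : ℕ} (A B : Mat m m') : ℝ := (Aᵀ * B).trace

/-- The action density `J_Λ(X, Y, Z)`. -/
def actionDensity {n k : ℕ} (Λ₁ : Mat k k) (Λ₂ : Mat n n)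
    (X : Mat n n) (Y : Mat n k) (Z : Mat n n) : ℝ≥0∞ :=
  open Classical in
  if X.PosSemidef ∧ ran Yᵀ ≤ ran Λ₁ ∧ ran Zᵀ ≤ ran Λ₂ ∧ ran (Matrix.fromCols Y Z) ≤ ran X then
    ENNReal.ofReal
      (1 / 2 * frob (Y * pinv Λ₁) (pinv X * Y * pinv Λ₁) +
        1 / 2 * frob (Z * pinv Λ₂) (pinv X * Z * pinv Λ₂))
  else ⊤

/-- A triple `μ = (G, q, R)` of matrix-valued measures on time-space `ℝ × ℝᵈ`. -/
structure Triple (d n k : ℕ) where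
  G : MatMeasure (ℝ × Space d) n n
  q : MatMeasure (ℝ × Space d) n k
  R : MatMeasure (ℝ × Space d) n n

/-- `μ ∈ 𝓜(S, 𝕏)` with `𝕏 = 𝕊ⁿ × ℝ^{n × k} × 𝕄ⁿ`. -/
def Triple.IsOn {d n k : ℕ} (μ : Triple d n k) (S : Set (ℝ × Space d)) : Prop :=
  LivesOn S μ.G ∧ LivesOn S μ.q ∧ LivesOn S μ.R ∧ IsSymmValued μ.G

/-- A reference measure that dominates `|μ|`. -/
def Triple.ref {d n k : ℕ} (μ : Triple d n k) : Measure (ℝ × Space d) :=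
  dominating μ.G + dominating μ.q + dominating μ.R

/-- The action `𝓙_{Λ,S}(μ) = ∫_S J_Λ(dμ/dλ) dλ`. It does not depend on the choice of the
reference measure `λ`, because `J_Λ` is positively `1`-homogeneous. -/
def action {d n k : ℕ} (Λ₁ : Mat k k) (Λ₂ : Mat n n) (S : Set (ℝ × Space d))
    (μ : Triple d n k) : ℝ≥0∞ :=
  ∫⁻ z in S, actionDensity Λ₁ Λ₂ (density μ.G μ.ref z) (density μ.q μ.ref z)
    (density μ.R μ.ref z) ∂μ.ref

/-! ### The continuity equation -/

/-- A constant coefficient linear differential operator of order at most one,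
`D* Φ = A₀ Φ + ∑ₗ Aₗ ∂ₗΦ`, from `𝕊ⁿ`-valued to `ℝ^{n × k}`-valued functions on `ℝᵈ`, with
`D*(I) = 0`. Only the values of the coefficients on symmetric matrices matter. -/
structure DiffOp (d n k : ℕ) where
  zeroth : Mat n n →ₗ[ℝ] Mat n k
  first : Fin d → (Mat n n →ₗ[ℝ] Mat n k)
  zeroth_one : zeroth 1 = 0

/-- The columns of `ℝ^{n × k}` split as `k = k₁ + k₂` in such a way that the first `k₁` columns of
`D* Φ` are homogeneous of order zero and the last `k₂` columns homogeneous of order one in `Φ`. -/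
def DiffOp.Splits {d n k : ℕ} (D : DiffOp d n k) : Prop :=
  ∃ k₁ ≤ k, ∀ A : Mat n n, A.IsSymm → ∀ (i : Fin n) (j : Fin k),
    (k₁ ≤ (j : ℕ) → D.zeroth A i j = 0) ∧ ((j : ℕ) < k₁ → ∀ l, D.first l A i j = 0)

/-- The time-space domain `Q = [0,1] × Ω`. -/
def timeSpace {d : ℕ} (Ω : Set (Space d)) : Set (ℝ × Space d) := Set.Icc (0 : ℝ) 1 ×ˢ Ω

/-- `Φ ∈ C¹(S)` with derivative `Φ'`, entry by entry: the derivative exists in the interior of `S`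
and extends continuously, by `Φ'`, to `S`. -/
def IsC1On {d n : ℕ} (S : Set (ℝ × Space d)) (Φ : ℝ × Space d → Mat n n)
    (Φ' : ℝ × Space d → Matrix (Fin n) (Fin n) (ℝ × Space d →L[ℝ] ℝ)) : Prop :=
  ∀ i j, ContinuousOn (fun z => Φ z i j) S ∧ ContinuousOn (fun z => Φ' z i j) S ∧
    ∀ z ∈ interior S, HasFDerivAt (fun z => Φ z i j) (Φ' z i j) z

/-- The derivative of a matrix-valued function in the direction `v`, read off from the derivatives
of the entries. -/
def dirDeriv {d n : ℕ} (v : ℝ × Space d)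
    (Φ' : ℝ × Space d → Matrix (Fin n) (Fin n) (ℝ × Space d →L[ℝ] ℝ)) (z : ℝ × Space d) :
    Mat n n :=
  Matrix.of fun i j => Φ' z i j v

/-- `D* Φ` at the point `z`, acting on the space variable only. -/
def DiffOp.apply {d n k : ℕ} (D : DiffOp d n k) (Φ : ℝ × Space d → Mat n n)
    (Φ' : ℝ × Space d → Matrix (Fin n) (Fin n) (ℝ × Space d →L[ℝ] ℝ)) (z : ℝ × Space d) :
    Mat n k :=
  D.zeroth (Φ z) + ∑ l, D.first l (dirDeriv (0, EuclideanSpace.single l 1) Φ' z)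

/-- The set `𝓒𝓔([0,1]; G₀, G₁)` of measures `(G, q, R) ∈ 𝓜(Q, 𝕏)` that satisfy
`∫_Q ∂ₜΦ · dG + D*Φ · dq + Φ · dR = ∫_Ω Φ₁ · dG₁ - ∫_Ω Φ₀ · dG₀` for all `Φ ∈ C¹(Q, 𝕊ⁿ)`. -/
def CE {d n k : ℕ} (Ω : Set (Space d)) (D : DiffOp d n k) (G₀ G₁ : MatMeasure (Space d) n n) :
    Set (Triple d n k) :=
  {μ | μ.IsOn (timeSpace Ω) ∧
    ∀ Φ Φ', IsC1On (timeSpace Ω) Φ Φ' → (∀ z ∈ timeSpace Ω, (Φ z).IsSymm) →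
      pairing μ.G (dirDeriv (1, 0) Φ') + pairing μ.q (D.apply Φ Φ') + pairing μ.R Φ =
        pairing G₁ (fun x => Φ (1, x)) - pairing G₀ (fun x => Φ (0, x))}

/-- The set `𝓒𝓔_∞([0,1]; G₀, G₁)` of the elements of `𝓒𝓔([0,1]; G₀, G₁)` of finite action. -/
def CEfin {d n k : ℕ} (Ω : Set (Space d)) (D : DiffOp d n k) (Λ₁ : Mat k k) (Λ₂ : Mat n n)
    (G₀ G₁ : MatMeasure (Space d) n n) : Set (Triple d n k) :=
  {μ | μ ∈ CE Ω D G₀ G₁ ∧ action Λ₁ Λ₂ (timeSpace Ω) μ < ⊤}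

/-- The weighted Wasserstein–Bures distance
`WB_Λ(G₀, G₁) = (inf {𝓙_{Λ,Q}(μ) ; μ ∈ 𝓒𝓔([0,1]; G₀, G₁)})^{1/2}`. -/
def WB {d n k : ℕ} (Ω : Set (Space d)) (D : DiffOp d n k) (Λ₁ : Mat k k) (Λ₂ : Mat n n)
    (G₀ G₁ : MatMeasure (Space d) n n) : ℝ≥0∞ :=
  (⨅ μ ∈ CE Ω D G₀ G₁, action Λ₁ Λ₂ (timeSpace Ω) μ) ^ (1 / 2 : ℝ)

/-- `Ω` is star-shaped with respect to a set of its points that has nonempty interior. -/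
def StarShaped {d : ℕ} (Ω : Set (Space d)) : Prop :=
  ∃ S ⊆ Ω, (interior S).Nonempty ∧ ∀ x ∈ S, StarConvex ℝ x Ω

end WBTransport

end

set_option linter.unusedSectionVars false

noncomputable section

namespace WBTransport

/-! ### The pseudoinverse -/

section Pinv

variable {m m' : ℕ}

/-! The regularization contracts space-time towards `(1/2, x₀)` by the factor `1 - s`, where `x₀` is
the centre of a ball with respect to which `Ω` is star-shaped, and then convolves with a smooth
kernel of width at most `s`. Star-shapedness leaves room of order `s` around the contracted domain,
so no mass leaves `Q`. The operation `moll` on measures is dual to the operation `avg` on test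
functions.

The average of a `C¹` test function is again one. Its first derivatives pick up the factor `1 - s`,
terms of order zero do not: `D*(avg Φ) = (1 - s) avg (D*Φ) + s D₀*(avg Φ)`. Inserting `avg Φ` into
the equation for `μ` shows that `(1 - s) moll G`, `(1 - s) moll q` and `moll R + s moll (D₀ q)`
solve the equation, with `D₀` the adjoint of `D₀*`, except that the boundary data are smeared over
time layers around `s/2` and `1 - s/2`. They are carried to the times `0` and `1` by adding to `G`
the density `(1 - χ₀) m₀ + χ₁ m₁`, where `m₀`, `m₁` are the spatial mollifications of `G₀`, `G₁` and
`χ₀`, `χ₁` are primitives of the translated time kernel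
(`IsKernelPair.integral_timeDeriv_mul_cutoff`). Adding a time-independent multiple `β(x) I` to `G`
and to both end points keeps the equation.

The action is controlled by writing `J_Λ` as a supremum of linear functionals
(`actionDensity_eq_iSup`). Hence `J_Λ` is subadditive and 1-homogeneous and satisfies Jensen's
inequality under mollification; moreover it vanishes at `(X, 0, 0)`. The regularized action is
therefore at most `(1 - s)⁻¹` times the original one plus the integral of `J_Λ(β I, 0, s moll (D₀
q))`. Let `M` be the space-time mollification of `|q|` and `m` the spatial mollification of its
marginal. The last entry is bounded by a multiple of `s M`, and `s M ≤ 4 m` because the time kernel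
is at most `4 / s`. With `β = √s m + s` one gets `(s M)² / β ≤ 4 √s M`, whose integral is of order
`√s`. The summand `s` of `β` gives uniform positivity. Together with weak* lower semicontinuity
(`eventually_lt_action`) this yields convergence of the action.

For absolutely continuous end points the densities converge in `L¹`. The distance of two measures
with densities `A`, `B` is at most a constant times the square root of the `L¹` distance
(`exists_WB_le`): interpolate with `q = 0` and `R = ∂ₜG`, adding to `G` a multiple of the identity
proportional to `|A - B|` that pays for `R`. -/

theorem isHermitian_iff_isSymm (A : Mat m m) : A.IsHermitian ↔ A.IsSymm := by
  rw [Matrix.IsHermitian, Matrix.conjTranspose_eq_transpose_of_trivial, Matrix.IsSymm]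

theorem _root_.Matrix.PosSemidef.isSymm_real {A : Mat m m} (hA : A.PosSemidef) : A.IsSymm :=
  (isHermitian_iff_isSymm A).1 hA.isHermitian

/-- Later arguments about `pinv` rest on these Penrose identities. In an eigenbasis they are scalar
identities for `e` and `e⁻¹`, true also at `e = 0` because `0⁻¹ = 0`. -/
theorem pinv_identities {A : Mat m m} (hA : A.IsSymm) :
    A * pinv A * A = A ∧ pinv A * A * pinv A = pinv A ∧ (pinv A)ᵀ = pinv A ∧
      A * pinv A = pinv A * A := by
  have h : A.IsHermitian := (isHermitian_iff_isSymm A).2 hA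
  set Q : Mat m m := (h.eigenvectorUnitary : Mat m m) with hQ
  set e := h.eigenvalues with he
  have hQQ : Qᵀ * Q = 1 := by
    have := Matrix.mem_unitaryGroup_iff'.1 h.eigenvectorUnitary.2
    rwa [Matrix.star_eq_conjTranspose, Matrix.conjTranspose_eq_transpose_of_trivial] at this
  have hAe : A = Q * Matrix.diagonal e * Qᵀ := by
    have := h.spectral_theorem
    rw [Unitary.conjStarAlgAut_apply, Matrix.star_eq_conjTranspose,
      Matrix.conjTranspose_eq_transpose_of_trivial] at this
    exact this
  have hp : pinv A = Q * Matrix.diagonal (fun i => (e i)⁻¹) * Qᵀ := by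
    rw [pinv, dif_pos h]
  have key : ∀ a b : Fin m → ℝ, (Q * Matrix.diagonal a * Qᵀ) * (Q * Matrix.diagonal b * Qᵀ) =
      Q * Matrix.diagonal (fun i => a i * b i) * Qᵀ := by
    intro a b
    calc _ = Q * Matrix.diagonal a * (Qᵀ * Q) * Matrix.diagonal b * Qᵀ := by
          simp only [Matrix.mul_assoc]
      _ = _ := by rw [hQQ, Matrix.mul_one, Matrix.mul_assoc Q, Matrix.diagonal_mul_diagonal]
  rw [hp]
  refine ⟨?_, ?_, ?_, ?_⟩
  · nth_rewrite 1 2 3 [hAe]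
    rw [key, key]
    congr 3
    ext i
    by_cases hi : e i = 0 <;> simp [hi]
  · nth_rewrite 1 [hAe]
    rw [key, key]
    congr 3
    ext i
    by_cases hi : e i = 0 <;> simp [hi]
  · simp [Matrix.transpose_mul, Matrix.mul_assoc]
  · nth_rewrite 1 2 [hAe]
    rw [key, key]
    congr 3
    ext i
    ring

/-- `A * pinv A` is the orthogonal projection onto the range of `A`. This turns the range conditions
in the action density into matrix identities. -/
theorem ran_le_iff {A : Mat m m} (hA : A.IsSymm) (B : Mat m m') :
    ran B ≤ ran A ↔ A * pinv A * B = B := by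
  constructor
  · intro h
    have hcol : ∀ v, ∃ w, A *ᵥ w = B *ᵥ v := fun v => h ⟨v, rfl⟩
    have hv : ∀ v, (A * pinv A * B) *ᵥ v = B *ᵥ v := by
      intro v
      obtain ⟨w, hw⟩ := hcol v
      rw [← Matrix.mulVec_mulVec, ← hw, Matrix.mulVec_mulVec, (pinv_identities hA).1]
    exact Matrix.ext_of_mulVec_single fun i => hv _
  · rintro h _ ⟨v, rfl⟩
    refine ⟨(pinv A * B) *ᵥ v, ?_⟩
    simp only [Matrix.mulVecLin_apply, Matrix.mulVec_mulVec, ← Matrix.mul_assoc, h]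

theorem ran_fromCols_le_iff {m₁ m₂ : ℕ} (A : Mat m m') (B : Mat m m₁) (C : Mat m m₂) :
    ran (Matrix.fromCols B C) ≤ ran A ↔ ran B ≤ ran A ∧ ran C ≤ ran A := by
  constructor
  · refine fun h => ⟨?_, ?_⟩
    · rintro _ ⟨v, rfl⟩
      exact h ⟨Sum.elim v 0, by simp [Matrix.fromCols_mulVec]⟩
    · rintro _ ⟨v, rfl⟩
      exact h ⟨Sum.elim 0 v, by simp [Matrix.fromCols_mulVec]⟩
  · rintro ⟨h₁, h₂⟩ _ ⟨v, rfl⟩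
    simp only [Matrix.mulVecLin_apply, Matrix.fromCols_mulVec]
    exact Submodule.add_mem _ (h₁ ⟨_, rfl⟩) (h₂ ⟨_, rfl⟩)

end Pinv

/-! ### The Frobenius inner product -/

section Frob

variable {m m' : ℕ}

theorem frob_eq_sum (A B : Mat m m') : frob A B = ∑ i, ∑ j, A i j * B i j := by
  rw [frob, Matrix.trace, Finset.sum_comm]
  simp [Matrix.mul_apply]

theorem frob_self_nonneg (A : Mat m m') : 0 ≤ frob A A := by
  rw [frob_eq_sum]
  exact Finset.sum_nonneg fun i _ => Finset.sum_nonneg fun j _ => mul_self_nonneg _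

theorem eq_zero_of_frob_self {A : Mat m m'} (h : frob A A = 0) : A = 0 := by
  rw [frob_eq_sum] at h
  ext i j
  have h₁ := (Finset.sum_eq_zero_iff_of_nonneg
    fun i _ => Finset.sum_nonneg fun j _ => mul_self_nonneg (A i j)).1 h i (Finset.mem_univ _)
  exact mul_self_eq_zero.1 ((Finset.sum_eq_zero_iff_of_nonneg
    fun j _ => mul_self_nonneg (A i j)).1 h₁ j (Finset.mem_univ _))

theorem frob_add_left (A B C : Mat m m') : frob (A + B) C = frob A C + frob B C := by
  simp [frob, Matrix.add_mul]

theorem frob_add_right (A B C : Mat m m') : frob A (B + C) = frob A B + frob A C := by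
  simp [frob, Matrix.mul_add]

theorem frob_smul_left (c : ℝ) (A B : Mat m m') : frob (c • A) B = c * frob A B := by
  simp [frob]

theorem frob_smul_right (c : ℝ) (A B : Mat m m') : frob A (c • B) = c * frob A B := by
  simp [frob]

theorem frob_mul_transpose (X : Mat m m) (hX : X.IsSymm) (W : Mat m m') :
    frob X (W * Wᵀ) = frob W (X * W) := by
  rw [frob, frob, hX, ← Matrix.mul_assoc, Matrix.trace_mul_comm]

theorem frob_mul_self_nonneg {X : Mat m m} (hX : X.PosSemidef) (W : Mat m m') :
    0 ≤ frob W (X * W) := by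
  have h := (hX.conjTranspose_mul_mul_same W).trace_nonneg
  rwa [Matrix.conjTranspose_eq_transpose_of_trivial, Matrix.mul_assoc] at h

end Frob

/-! ### The dual formula for the action density -/

section Dual

variable {n k : ℕ}

/-- The affine functionals whose supremum is the action density. -/
def dualForm (Λ₁ : Mat k k) (Λ₂ : Mat n n) (p : Mat n k × Mat n n)
    (X : Mat n n) (Y : Mat n k) (Z : Mat n n) : ℝ :=
  frob p.1 Y + frob p.2 Z -
    1 / 2 * (frob X (p.1 * Λ₁ * (p.1 * Λ₁)ᵀ) + frob X (p.2 * Λ₂ * (p.2 * Λ₂)ᵀ))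

/-- Completing the square. With `P = X†YΛ†` the range conditions give `Y = X P Λ`, and the claim is
the expansion of `(UΛ - P) · X(UΛ - P) ≥ 0`. -/
theorem half_quadratic_bound {k' : ℕ} {X : Mat n n} (hX : X.PosSemidef) {Λ : Mat k' k'}
    (hΛ : Λ.IsSymm) {Y : Mat n k'} (h₁ : Λ * pinv Λ * Yᵀ = Yᵀ) (h₂ : X * pinv X * Y = Y)
    (U : Mat n k') :
    frob U Y - 1 / 2 * frob X (U * Λ * (U * Λ)ᵀ) ≤
      1 / 2 * frob (Y * pinv Λ) (pinv X * Y * pinv Λ) := by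
  have hXs : X.IsSymm := hX.isSymm_real
  obtain ⟨-, hp2, hp3, hp4⟩ := pinv_identities hXs
  obtain ⟨-, -, hl3, hl4⟩ := pinv_identities hΛ
  set P := pinv X * Y * pinv Λ with hP
  have hXP : X * P = Y * pinv Λ := by
    rw [hP, ← Matrix.mul_assoc, ← Matrix.mul_assoc, h₂]
  have hYΛ : Y = X * P * Λ := by
    have := congrArg Matrix.transpose h₁
    simp only [Matrix.transpose_mul, Matrix.transpose_transpose, hl3, hΛ.eq] at this
    rw [hXP, Matrix.mul_assoc]
    exact this.symm
  have e1 : frob (Y * pinv Λ) P = frob P (X * P) := by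
    rw [← hXP, frob, frob, Matrix.transpose_mul, hXs.eq, Matrix.mul_assoc]
  have e2 : frob U Y = frob (U * Λ) (X * P) := by
    rw [hYΛ, frob, frob, Matrix.transpose_mul, hΛ.eq, ← Matrix.mul_assoc, Matrix.trace_mul_comm,
      ← Matrix.mul_assoc]
  have e3 : frob X (U * Λ * (U * Λ)ᵀ) = frob (U * Λ) (X * (U * Λ)) :=
    frob_mul_transpose X hXs _
  have e4 : frob P (X * (U * Λ)) = frob (U * Λ) (X * P) := by
    rw [frob, frob, ← Matrix.trace_transpose]
    simp only [Matrix.transpose_mul, Matrix.transpose_transpose, hXs.eq, Matrix.mul_assoc]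
  have h := frob_mul_self_nonneg hX (U * Λ + (-1 : ℝ) • P)
  rw [Matrix.mul_add, frob_add_left, frob_add_right, frob_add_right, Matrix.mul_smul,
    frob_smul_left, frob_smul_left, frob_smul_right, frob_smul_right, e4] at h
  rw [e1, e2, e3]
  linarith

/-- The square in `half_quadratic_bound` vanishes when `UΛ = P`, which holds for `U = X†YΛ†Λ†`. -/
theorem half_quadratic_attained {k' : ℕ} {X : Mat n n} (hX : X.IsSymm) {Λ : Mat k' k'}
    (hΛ : Λ.IsSymm) {Y : Mat n k'} (h₂ : X * pinv X * Y = Y) :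
    frob (pinv X * Y * pinv Λ * pinv Λ) Y -
        1 / 2 * frob X (pinv X * Y * pinv Λ * pinv Λ * Λ * (pinv X * Y * pinv Λ * pinv Λ * Λ)ᵀ) =
      1 / 2 * frob (Y * pinv Λ) (pinv X * Y * pinv Λ) := by
  obtain ⟨-, -, hp3, -⟩ := pinv_identities hX
  obtain ⟨-, hl2, hl3, hl4⟩ := pinv_identities hΛ
  have e0 : pinv X * Y * pinv Λ * pinv Λ * Λ = pinv X * Y * pinv Λ := by
    rw [Matrix.mul_assoc _ (pinv Λ) Λ, Matrix.mul_assoc _ (pinv Λ), ← hl4]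
    simp only [Matrix.mul_assoc] at hl2 ⊢
    rw [hl2]
  have hXP : X * (pinv X * Y * pinv Λ) = Y * pinv Λ := by
    rw [← Matrix.mul_assoc, ← Matrix.mul_assoc, h₂]
  rw [e0, frob_mul_transpose X hX, hXP]
  have e1 : frob (pinv X * Y * pinv Λ) (Y * pinv Λ) = frob (Y * pinv Λ) (pinv X * Y * pinv Λ) := by
    simp only [frob_eq_sum, mul_comm]
  have e2 : frob (pinv X * Y * pinv Λ * pinv Λ) Y = frob (pinv X * Y * pinv Λ) (Y * pinv Λ) := by
    rw [frob, frob, Matrix.transpose_mul _ (pinv Λ), hl3, Matrix.mul_assoc,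
      Matrix.trace_mul_comm, Matrix.mul_assoc]
  rw [e2, e1]
  ring

/-- If `U ↦ U·Y - ½ X·(UΛ)(UΛ)ᵀ` is bounded above, then `Y` satisfies the range conditions. -/
theorem range_conditions_of_bounded {k' : ℕ} {X : Mat n n} (hX : X.IsSymm) {Λ : Mat k' k'}
    (hΛ : Λ.IsSymm) {Y : Mat n k'} {M : ℝ}
    (hM : ∀ U : Mat n k', frob U Y - 1 / 2 * frob X (U * Λ * (U * Λ)ᵀ) ≤ M) :
    Λ * pinv Λ * Yᵀ = Yᵀ ∧ X * pinv X * Y = Y := by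
  -- Along a line on which the quadratic term vanishes the functional is linear, so boundedness
  -- above forces a nonpositive slope.
  have hline : ∀ U : Mat n k', frob X (U * Λ * (U * Λ)ᵀ) = 0 → frob U Y ≤ 0 := by
    intro U hU
    by_contra! hpos
    have h := hM (((M + 1) / frob U Y) • U)
    have e : frob X ((((M + 1) / frob U Y) • U) * Λ * ((((M + 1) / frob U Y) • U) * Λ)ᵀ) = 0 := by
      simp only [Matrix.smul_mul, Matrix.transpose_smul, Matrix.mul_smul, frob_smul_right, hU,
        mul_zero]
    rw [e, frob_smul_left, div_mul_cancel₀ _ hpos.ne'] at h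
    linarith
  obtain ⟨hx1, hx2, hx3, hx4⟩ := pinv_identities hX
  obtain ⟨hl1, hl2, hl3, hl4⟩ := pinv_identities hΛ
  constructor
  -- `U` is the part of `Y` whose rows lie in the kernel of `Λ`. It is orthogonal to the rest of
  -- `Y`, so `U · U = U · Y ≤ 0`.
  · set U := Y - Y * pinv Λ * Λ with hU
    have hUΛ : U * Λ = 0 := by
      rw [hU, Matrix.sub_mul, Matrix.mul_assoc Y, ← hl4, Matrix.mul_assoc Y, hl1, sub_self]
    have h0 := hline U (by simp [hUΛ, frob])
    have h1 : frob U (Y * pinv Λ * Λ) = 0 := by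
      have : frob U (Y * pinv Λ * Λ) = frob (U * Λ) (Y * pinv Λ) := by
        rw [frob, frob, Matrix.transpose_mul, hΛ.eq, ← Matrix.mul_assoc, Matrix.trace_mul_comm,
          Matrix.mul_assoc]
      rw [this, hUΛ]
      simp [frob]
    have h2 : frob U U = frob U Y := by
      have : Y = U + Y * pinv Λ * Λ := by rw [hU]; abel
      conv_rhs => rw [this]
      rw [frob_add_right, h1, add_zero]
    have h3 : U = 0 := eq_zero_of_frob_self (le_antisymm (h2.trans_le h0) (frob_self_nonneg U))
    rw [hU, sub_eq_zero] at h3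
    nth_rewrite 2 [h3]
    simp only [Matrix.transpose_mul, hl3, hΛ.eq, Matrix.mul_assoc]
  -- The same argument with the part of `Y` whose columns lie in the kernel of `X`.
  · set U := Y - X * pinv X * Y with hU
    have hXU : X * U = 0 := by
      rw [hU, Matrix.mul_sub, hx4, ← Matrix.mul_assoc, ← Matrix.mul_assoc, hx1, sub_self]
    have h0 := hline U (by
      rw [frob_mul_transpose X hX, ← Matrix.mul_assoc, hXU]
      simp [frob])
    have h1 : frob U (X * pinv X * Y) = 0 := by
      have : frob U (X * pinv X * Y) = frob (X * U) (pinv X * Y) := by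
        rw [frob, frob, Matrix.transpose_mul, hX.eq]
        simp only [Matrix.mul_assoc]
      rw [this, hXU]
      simp [frob]
    have h2 : frob U U = frob U Y := by
      have : Y = U + X * pinv X * Y := by rw [hU]; abel
      conv_rhs => rw [this]
      rw [frob_add_right, h1, add_zero]
    have h3 : U = 0 := eq_zero_of_frob_self (le_antisymm (h2.trans_le h0) (frob_self_nonneg U))
    rw [hU, sub_eq_zero] at h3
    exact h3.symm

/-- A vector `x` with `x · Xx < 0` would make the functional grow quadratically. Since `Λ` is
invertible, `VΛ` can be any rank-one matrix with column space spanned by `x`. -/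
theorem posSemidef_of_bounded {X : Mat n n} (hX : X.IsSymm) {Λ : Mat n n} (hΛ : Λ.PosDef)
    {Z : Mat n n} {M : ℝ}
    (hM : ∀ V : Mat n n, frob V Z - 1 / 2 * frob X (V * Λ * (V * Λ)ᵀ) ≤ M) : X.PosSemidef := by
  refine Matrix.PosSemidef.of_dotProduct_mulVec_nonneg ((isHermitian_iff_isSymm X).2 hX)
    fun x => ?_
  simp only [star_trivial]
  by_contra! hneg
  have hdet : IsUnit Λ.det := hΛ.det_pos.ne'.isUnit
  rcases isEmpty_or_nonempty (Fin n) with hn | ⟨⟨i₀⟩⟩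
  · simp [dotProduct] at hneg
  set W : Mat n n := Matrix.vecMulVec x (Pi.single i₀ 1) with hW
  have hquad : ∀ c : ℝ, frob X ((c • (W * Λ⁻¹)) * Λ * ((c • (W * Λ⁻¹)) * Λ)ᵀ) =
      c ^ 2 * (x ⬝ᵥ (X *ᵥ x)) := by
    intro c
    have : W * Λ⁻¹ * Λ = W := by rw [Matrix.mul_assoc, Matrix.nonsing_inv_mul _ hdet, Matrix.mul_one]
    rw [Matrix.smul_mul, this, Matrix.transpose_smul, Matrix.smul_mul, Matrix.mul_smul,
      frob_smul_right, frob_smul_right, hW, Matrix.transpose_vecMulVec,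
      Matrix.vecMulVec_mul_vecMulVec]
    simp only [single_one_dotProduct, Pi.single_eq_same, one_smul]
    have : frob X (Matrix.vecMulVec x x) = x ⬝ᵥ (X *ᵥ x) := by
      simp only [frob_eq_sum, Matrix.vecMulVec_apply, dotProduct, Matrix.mulVec, Finset.mul_sum]
      exact Finset.sum_congr rfl fun i _ => Finset.sum_congr rfl fun j _ => by ring
    rw [this]
    ring
  set a := frob (W * Λ⁻¹) Z
  set b := -(x ⬝ᵥ (X *ᵥ x)) with hb
  have hbpos : 0 < b := by linarith
  have h : ∀ c : ℝ, c * a + 1 / 2 * (c ^ 2 * b) ≤ M := fun c => by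
    have := hM (c • (W * Λ⁻¹))
    rw [hquad, frob_smul_left] at this
    rw [hb]
    linarith
  -- Opposite values of `c` cancel the linear term and leave `c² b ≤ 2 M`; the chosen `c` is large
  -- enough to violate this.
  have h1 := h ((2 * |M| + 2) / b + 1)
  have h2 := h (-((2 * |M| + 2) / b + 1))
  have h3 : (2 * |M| + 2) / b * b = 2 * |M| + 2 := div_mul_cancel₀ _ hbpos.ne'
  have h4 : 0 ≤ (2 * |M| + 2) / b := by positivity
  have h5 := le_abs_self M
  nlinarith [mul_nonneg h4 h4, abs_nonneg M, mul_nonneg (mul_nonneg h4 h4) hbpos.le]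

/-- Convex duality. Each functional `dualForm` is linear in `(X, Y, Z)`, so subadditivity,
homogeneity, Jensen's inequality and lower semicontinuity can all be read off from this formula.
Outside the domain of `J_Λ` the supremum is infinite, because a finite supremum would force
positivity and the range conditions. -/
theorem actionDensity_eq_iSup {Λ₁ : Mat k k} (hΛ₁ : Λ₁.PosSemidef) {Λ₂ : Mat n n}
    (hΛ₂ : Λ₂.PosDef) {X : Mat n n} (hX : X.IsSymm) (Y : Mat n k) (Z : Mat n n) :
    actionDensity Λ₁ Λ₂ X Y Z =
      ⨆ p : Mat n k × Mat n n, ENNReal.ofReal (dualForm Λ₁ Λ₂ p X Y Z) := by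
  have hs₁ : Λ₁.IsSymm := hΛ₁.isSymm_real
  have hs₂ : Λ₂.IsSymm := hΛ₂.posSemidef.isSymm_real
  rw [actionDensity, ran_le_iff hs₁, ran_le_iff hs₂, ran_fromCols_le_iff, ran_le_iff hX,
    ran_le_iff hX]
  split_ifs with h
  · obtain ⟨hXp, h₁, h₂, h₃, h₄⟩ := h
    refine le_antisymm ?_ (iSup_le fun p => ENNReal.ofReal_le_ofReal ?_)
    · refine le_iSup_of_le (pinv X * Y * pinv Λ₁ * pinv Λ₁, pinv X * Z * pinv Λ₂ * pinv Λ₂)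
        (ENNReal.ofReal_le_ofReal ?_)
      rw [← half_quadratic_attained hX hs₁ h₃, ← half_quadratic_attained hX hs₂ h₄, dualForm]
      linarith
    · have e₁ := half_quadratic_bound hXp hs₁ h₁ h₃ p.1
      have e₂ := half_quadratic_bound hXp hs₂ h₂ h₄ p.2
      rw [dualForm]
      linarith
  · symm
    by_contra hne
    refine h ?_
    set S := ⨆ p : Mat n k × Mat n n, ENNReal.ofReal (dualForm Λ₁ Λ₂ p X Y Z)
    have hb : ∀ p, dualForm Λ₁ Λ₂ p X Y Z ≤ S.toReal := fun p =>
      (ENNReal.ofReal_le_iff_le_toReal hne).1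
        (le_iSup (fun p => ENNReal.ofReal (dualForm Λ₁ Λ₂ p X Y Z)) p)
    have hb₁ : ∀ U : Mat n k, frob U Y - 1 / 2 * frob X (U * Λ₁ * (U * Λ₁)ᵀ) ≤ S.toReal := by
      intro U
      simpa [dualForm, frob] using hb (U, 0)
    have hb₂ : ∀ V : Mat n n, frob V Z - 1 / 2 * frob X (V * Λ₂ * (V * Λ₂)ᵀ) ≤ S.toReal := by
      intro V
      simpa [dualForm, frob] using hb (0, V)
    have h₁ := range_conditions_of_bounded hX hs₁ hb₁
    have h₂ := range_conditions_of_bounded hX hs₂ hb₂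
    exact ⟨posSemidef_of_bounded hX hΛ₂ hb₂, h₁.1, h₂.1, h₁.2, h₂.2⟩

end Dual

end WBTransport

end

noncomputable section

namespace WBTransport

/-! ### Properties of the action density -/

section ActionDensity

variable {n k : ℕ} {Λ₁ : Mat k k} {Λ₂ : Mat n n}

theorem dualForm_add (p : Mat n k × Mat n n) (X X' : Mat n n) (Y Y' : Mat n k) (Z Z' : Mat n n) :
    dualForm Λ₁ Λ₂ p (X + X') (Y + Y') (Z + Z') =
      dualForm Λ₁ Λ₂ p X Y Z + dualForm Λ₁ Λ₂ p X' Y' Z' := by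
  simp only [dualForm, frob_add_left, frob_add_right]
  ring

theorem dualForm_smul (p : Mat n k × Mat n n) (c : ℝ) (X : Mat n n) (Y : Mat n k) (Z : Mat n n) :
    dualForm Λ₁ Λ₂ p (c • X) (c • Y) (c • Z) = c * dualForm Λ₁ Λ₂ p X Y Z := by
  simp only [dualForm, frob_smul_left, frob_smul_right]
  ring

theorem ofReal_dualForm_le (hΛ₁ : Λ₁.PosSemidef) (hΛ₂ : Λ₂.PosDef) {X : Mat n n} (hX : X.IsSymm)
    (Y : Mat n k) (Z : Mat n n) (p : Mat n k × Mat n n) :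
    ENNReal.ofReal (dualForm Λ₁ Λ₂ p X Y Z) ≤ actionDensity Λ₁ Λ₂ X Y Z := by
  rw [actionDensity_eq_iSup hΛ₁ hΛ₂ hX]
  exact le_iSup (fun p => ENNReal.ofReal (dualForm Λ₁ Λ₂ p X Y Z)) p

theorem actionDensity_le_of_dualForm_le (hΛ₁ : Λ₁.PosSemidef) (hΛ₂ : Λ₂.PosDef) {X : Mat n n}
    (hX : X.IsSymm) {Y : Mat n k} {Z : Mat n n} {M : ℝ≥0∞}
    (h : ∀ p, ENNReal.ofReal (dualForm Λ₁ Λ₂ p X Y Z) ≤ M) : actionDensity Λ₁ Λ₂ X Y Z ≤ M := by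
  rw [actionDensity_eq_iSup hΛ₁ hΛ₂ hX]
  exact iSup_le h

theorem actionDensity_add_le (hΛ₁ : Λ₁.PosSemidef) (hΛ₂ : Λ₂.PosDef) {X X' : Mat n n}
    (hX : X.IsSymm) (hX' : X'.IsSymm) (Y Y' : Mat n k) (Z Z' : Mat n n) :
    actionDensity Λ₁ Λ₂ (X + X') (Y + Y') (Z + Z') ≤
      actionDensity Λ₁ Λ₂ X Y Z + actionDensity Λ₁ Λ₂ X' Y' Z' := by
  refine actionDensity_le_of_dualForm_le hΛ₁ hΛ₂ (hX.add hX') fun p => ?_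
  rw [dualForm_add]
  exact ENNReal.ofReal_add_le.trans (add_le_add (ofReal_dualForm_le hΛ₁ hΛ₂ hX _ _ _)
    (ofReal_dualForm_le hΛ₁ hΛ₂ hX' _ _ _))

theorem actionDensity_smul (hΛ₁ : Λ₁.PosSemidef) (hΛ₂ : Λ₂.PosDef) {X : Mat n n}
    (hX : X.IsSymm) (Y : Mat n k) (Z : Mat n n) {c : ℝ} (hc : 0 ≤ c) :
    actionDensity Λ₁ Λ₂ (c • X) (c • Y) (c • Z) =
      ENNReal.ofReal c * actionDensity Λ₁ Λ₂ X Y Z := by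
  rw [actionDensity_eq_iSup hΛ₁ hΛ₂ hX, actionDensity_eq_iSup hΛ₁ hΛ₂ (hX.smul c), ENNReal.mul_iSup]
  simp_rw [dualForm_smul, ENNReal.ofReal_mul hc]

theorem actionDensity_eq_top (X : Mat n n) (Y : Mat n k) (Z : Mat n n) (hX : ¬X.PosSemidef) :
    actionDensity Λ₁ Λ₂ X Y Z = ⊤ := by
  rw [actionDensity, if_neg fun h => hX h.1]

theorem actionDensity_zero_zero {X : Mat n n} (hX : X.PosSemidef) :
    actionDensity Λ₁ Λ₂ X (0 : Mat n k) 0 = 0 := by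
  have h0 : ∀ {m m' m'' : ℕ} (A : Mat m m''), ran (0 : Mat m m') ≤ ran A := by
    rintro m m' m'' A _ ⟨v, rfl⟩
    simp
  rw [actionDensity, if_pos]
  · simp [frob]
  · simp only [Matrix.transpose_zero]
    exact ⟨hX, h0 _, h0 _, (ran_fromCols_le_iff _ _ _).2 ⟨h0 _, h0 _⟩⟩

/-- Substitute the dual variables `(c² U, c V)` in the bound for `(X, Y, Z)` and use `c³ ≤ c`. It
serves for the regularized triple, in which `G` and `q` carry the factor `1 - s` but `R` does not.
-/
theorem actionDensity_shrink (hΛ₁ : Λ₁.PosSemidef) (hΛ₂ : Λ₂.PosDef) {X : Mat n n}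
    (hX : X.IsSymm) (Y : Mat n k) (Z : Mat n n) {c : ℝ} (hc : 0 < c) (hc1 : c ≤ 1) :
    actionDensity Λ₁ Λ₂ (c • X) (c • Y) Z ≤ ENNReal.ofReal c⁻¹ * actionDensity Λ₁ Λ₂ X Y Z := by
  by_cases hXp : X.PosSemidef
  swap
  · rw [actionDensity_eq_top X Y Z hXp, ENNReal.mul_top]
    · exact le_top
    · simpa using hc
  refine actionDensity_le_of_dualForm_le hΛ₁ hΛ₂ (hX.smul c) fun p => ?_
  refine le_trans ?_ (mul_le_mul_right (ofReal_dualForm_le hΛ₁ hΛ₂ hX Y Z (c ^ 2 • p.1, c • p.2)) _)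
  rw [← ENNReal.ofReal_mul (by positivity)]
  refine ENNReal.ofReal_le_ofReal ?_
  simp only [dualForm, frob_smul_left, frob_smul_right, Matrix.smul_mul, Matrix.transpose_smul,
    Matrix.mul_smul]
  have h1 : 0 ≤ frob X (p.1 * Λ₁ * (p.1 * Λ₁)ᵀ) := by
    rw [frob_mul_transpose X hX]
    exact frob_mul_self_nonneg hXp _
  set a := frob X (p.1 * Λ₁ * (p.1 * Λ₁)ᵀ)
  set b := frob X (p.2 * Λ₂ * (p.2 * Λ₂)ᵀ)
  set u := frob p.1 Y
  set v := frob p.2 Z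
  have e : c⁻¹ * (c ^ 2 * u + c * v - 1 / 2 * (c ^ 2 * (c ^ 2 * a) + c * (c * b))) =
      c * u + v - 1 / 2 * (c ^ 3 * a + c * b) := by
    field_simp
  rw [e]
  have h2 : c ^ 3 ≤ c := by nlinarith [mul_nonneg hc.le hc.le]
  nlinarith [mul_le_mul_of_nonneg_right h2 h1]

/-- For a multiple of the identity, `J_Λ(βI, 0, Z)` is of the order `|Z|² / β`. The condition `e² ≤
βκ` expresses `|Z|² / β ≤ κ` without a division and so includes `β = 0`. -/
theorem exists_actionDensity_scalar_le (hΛ₁ : Λ₁.PosSemidef) (hΛ₂ : Λ₂.PosDef) :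
    ∃ C : ℝ, 0 ≤ C ∧ ∀ (β e κ : ℝ) (Z : Mat n n), 0 ≤ β → 0 ≤ κ → (∀ i j, |Z i j| ≤ e) →
      e ^ 2 ≤ β * κ →
      actionDensity Λ₁ Λ₂ (β • (1 : Mat n n)) (0 : Mat n k) Z ≤ ENNReal.ofReal (C * κ) := by
  have hdet : IsUnit Λ₂.det := hΛ₂.det_pos.ne'.isUnit
  set M := Λ₂⁻¹ with hM
  set C₀ : ℝ := ∑ _i : Fin n, ∑ j, (∑ l, |M j l|) ^ 2 with hC₀
  have hC₀n : 0 ≤ C₀ := Finset.sum_nonneg fun i _ => Finset.sum_nonneg fun j _ => sq_nonneg _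
  refine ⟨1 / 2 * C₀, by positivity, fun β e κ Z hβ hκ hZ he => ?_⟩
  refine actionDensity_le_of_dualForm_le hΛ₁ hΛ₂ (Matrix.isSymm_one.smul β) fun p =>
    ENNReal.ofReal_le_ofReal ?_
  set W := p.2 * Λ₂ with hW
  set T := Z * Mᵀ with hT
  -- After the substitution `W = VΛ₂` the linear term becomes `W · T` with `T = Z Λ₂⁻ᵀ`, and `C₀` is
  -- the constant comparing `|T|²` with the largest entry of `Z`.
  have hTe : frob T T ≤ C₀ * e ^ 2 := by
    rw [frob_eq_sum, hC₀, Finset.sum_mul]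
    refine Finset.sum_le_sum fun i _ => ?_
    rw [Finset.sum_mul]
    refine Finset.sum_le_sum fun j _ => ?_
    have h : |T i j| ≤ (∑ l, |M j l|) * e := by
      rw [hT, Matrix.mul_apply, Finset.sum_mul]
      refine (Finset.abs_sum_le_sum_abs _ _).trans (Finset.sum_le_sum fun l _ => ?_)
      rw [abs_mul, Matrix.transpose_apply, mul_comm]
      exact mul_le_mul_of_nonneg_left (hZ i l) (abs_nonneg _)
    rw [← abs_mul_abs_self, ← sq, ← mul_pow]
    exact pow_le_pow_left₀ (abs_nonneg _) h 2
  have hVZ : frob p.2 Z = frob W T := by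
    have : p.2 = W * M := by rw [hW, hM, Matrix.mul_assoc, Matrix.mul_nonsing_inv _ hdet, Matrix.mul_one]
    rw [this, hT, frob, frob, Matrix.transpose_mul, Matrix.mul_assoc, Matrix.trace_mul_comm,
      Matrix.mul_assoc]
  have hquad : ∀ {m : ℕ} (U : Mat n m), frob (β • (1 : Mat n n)) (U * Uᵀ) = β * frob U U := by
    intro m U
    rw [frob_smul_left, frob_mul_transpose _ Matrix.isSymm_one, Matrix.one_mul]
  rw [dualForm, hquad, hquad, ← hW, hVZ]
  have h0 : frob p.1 (0 : Mat n k) = 0 := by simp [frob]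
  have h1 := mul_nonneg hβ (frob_self_nonneg (p.1 * Λ₁))
  have hcomm : frob T W = frob W T := by simp only [frob_eq_sum, mul_comm]
  have hsq := frob_self_nonneg (β • W + (-1 : ℝ) • T)
  rw [frob_add_left, frob_add_right, frob_add_right] at hsq
  simp only [frob_smul_left, frob_smul_right, hcomm] at hsq
  rw [h0]
  suffices frob W T - 1 / 2 * (β * frob W W) ≤ 1 / 2 * C₀ * κ by linarith
  rcases hβ.eq_or_lt with rfl | hβ
  · have hT0 : frob T T ≤ 0 := by nlinarith
    have : T = 0 := eq_zero_of_frob_self (le_antisymm hT0 (frob_self_nonneg T))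
    rw [this]
    have : frob W (0 : Mat n n) = 0 := by simp [frob]
    rw [this]
    nlinarith [mul_nonneg hC₀n hκ]
  · have h3 : C₀ * e ^ 2 ≤ C₀ * (β * κ) := mul_le_mul_of_nonneg_left he hC₀n
    have h4 : β * (2 * frob W T) ≤ β * (β * frob W W + C₀ * κ) := by nlinarith
    have := le_of_mul_le_mul_left h4 hβ
    linarith

/-! ### The countable dual formula and measurability -/

instance (m m' : ℕ) : TopologicalSpace.SeparableSpace (Mat m m') :=
  inferInstanceAs (TopologicalSpace.SeparableSpace (Fin m → Fin m' → ℝ))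

/-- A dense sequence of dual variables. -/
def dualSeq (n k : ℕ) : ℕ → Mat n k × Mat n n := TopologicalSpace.denseSeq _

theorem continuous_dualForm (X : Mat n n) (Y : Mat n k) (Z : Mat n n) :
    Continuous fun p => dualForm Λ₁ Λ₂ p X Y Z := by
  unfold dualForm frob
  fun_prop

/-- `dualForm` is continuous in the dual variable, so a dense sequence suffices. Countability is
what gives measurability and allows monotone convergence. -/
theorem actionDensity_eq_iSup_dualSeq (hΛ₁ : Λ₁.PosSemidef) (hΛ₂ : Λ₂.PosDef) {X : Mat n n}
    (hX : X.IsSymm) (Y : Mat n k) (Z : Mat n n) :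
    actionDensity Λ₁ Λ₂ X Y Z =
      ⨆ i, ENNReal.ofReal (dualForm Λ₁ Λ₂ (dualSeq n k i) X Y Z) := by
  rw [actionDensity_eq_iSup hΛ₁ hΛ₂ hX]
  refine le_antisymm (iSup_le fun p => le_of_forall_lt fun a ha => ?_)
    (iSup_le fun i => le_iSup (fun p => ENNReal.ofReal (dualForm Λ₁ Λ₂ p X Y Z)) _)
  have hcont : Continuous fun p => ENNReal.ofReal (dualForm Λ₁ Λ₂ p X Y Z) :=
    ENNReal.continuous_ofReal.comp (continuous_dualForm X Y Z)
  obtain ⟨i, hi⟩ := (TopologicalSpace.denseRange_denseSeq (Mat n k × Mat n n)).exists_mem_open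
    (isOpen_lt continuous_const hcont) ⟨p, ha⟩
  exact hi.trans_le (le_iSup (fun i => ENNReal.ofReal (dualForm Λ₁ Λ₂ (dualSeq n k i) X Y Z)) i)

theorem measurable_frob {α : Type*} [MeasurableSpace α] {m m' : ℕ} {f g : α → Mat m m'}
    (hf : ∀ i j, Measurable fun a => f a i j) (hg : ∀ i j, Measurable fun a => g a i j) :
    Measurable fun a => frob (f a) (g a) := by
  simp only [frob_eq_sum]
  fun_prop

theorem measurable_dualForm {α : Type*} [MeasurableSpace α] {X : α → Mat n n} {Y : α → Mat n k}
    {Z : α → Mat n n} (hX : ∀ i j, Measurable fun a => X a i j)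
    (hY : ∀ i j, Measurable fun a => Y a i j) (hZ : ∀ i j, Measurable fun a => Z a i j)
    (p : Mat n k × Mat n n) : Measurable fun a => dualForm Λ₁ Λ₂ p (X a) (Y a) (Z a) := by
  unfold dualForm
  have h₁ := measurable_frob (f := fun _ => p.1) (fun _ _ => measurable_const) hY
  have h₂ := measurable_frob (f := fun _ => p.2) (fun _ _ => measurable_const) hZ
  have h₃ := measurable_frob (g := fun _ => p.1 * Λ₁ * (p.1 * Λ₁)ᵀ) hX fun _ _ => measurable_const
  have h₄ := measurable_frob (g := fun _ => p.2 * Λ₂ * (p.2 * Λ₂)ᵀ) hX fun _ _ => measurable_const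
  exact (h₁.add h₂).sub ((h₃.add h₄).const_mul _)

theorem aemeasurable_actionDensity (hΛ₁ : Λ₁.PosSemidef) (hΛ₂ : Λ₂.PosDef) {α : Type*}
    [MeasurableSpace α] {lam : Measure α} {X : α → Mat n n} {Y : α → Mat n k}
    {Z : α → Mat n n} (hX : ∀ i j, Measurable fun a => X a i j)
    (hY : ∀ i j, Measurable fun a => Y a i j) (hZ : ∀ i j, Measurable fun a => Z a i j)
    (hs : ∀ᵐ a ∂lam, (X a).IsSymm) :
    AEMeasurable (fun a => actionDensity Λ₁ Λ₂ (X a) (Y a) (Z a)) lam := by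
  refine ⟨fun a => ⨆ i, ENNReal.ofReal (dualForm Λ₁ Λ₂ (dualSeq n k i) (X a) (Y a) (Z a)),
    Measurable.iSup fun i => (measurable_dualForm hX hY hZ _).ennreal_ofReal, ?_⟩
  filter_upwards [hs] with a ha
  exact actionDensity_eq_iSup_dualSeq hΛ₁ hΛ₂ ha _ _

end ActionDensity

end WBTransport

end

noncomputable section

namespace WBTransport

/-! ### Matrix-valued measures with densities -/

section Density

variable {X : Type} [MeasurableSpace X] {m m' : ℕ}

theorem entry_apply (ν : MatMeasure X m m') (i : Fin m) (j : Fin m') (E : Set X) :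
    entry ν i j E = ν E i j := rfl

/-- The measure `ν` has the integrable density `f` with respect to `lam`. -/
def HasMatDensity (ν : MatMeasure X m m') (lam : Measure X) (f : X → Mat m m') : Prop :=
  ∀ i j, Integrable (fun x => f x i j) lam ∧ entry ν i j = lam.withDensityᵥ fun x => f x i j

theorem HasMatDensity.integrable {ν : MatMeasure X m m'} {lam : Measure X} {f : X → Mat m m'}
    (h : HasMatDensity ν lam f) (i : Fin m) (j : Fin m') : Integrable (fun x => f x i j) lam :=
  (h i j).1

theorem HasMatDensity.apply {ν : MatMeasure X m m'} {lam : Measure X} {f : X → Mat m m'}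
    (h : HasMatDensity ν lam f) {E : Set X} (hE : MeasurableSet E) (i : Fin m) (j : Fin m') :
    ν E i j = ∫ x in E, f x i j ∂lam := by
  rw [← entry_apply, (h i j).2, withDensityᵥ_apply (h.integrable i j) hE]

/-- The matrix-valued measure with given densities. -/
def matWithDensity (lam : Measure X) (f : X → Mat m m') : MatMeasure X m m' where
  measureOf' E := Matrix.of fun i j => lam.withDensityᵥ (fun x => f x i j) E
  empty' := by ext; simp
  not_measurable' E hE := by
    ext i j
    simp [VectorMeasure.not_measurable _ hE]
  m_iUnion' E hE hd := by
    refine Pi.hasSum.2 fun i => Pi.hasSum.2 fun j => ?_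
    exact VectorMeasure.m_iUnion _ hE hd

theorem hasMatDensity_matWithDensity {lam : Measure X} {f : X → Mat m m'}
    (hf : ∀ i j, Integrable (fun x => f x i j) lam) :
    HasMatDensity (matWithDensity lam f) lam f :=
  fun i j => ⟨hf i j, rfl⟩

theorem HasMatDensity.sub {ν ν' : MatMeasure X m m'} {lam : Measure X} {f f' : X → Mat m m'}
    (h : HasMatDensity ν lam f) (h' : HasMatDensity ν' lam f') :
    HasMatDensity (ν - ν') lam fun x => f x - f' x := fun i j =>
  ⟨(h i j).1.sub (h' i j).1, by
    have : entry (ν - ν') i j = entry ν i j - entry ν' i j := rfl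
    rw [this, (h i j).2, (h' i j).2, ← withDensityᵥ_sub (h i j).1 (h' i j).1]
    rfl⟩

theorem HasMatDensity.livesOn {ν : MatMeasure X m m'} {lam : Measure X} {f : X → Mat m m'}
    (h : HasMatDensity ν lam f) {S : Set X} (hS : MeasurableSet S) (h0 : lam Sᶜ = 0) :
    LivesOn S ν := by
  intro E hE
  ext i j
  rw [h.apply hE, h.apply (hE.inter hS)]
  refine setIntegral_congr_set ?_
  have hS' : ∀ᵐ x ∂lam, x ∈ S := mem_ae_iff.2 h0
  filter_upwards [hS'] with x hx
  exact propext ⟨fun h => ⟨h, hx⟩, fun h => h.1⟩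

theorem HasMatDensity.isSymmValued {ν : MatMeasure X m m} {lam : Measure X} {f : X → Mat m m}
    (h : HasMatDensity ν lam f) (hs : ∀ x, (f x).IsSymm) : IsSymmValued ν := by
  intro E
  ext i j
  rw [Matrix.transpose_apply, ← entry_apply, ← entry_apply, (h j i).2, (h i j).2]
  congr 2
  ext x
  exact (hs x).apply i j

theorem HasMatDensity.hasDensityOn {Y : Type} [MeasureSpace Y] {ν : MatMeasure Y m m'} {S : Set Y}
    {f : Y → Mat m m'} (h : HasMatDensity ν (volume.restrict S) f) : HasDensityOn S ν f := by
  intro E hE i j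
  rw [h.apply hE, Measure.restrict_restrict hE]

theorem totalVariation_entry_le_dominating (ν : MatMeasure X m m') (i : Fin m) (j : Fin m') :
    (entry ν i j).totalVariation ≤ dominating ν := by
  rw [dominating]
  refine le_trans ?_ (Finset.single_le_sum (f := fun i => ∑ j, (entry ν i j).totalVariation)
    (fun _ _ => Measure.zero_le _) (Finset.mem_univ i))
  exact Finset.single_le_sum (f := fun j => (entry ν i j).totalVariation)
    (fun _ _ => Measure.zero_le _) (Finset.mem_univ j)

instance (s : SignedMeasure X) : IsFiniteMeasure s.totalVariation := by
  rw [SignedMeasure.totalVariation]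
  infer_instance

instance (ν : MatMeasure X m m') : IsFiniteMeasure (dominating ν) := by
  rw [dominating]
  infer_instance

theorem dominating_compl_eq_zero {ν : MatMeasure X m m'} {S : Set X} (hS : MeasurableSet S)
    (h : LivesOn S ν) : dominating ν Sᶜ = 0 := by
  simp only [dominating, Measure.coe_finsetSum, Finset.sum_apply, Finset.sum_eq_zero_iff]
  intro i _ j _
  rw [SignedMeasure.totalVariation_eq_variation, VectorMeasure.variation_apply_eq_zero hS.compl]
  intro E hE hES
  rw [entry_apply, h E hES, Set.disjoint_iff_inter_eq_empty.1
    (Set.disjoint_left.2 fun x hx hxS => hE hx hxS)]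
  simp

theorem hasMatDensity_density {ν : MatMeasure X m m'} {lam : Measure X} [SigmaFinite lam]
    (h : dominating ν ≪ lam) : HasMatDensity ν lam (density ν lam) := by
  intro i j
  refine ⟨SignedMeasure.integrable_rnDeriv _ _, ?_⟩
  refine (SignedMeasure.withDensityᵥ_rnDeriv_eq _ _ ?_).symm
  rw [SignedMeasure.absolutelyContinuous_ennreal_iff, VectorMeasure.ennrealToMeasure_toENNRealVectorMeasure]
  exact (Measure.absolutelyContinuous_of_le (totalVariation_entry_le_dominating ν i j)).trans h

theorem measurable_density (ν : MatMeasure X m m') (lam : Measure X) (i : Fin m) (j : Fin m') :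
    Measurable fun x => density ν lam x i j :=
  SignedMeasure.measurable_rnDeriv _ _

theorem density_isSymm {ν : MatMeasure X m m} (hν : IsSymmValued ν) (lam : Measure X) (x : X) :
    (density ν lam x).IsSymm := by
  ext i j
  have : entry ν i j = entry ν j i := by
    ext E
    exact ((hν E).apply i j).symm
  simp [density, this]

theorem HasMatDensity.dominating_absolutelyContinuous {ν : MatMeasure X m m'} {lam : Measure X}
    {f : X → Mat m m'} (h : HasMatDensity ν lam f) : dominating ν ≪ lam := by
  intro E hE
  simp only [dominating, Measure.coe_finsetSum, Finset.sum_apply, Finset.sum_eq_zero_iff]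
  intro i _ j _
  rw [SignedMeasure.totalVariation_eq_variation, (h i j).2,
    Measure.variation_withDensityᵥ (h.integrable i j)]
  exact withDensity_absolutelyContinuous _ _ hE

theorem integral_toSignedMeasure_withDensity {lam : Measure X} {φ : X → ℝ} {w : X → ℝ≥0∞}
    (hw : AEMeasurable w lam) (hw' : ∀ᵐ x ∂lam, w x < ⊤) [IsFiniteMeasure (lam.withDensity w)] :
    ∫ᵛ x, φ x ∂•(lam.withDensity w).toSignedMeasure = ∫ x, (w x).toReal * φ x ∂lam := by
  have hflip : ContinuousLinearMap.lsmul ℝ ℝ = (ContinuousLinearMap.lsmul ℝ ℝ (E := ℝ)).flip := by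
    ext
    simp
  rw [hflip, VectorMeasure.integral_toSignedMeasure, integral_withDensity_eq_integral_toReal_smul₀ hw hw']
  rfl

/-- Split the density into positive and negative part; on each of them the vector measure integral
is an ordinary integral with respect to a finite positive measure. -/
theorem integral_withDensityᵥ {lam : Measure X} {f φ : X → ℝ} (hf : Integrable f lam)
    (hφ : Integrable (fun x => φ x * f x) lam) :
    ∫ᵛ x, φ x ∂•(lam.withDensityᵥ f) = ∫ x, φ x * f x ∂lam := by
  have : IsFiniteMeasure (lam.withDensity fun x => ENNReal.ofReal (f x)) :=
    isFiniteMeasure_withDensity_ofReal hf.2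
  have : IsFiniteMeasure (lam.withDensity fun x => ENNReal.ofReal (-f x)) :=
    isFiniteMeasure_withDensity_ofReal hf.neg.2
  have hm := hf.aestronglyMeasurable.aemeasurable
  have key : ∀ g : X → ℝ, AEMeasurable g lam → Integrable (fun x => φ x * g x) lam →
      Integrable (fun x => (ENNReal.ofReal (g x)).toReal * φ x) lam := by
    intro g hg hgf
    refine (hgf.indicator₀ (nullMeasurableSet_lt (aemeasurable_const (b := (0 : ℝ))) hg)).congr
      (ae_of_all _ fun x => ?_)
    simp only [Set.indicator_apply, Set.mem_ofPred_eq, ENNReal.toReal_ofReal']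
    split_ifs with hx
    · rw [max_eq_left hx.le, mul_comm]
    · rw [max_eq_right (not_lt.1 hx), zero_mul]
  have hφ' : Integrable (fun x => φ x * -f x) lam := by
    simp only [mul_neg]
    exact hφ.neg
  have hint : ∀ g : X → ℝ, AEMeasurable g lam → Integrable (fun x => φ x * g x) lam →
      Integrable φ (lam.withDensity fun x => ENNReal.ofReal (g x)) := fun g hg hgf =>
    (integrable_withDensity_iff_integrable_smul₀' hg.ennreal_ofReal
      (ae_of_all _ fun _ => ENNReal.ofReal_lt_top)).2 (key g hg hgf)
  rw [withDensityᵥ_eq_withDensity_pos_part_sub_withDensity_neg_part hf,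
    VectorMeasure.integral_sub_vectorMeasure, integral_toSignedMeasure_withDensity,
    integral_toSignedMeasure_withDensity, ← integral_sub]
  · refine integral_congr_ae (ae_of_all _ fun x => ?_)
    simp only [ENNReal.toReal_ofReal']
    rw [← sub_mul, max_zero_sub_eq_self, mul_comm]
  · exact key f hm hφ
  · exact key (fun x => -f x) hm.neg hφ'
  · exact hm.neg.ennreal_ofReal
  · exact ae_of_all _ fun _ => ENNReal.ofReal_lt_top
  · exact hm.ennreal_ofReal
  · exact ae_of_all _ fun _ => ENNReal.ofReal_lt_top
  · rw [VectorMeasure.Integrable, Measure.variation_toSignedMeasure]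
    exact hint f hm hφ
  · rw [VectorMeasure.Integrable, Measure.variation_toSignedMeasure]
    exact hint (fun x => -f x) hm.neg hφ'

theorem HasMatDensity.pairing_eq {ν : MatMeasure X m m'} {lam : Measure X} {f : X → Mat m m'}
    (h : HasMatDensity ν lam f) {φ : X → Mat m m'}
    (hφ : ∀ i j, Integrable (fun x => φ x i j * f x i j) lam) :
    pairing ν φ = ∑ i, ∑ j, ∫ x, φ x i j * f x i j ∂lam := by
  refine Finset.sum_congr rfl fun i _ => Finset.sum_congr rfl fun j _ => ?_
  rw [(h i j).2, integral_withDensityᵥ (h.integrable i j) (hφ i j)]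

theorem norm_vec_le (A : Mat m m') : ‖vec m m' A‖ ≤ ∑ i, ∑ j, |A i j| := by
  have h0 : 0 ≤ ∑ p : Fin m × Fin m', |A p.1 p.2| := Finset.sum_nonneg fun _ _ => abs_nonneg _
  rw [← Fintype.sum_prod_type' (f := fun i j => |A i j|), EuclideanSpace.norm_eq]
  refine Real.sqrt_le_iff.2 ⟨h0, ?_⟩
  exact Finset.sum_sq_le_sq_sum_of_nonneg fun p _ => abs_nonneg (A p.1 p.2)

/-- On each measurable set the Frobenius norm of the value is at most the integral of the entrywise
`ℓ¹` norm of the density, and the variation is the smallest measure with such a bound. -/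
theorem tvNorm_le {ν : MatMeasure X m m'} {lam : Measure X} {f : X → Mat m m'}
    (h : HasMatDensity ν lam f) :
    tvNorm ν ≤ ENNReal.ofReal (∫ x, ∑ i, ∑ j, |f x i j| ∂lam) := by
  have hint : Integrable (fun x => ∑ i, ∑ j, |f x i j|) lam :=
    integrable_finsetSum _ fun i _ => integrable_finsetSum _ fun j _ => (h.integrable i j).abs
  have h0 : ∀ x, 0 ≤ ∑ i, ∑ j, |f x i j| := fun x =>
    Finset.sum_nonneg fun _ _ => Finset.sum_nonneg fun _ _ => abs_nonneg _
  rw [tvNorm, ofReal_integral_eq_lintegral_ofReal hint (ae_of_all _ h0), ← setLIntegral_univ,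
    ← withDensity_apply _ MeasurableSet.univ]
  refine VectorMeasure.variation_le_of_forall_enorm_le (fun E hE => ?_) _
  rw [withDensity_apply _ hE, ← ofReal_integral_eq_lintegral_ofReal hint.integrableOn
    (ae_of_all _ h0), VectorMeasure.mapRange_apply, ← ofReal_norm]
  refine ENNReal.ofReal_le_ofReal ((norm_vec_le _).trans ?_)
  rw [integral_finsetSum _ fun i _ => integrable_finsetSum _ fun j _ =>
    (h.integrable i j).abs.integrableOn]
  refine Finset.sum_le_sum fun i _ => ?_
  rw [integral_finsetSum _ fun j _ => (h.integrable i j).abs.integrableOn]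
  refine Finset.sum_le_sum fun j _ => ?_
  rw [h.apply hE]
  exact abs_integral_le_integral_abs

end Density

/-! ### Independence of the action of the reference measure -/

section Action

variable {d n k : ℕ} {Λ₁ : Mat k k} {Λ₂ : Mat n n}

instance (μ : Triple d n k) : IsFiniteMeasure μ.ref := by
  rw [Triple.ref]
  infer_instance

theorem Triple.dominating_le_ref (μ : Triple d n k) :
    dominating μ.G ≤ μ.ref ∧ dominating μ.q ≤ μ.ref ∧ dominating μ.R ≤ μ.ref := by
  rw [Triple.ref]
  refine ⟨?_, ?_, ?_⟩
  · rw [add_assoc]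
    exact Measure.le_add_right le_rfl
  · rw [add_assoc, add_left_comm]
    exact Measure.le_add_right le_rfl
  · exact Measure.le_add_left le_rfl

theorem Triple.hasMatDensity_ref (μ : Triple d n k) :
    HasMatDensity μ.G μ.ref (density μ.G μ.ref) ∧ HasMatDensity μ.q μ.ref (density μ.q μ.ref) ∧
      HasMatDensity μ.R μ.ref (density μ.R μ.ref) :=
  ⟨hasMatDensity_density (Measure.absolutelyContinuous_of_le μ.dominating_le_ref.1),
    hasMatDensity_density (Measure.absolutelyContinuous_of_le μ.dominating_le_ref.2.1),
    hasMatDensity_density (Measure.absolutelyContinuous_of_le μ.dominating_le_ref.2.2)⟩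

theorem HasMatDensity.ae_eq_rnDeriv_mul {X : Type} [MeasurableSpace X] {m m' : ℕ}
    {ν : MatMeasure X m m'} {lam ref : Measure X} [SigmaFinite lam] [IsFiniteMeasure ref]
    {f g : X → Mat m m'} (h : HasMatDensity ν lam f) (h' : HasMatDensity ν ref g)
    (hac : ref ≪ lam) :
    ∀ᵐ x ∂lam, f x = (ref.rnDeriv lam x).toReal • g x := by
  have key : ∀ i j, ∀ᵐ x ∂lam, f x i j = (ref.rnDeriv lam x).toReal • g x i j := by
    intro i j
    refine Integrable.ae_eq_of_withDensityᵥ_eq (h.integrable i j)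
      ((integrable_rnDeriv_smul_iff hac).2 (h'.integrable i j)) ?_
    rw [withDensityᵥ_rnDeriv_smul hac (h'.integrable i j), ← (h i j).2, (h' i j).2]
  filter_upwards [ae_all_iff.2 fun i => ae_all_iff.2 (key i)] with x hx
  ext i j
  exact hx i j

/-- Passing from `μ.ref` to `lam` multiplies all three densities by the same Radon–Nikodym factor,
which 1-homogeneity of the action density pulls out. -/
theorem action_eq_lintegral (hΛ₁ : Λ₁.PosSemidef) (hΛ₂ : Λ₂.PosDef) {μ : Triple d n k}
    (hμ : IsSymmValued μ.G) {lam : Measure (ℝ × Space d)} [SigmaFinite lam]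
    {g r : ℝ × Space d → Mat n n} {q : ℝ × Space d → Mat n k} (hg : HasMatDensity μ.G lam g)
    (hq : HasMatDensity μ.q lam q) (hr : HasMatDensity μ.R lam r) (S : Set (ℝ × Space d))
    (hS : MeasurableSet S) :
    action Λ₁ Λ₂ S μ = ∫⁻ z in S, actionDensity Λ₁ Λ₂ (g z) (q z) (r z) ∂lam := by
  have hac : μ.ref ≪ lam := by
    rw [Triple.ref]
    exact (hg.dominating_absolutelyContinuous.add_left hq.dominating_absolutelyContinuous).add_left
      hr.dominating_absolutelyContinuous
  have hsymm := density_isSymm hμ μ.ref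
  have hmeas := aemeasurable_actionDensity (lam := lam) hΛ₁ hΛ₂
    (measurable_density μ.G μ.ref)
    (measurable_density μ.q μ.ref) (measurable_density μ.R μ.ref) (ae_of_all _ hsymm)
  obtain ⟨hG, hQ, hR⟩ := μ.hasMatDensity_ref
  rw [action, ← setLIntegral_rnDeriv_mul hac hmeas hS]
  refine lintegral_congr_ae (ae_restrict_of_ae ?_)
  filter_upwards [hg.ae_eq_rnDeriv_mul hG hac, hq.ae_eq_rnDeriv_mul hQ hac,
    hr.ae_eq_rnDeriv_mul hR hac, μ.ref.rnDeriv_lt_top lam] with z h₁ h₂ h₃ h₄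
  rw [h₁, h₂, h₃, actionDensity_smul hΛ₁ hΛ₂ (hsymm z) _ _ ENNReal.toReal_nonneg,
    ENNReal.ofReal_toReal h₄.ne]

end Action

end WBTransport

end

noncomputable section

namespace WBTransport

/-! ### Contraction followed by mollification -/

section Mollify

variable {E : Type} [NormedAddCommGroup E] [NormedSpace ℝ E]

/-- The homothety with center `c` and ratio `1 - s`. -/
def contract (c : E) (s : ℝ) (w : E) : E := c + (1 - s) • (w - c)

theorem continuous_contract (c : E) (s : ℝ) : Continuous (contract c s) := by
  unfold contract
  fun_prop

theorem dist_contract_add_le (c : E) {s : ℝ} (hs : 0 ≤ s) (w y : E) :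
    dist (contract c s w + y) w ≤ s * ‖w - c‖ + ‖y‖ := by
  rw [dist_eq_norm]
  have : contract c s w + y - w = -(s • (w - c)) + y := by
    rw [contract, sub_smul, one_smul]
    abel
  rw [this]
  refine (norm_add_le _ _).trans ?_
  rw [norm_neg, norm_smul, Real.norm_of_nonneg hs]

variable [MeasureSpace E]

/-- `η` is a smooth probability density such that contracting `S` by the factor `1 - s` towards `c`
and then translating it by vectors of the support of `η` maps `S` into its interior. -/
structure IsMollifier (S : Set E) (c : E) (s : ℝ) (η : E → ℝ) : Prop where
  pos : 0 < s
  lt_one : s < 1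
  smooth : ContDiff ℝ ∞ η
  compact : HasCompactSupport η
  nonneg : ∀ y, 0 ≤ η y
  integral_eq_one : ∫ y, η y = 1
  mem : ∀ w ∈ S, ∀ y, η y ≠ 0 → contract c s w + y ∈ interior S

/-- The density of the mollification by `η` of the pushforward of `f • lam` under the contraction. -/
def moll (c : E) (s : ℝ) (η : E → ℝ) (lam : Measure E) (f : E → ℝ) (z : E) : ℝ :=
  ∫ w, η (z - contract c s w) * f w ∂lam

/-- The action on functions of the adjoint of `moll`. -/
def avg {F : Type} [NormedAddCommGroup F] [NormedSpace ℝ F] (c : E) (s : ℝ) (η : E → ℝ)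
    (φ : E → F) (w : E) : F :=
  ∫ y, η y • φ (contract c s w + y)

variable [FiniteDimensional ℝ E] [BorelSpace E] [(volume : Measure E).IsAddHaarMeasure]
  {S : Set E} {c : E} {s : ℝ} {η : E → ℝ} {lam : Measure E}

namespace IsMollifier

variable (h : IsMollifier S c s η)
include h

theorem exists_bound : ∃ C, ∀ y, |η y| ≤ C :=
  h.compact.exists_bound_of_continuous h.smooth.continuous

theorem integrable_kernel : Integrable η :=
  h.smooth.continuous.integrable_of_hasCompactSupport h.compact

theorem integrable_mul {f : E → ℝ} (hf : Integrable f lam) (z : E) :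
    Integrable (fun w => η (z - contract c s w) * f w) lam := by
  obtain ⟨C, hC⟩ := h.exists_bound
  refine hf.bdd_mul (c := C) ?_ (ae_of_all _ fun w => hC _)
  exact (h.smooth.continuous.comp (continuous_const.sub (continuous_contract c s))).aestronglyMeasurable

/-- `z - contract c s w = (1 - s) • (z' - w)` with `z' = (1 - s)⁻¹ • (z - s • c)`. Thus `moll` is a
convolution with a rescaled kernel, composed with an affine map. -/
theorem contDiff_moll {f : E → ℝ} (hf : Integrable f lam) :
    ContDiff ℝ ∞ (moll c s η lam f) := by
  have h1s : (1 - s) ≠ 0 := (sub_pos.2 h.lt_one).ne'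
  set κ : E → ℝ := fun y => η ((1 - s) • y) with hκ
  have hκc : HasCompactSupport κ :=
    h.compact.comp_homeomorph (Homeomorph.smulOfNeZero (1 - s) h1s)
  have hκs : ContDiff ℝ ∞ κ := h.smooth.comp (contDiff_const_smul _)
  have hconv := hκc.contDiff_convolution_right (ContinuousLinearMap.mul ℝ ℝ)
    (hf.locallyIntegrable) hκs
  have : moll c s η lam f = (MeasureTheory.convolution f κ (ContinuousLinearMap.mul ℝ ℝ) lam) ∘
      fun z => (1 - s)⁻¹ • (z - s • c) := by
    ext z
    simp only [moll, convolution, Function.comp, hκ, ContinuousLinearMap.mul_apply']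
    refine integral_congr_ae (ae_of_all _ fun w => ?_)
    have : z - contract c s w = (1 - s) • ((1 - s)⁻¹ • (z - s • c) - w) := by
      rw [smul_sub, smul_inv_smul₀ h1s, contract]
      module
    simp only [this, mul_comm]
  rw [this]
  exact hconv.comp (by fun_prop)

theorem moll_nonneg {f : E → ℝ} (hf : 0 ≤ᵐ[lam] f) (z : E) : 0 ≤ moll c s η lam f z := by
  refine integral_nonneg_of_ae ?_
  filter_upwards [hf] with w hw
  exact mul_nonneg (h.nonneg _) hw

theorem abs_moll_le (f : E → ℝ) (z : E) :
    |moll c s η lam f z| ≤ moll c s η lam (fun w => |f w|) z := by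
  refine abs_integral_le_integral_abs.trans_eq ?_
  simp only [moll, abs_mul, abs_of_nonneg (h.nonneg _)]

theorem moll_add {f g : E → ℝ} (hf : Integrable f lam) (hg : Integrable g lam) (z : E) :
    moll c s η lam (fun w => f w + g w) z = moll c s η lam f z + moll c s η lam g z := by
  simp only [moll, mul_add]
  exact integral_add (h.integrable_mul hf z) (h.integrable_mul hg z)

theorem moll_sum {ι : Type*} (t : Finset ι) {f : ι → E → ℝ} (hf : ∀ i, Integrable (f i) lam)
    (z : E) :
    moll c s η lam (fun w => ∑ i ∈ t, f i w) z = ∑ i ∈ t, moll c s η lam (f i) z := by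
  simp only [moll, Finset.mul_sum]
  exact integral_finsetSum _ fun i _ => h.integrable_mul (hf i) z

omit [BorelSpace E] [FiniteDimensional ℝ E] [(volume : Measure E).IsAddHaarMeasure] h in
theorem moll_const_mul (a : ℝ) (f : E → ℝ) (z : E) :
    moll c s η lam (fun w => a * f w) z = a * moll c s η lam f z := by
  simp only [moll, mul_left_comm _ a]
  exact integral_const_mul _ _

theorem moll_mono {f g : E → ℝ} (hf : Integrable f lam) (hg : Integrable g lam)
    (hfg : f ≤ᵐ[lam] g) (z : E) : moll c s η lam f z ≤ moll c s η lam g z := by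
  refine integral_mono_ae (h.integrable_mul hf z) (h.integrable_mul hg z) ?_
  filter_upwards [hfg] with w hw
  exact mul_le_mul_of_nonneg_left hw (h.nonneg _)

variable {F : Type} [NormedAddCommGroup F] [NormedSpace ℝ F]

theorem integrable_avg (hS : IsCompact S) {φ : E → F} (hφ : ContinuousOn φ S) {w : E}
    (hw : w ∈ S) : Integrable fun y => η y • φ (contract c s w + y) := by
  obtain ⟨C, hC⟩ := hS.exists_bound_of_continuousOn hφ
  have hm : AEStronglyMeasurable (S.indicator φ) (volume : Measure E) :=
    (aestronglyMeasurable_indicator_iff hS.measurableSet).2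
      (hφ.aestronglyMeasurable hS.measurableSet)
  -- `φ` is controlled on `S` only. Extending it by zero changes nothing, because the kernel
  -- vanishes whenever the argument leaves `S`.
  have heq : (fun y => η y • φ (contract c s w + y)) =
      fun y => η y • S.indicator φ (contract c s w + y) := by
    ext y
    by_cases hy : η y = 0
    · simp [hy]
    · rw [Set.indicator_of_mem (interior_subset (h.mem w hw y hy))]
  have hm' : AEStronglyMeasurable (fun y => S.indicator φ (contract c s w + y)) volume :=
    hm.comp_measurePreserving (measurePreserving_add_left volume (contract c s w))
  have hb : ∀ y, ‖S.indicator φ (contract c s w + y)‖ ≤ max C 0 := by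
    intro y
    by_cases hy : contract c s w + y ∈ S
    · rw [Set.indicator_of_mem hy]
      exact (hC _ hy).trans (le_max_left _ _)
    · rw [Set.indicator_of_notMem hy, norm_zero]
      exact le_max_right _ _
  rw [heq]
  exact h.integrable_kernel.smul_bdd (max C 0) hm' (ae_of_all _ hb)

theorem norm_avg_le [CompleteSpace F] {φ : E → F} {w : E} (hw : w ∈ S) {C : ℝ}
    (hC : ∀ z ∈ S, ‖φ z‖ ≤ C) : ‖avg c s η φ w‖ ≤ C := by
  have : ‖avg c s η φ w‖ ≤ ∫ y, η y * C := by
    refine norm_integral_le_of_norm_le (h.integrable_kernel.mul_const C) (ae_of_all _ fun y => ?_)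
    rw [norm_smul, Real.norm_of_nonneg (h.nonneg y)]
    by_cases hy : η y = 0
    · simp [hy]
    · exact mul_le_mul_of_nonneg_left (hC _ (interior_subset (h.mem w hw y hy))) (h.nonneg y)
  rwa [integral_mul_const, h.integral_eq_one, one_mul] at this

theorem continuousOn_avg (hS : IsCompact S) {φ : E → F} (hφ : ContinuousOn φ S) :
    ContinuousOn (avg c s η φ) S := by
  obtain ⟨C, hC⟩ := hS.exists_bound_of_continuousOn hφ
  refine continuousOn_of_dominated (bound := fun y => η y * C)
    (fun w hw => (h.integrable_avg hS hφ hw).aestronglyMeasurable)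
    (fun w hw => ae_of_all _ fun y => ?_) (h.integrable_kernel.mul_const C)
    (ae_of_all _ fun y => ?_)
  · rw [norm_smul, Real.norm_of_nonneg (h.nonneg y)]
    by_cases hy : η y = 0
    · simp [hy]
    · exact mul_le_mul_of_nonneg_left (hC _ (interior_subset (h.mem w hw y hy))) (h.nonneg y)
  · by_cases hy : η y = 0
    · simp only [hy, zero_smul]
      exact continuousOn_const
    · exact (hφ.comp ((continuous_contract c s).add continuous_const).continuousOn
        fun w hw => interior_subset (h.mem w hw y hy)).const_smul _

/-- Differentiation under the integral; the factor `1 - s` is the derivative of the contraction.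
Differentiability of `φ` in the interior is enough, because contraction and translation by the
support of `η` send all of `S` there. -/
theorem hasFDerivAt_avg (hS : IsCompact S) {φ : E → ℝ} {φ' : E → E →L[ℝ] ℝ}
    (hφ : ContinuousOn φ S) (hφ' : ContinuousOn φ' S)
    (hd : ∀ z ∈ interior S, HasFDerivAt φ (φ' z) z) {w : E} (hw : w ∈ interior S) :
    HasFDerivAt (avg c s η φ) ((1 - s) • avg c s η φ' w) w := by
  obtain ⟨C, hC⟩ := hS.exists_bound_of_continuousOn hφ'
  have hmem : interior S ∈ 𝓝 w := isOpen_interior.mem_nhds hw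
  have hsub : interior S ⊆ S := interior_subset
  have key := hasFDerivAt_integral_of_dominated_of_fderiv_le (μ := (volume : Measure E))
    (F := fun w y => η y • φ (contract c s w + y))
    (F' := fun w y => η y • ((1 - s) • φ' (contract c s w + y)))
    (bound := fun y => η y * (|1 - s| * C)) hmem
    (Filter.eventually_of_mem hmem fun x hx =>
      (h.integrable_avg hS hφ (hsub hx)).aestronglyMeasurable)
    (h.integrable_avg hS hφ (hsub hw))
    (by
      have := (h.integrable_avg hS (hφ'.const_smul (1 - s)) (hsub hw)).aestronglyMeasurable
      exact this)
    (ae_of_all _ fun y x hx => by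
      rw [norm_smul, Real.norm_of_nonneg (h.nonneg y), norm_smul, Real.norm_eq_abs]
      by_cases hy : η y = 0
      · simp [hy]
      · have := hC _ (hsub (h.mem x (hsub hx) y hy))
        exact mul_le_mul_of_nonneg_left (mul_le_mul_of_nonneg_left this (abs_nonneg _))
          (h.nonneg y))
    (h.integrable_kernel.mul_const _)
    (ae_of_all _ fun y x hx => by
      by_cases hy : η y = 0
      · simp only [hy, zero_smul]
        exact hasFDerivAt_const _ _
      · refine HasFDerivAt.const_smul ?_ (η y)
        have h1 : HasFDerivAt (fun x => contract c s x + y)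
            ((1 - s) • ContinuousLinearMap.id ℝ E) x := by
          unfold contract
          exact ((((hasFDerivAt_id x).sub_const c).const_smul (1 - s)).const_add c).add_const y
        have h2 := (hd _ (h.mem x (hsub hx) y hy)).comp x h1
        rw [ContinuousLinearMap.comp_smul, ContinuousLinearMap.comp_id] at h2
        exact h2)
  have e : (∫ y, η y • ((1 - s) • φ' (contract c s w + y))) = (1 - s) • avg c s η φ' w := by
    rw [avg, ← integral_smul]
    simp only [smul_comm (1 - s)]
  rw [← e]
  exact key

theorem avg_apply (hS : IsCompact S) {φ' : E → E →L[ℝ] ℝ} (hφ' : ContinuousOn φ' S) {w : E}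
    (hw : w ∈ S) (v : E) : avg c s η φ' w v = avg c s η (fun z => φ' z v) w := by
  rw [avg, ContinuousLinearMap.integral_apply (h.integrable_avg hS hφ' hw)]
  rfl

theorem setIntegral_kernel {φ : E → ℝ} {w : E} (hw : w ∈ S) :
    ∫ z in S, φ z * η (z - contract c s w) = avg c s η φ w := by
  rw [setIntegral_eq_integral_of_forall_compl_eq_zero, avg,
    ← integral_sub_right_eq_self (fun y => η y • φ (contract c s w + y)) (contract c s w)]
  · simp only [smul_eq_mul, add_sub_cancel, mul_comm]
  · intro z hz
    by_contra hne
    have := h.mem w hw (z - contract c s w) (right_ne_zero_of_mul hne)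
    rw [add_sub_cancel] at this
    exact hz (interior_subset this)

theorem integrable_prod_kernel [SFinite lam] (hS : IsCompact S) {φ f : E → ℝ}
    (hφ : ContinuousOn φ S) (hf : Integrable f lam) :
    Integrable (fun p : E × E => φ p.1 * η (p.1 - contract c s p.2) * f p.2)
      ((volume.restrict S).prod lam) := by
  obtain ⟨C, hC⟩ := h.exists_bound
  have h1 : Integrable (fun p : E × E => φ p.1 * f p.2) ((volume.restrict S).prod lam) :=
    (hφ.integrableOn_compact hS).mul_prod hf
  have h2 := h1.bdd_mul (c := C) (f := fun p : E × E => η (p.1 - contract c s p.2))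
    (h.smooth.continuous.comp (continuous_fst.sub
      ((continuous_contract c s).comp continuous_snd))).aestronglyMeasurable
    (ae_of_all _ fun p => hC _)
  refine h2.congr (ae_of_all _ fun p => ?_)
  simp only
  ring

theorem integrable_mul_moll [SFinite lam] (hS : IsCompact S) {φ f : E → ℝ}
    (hφ : ContinuousOn φ S) (hf : Integrable f lam) :
    Integrable (fun z => φ z * moll c s η lam f z) (volume.restrict S) := by
  refine (h.integrable_prod_kernel hS hφ hf).integral_prod_left.congr (ae_of_all _ fun z => ?_)
  simp only [moll, mul_assoc]
  exact integral_const_mul _ _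

/-- Fubini. Restricting the `z`-integral to `S` loses nothing, since for `w ∈ S` the function `z ↦ η
(z - contract c s w)` vanishes off `S`. -/
theorem setIntegral_mul_moll [SFinite lam] (hS : IsCompact S) (h0 : lam Sᶜ = 0) {φ f : E → ℝ}
    (hφ : ContinuousOn φ S) (hf : Integrable f lam) :
    ∫ z in S, φ z * moll c s η lam f z = ∫ w, avg c s η φ w * f w ∂lam := by
  have hmem : ∀ᵐ w ∂lam, w ∈ S := mem_ae_iff.2 h0
  calc ∫ z in S, φ z * moll c s η lam f z
      = ∫ z in S, ∫ w, φ z * η (z - contract c s w) * f w ∂lam := by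
        refine integral_congr_ae (ae_of_all _ fun z => ?_)
        simp only [moll, mul_assoc]
        exact (integral_const_mul _ _).symm
    _ = ∫ w, (∫ z in S, φ z * η (z - contract c s w) * f w) ∂lam :=
        integral_integral_swap (f := fun z w => φ z * η (z - contract c s w) * f w)
          (h.integrable_prod_kernel hS hφ hf)
    _ = _ := by
        refine integral_congr_ae ?_
        filter_upwards [hmem] with w hw
        rw [integral_mul_const, h.setIntegral_kernel hw]

theorem lintegral_kernel (w : E) : ∫⁻ z, ENNReal.ofReal (η (z - contract c s w)) = 1 := by
  rw [lintegral_sub_right_eq_self (fun y => ENNReal.ofReal (η y)),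
    ← ofReal_integral_eq_lintegral_ofReal h.integrable_kernel (ae_of_all _ h.nonneg),
    h.integral_eq_one, ENNReal.ofReal_one]

/-- Tonelli with a kernel of mass one in `z`. It is stated for functions with values in `ℝ≥0∞` so
that it applies to the action density. -/
theorem lintegral_moll_le [SFinite lam] {f : E → ℝ≥0∞} (hf : AEMeasurable f lam) (A : Set E) :
    ∫⁻ z in A, ∫⁻ w, ENNReal.ofReal (η (z - contract c s w)) * f w ∂lam ≤ ∫⁻ w, f w ∂lam := by
  have hm : Measurable fun p : E × E => ENNReal.ofReal (η (p.1 - contract c s p.2)) :=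
    (h.smooth.continuous.comp (continuous_fst.sub
      ((continuous_contract c s).comp continuous_snd))).measurable.ennreal_ofReal
  rw [lintegral_lintegral_swap (hm.aemeasurable.mul hf.comp_snd)]
  refine lintegral_mono fun w => ?_
  have hmw : Measurable fun z => ENNReal.ofReal (η (z - contract c s w)) :=
    hm.comp measurable_prodMk_right
  rw [lintegral_mul_const _ hmw]
  refine (mul_le_mul_left ((setLIntegral_le_lintegral A _).trans_eq (h.lintegral_kernel w)) _).trans ?_
  rw [one_mul]

end IsMollifier

/-- By duality the mollification is moved to `φ`. The averages of `φ` converge to it pointwise on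
`S` and keep its bound, so dominated convergence applies, for an arbitrary s-finite measure `lam`
living on `S`. -/
theorem tendsto_setIntegral_mul_moll [SFinite lam] (hS : IsCompact S) (h0 : lam Sᶜ = 0)
    {η : ℝ → E → ℝ} {r : ℝ → ℝ} (hη : ∀ᶠ s in 𝓝[>] (0 : ℝ), IsMollifier S c s (η s))
    (hr : Tendsto r (𝓝[>] 0) (𝓝 0)) (hηr : ∀ᶠ s in 𝓝[>] (0 : ℝ), ∀ y, η s y ≠ 0 → ‖y‖ ≤ r s)
    {φ f : E → ℝ} (hφ : ContinuousOn φ S) (hf : Integrable f lam) :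
    Tendsto (fun s => ∫ z in S, φ z * moll c s (η s) lam f z) (𝓝[>] 0)
      (𝓝 (∫ w, φ w * f w ∂lam)) := by
  have hmem : ∀ᵐ w ∂lam, w ∈ S := mem_ae_iff.2 h0
  obtain ⟨C, hC⟩ := hS.exists_bound_of_continuousOn hφ
  have hcongr : (fun s => ∫ w, avg c s (η s) φ w * f w ∂lam) =ᶠ[𝓝[>] 0]
      fun s => ∫ z in S, φ z * moll c s (η s) lam f z := by
    filter_upwards [hη] with s hs
    exact (hs.setIntegral_mul_moll hS h0 hφ hf).symm
  refine Tendsto.congr' hcongr ?_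
  refine tendsto_integral_filter_of_dominated_convergence (fun w => C * |f w|) ?_ ?_
    (hf.abs.const_mul C) ?_
  · filter_upwards [hη] with s hs
    have hlam : lam.restrict S = lam := Measure.restrict_eq_self_of_ae_mem hmem
    have := (hs.continuousOn_avg hS hφ).aestronglyMeasurable (μ := lam) hS.measurableSet
    rw [hlam] at this
    exact this.mul hf.aestronglyMeasurable
  · filter_upwards [hη] with s hs
    filter_upwards [hmem] with w hw
    rw [norm_mul]
    exact mul_le_mul_of_nonneg_right (hs.norm_avg_le hw hC) (abs_nonneg _)
  · filter_upwards [hmem] with w hw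
    refine Tendsto.mul_const _ ?_
    rw [Metric.tendsto_nhds]
    intro δ hδ
    have hcw := Metric.continuousWithinAt_iff.1 (hφ w hw) (δ / 2) (half_pos hδ)
    obtain ⟨ρ, hρ, hρφ⟩ := hcw
    have hlim : Tendsto (fun s : ℝ => s * ‖w - c‖ + r s) (𝓝[>] 0) (𝓝 0) := by
      have h1 : Tendsto (fun s : ℝ => s * ‖w - c‖) (𝓝[>] 0) (𝓝 0) := by
        have : Tendsto (fun s : ℝ => s * ‖w - c‖) (𝓝 0) (𝓝 (0 * ‖w - c‖)) :=
          (continuous_id.mul continuous_const).tendsto 0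
        rw [zero_mul] at this
        exact this.mono_left nhdsWithin_le_nhds
      simpa using h1.add hr
    filter_upwards [hη, hηr, hlim.eventually (gt_mem_nhds hρ)] with s hs hsr hsρ
    refine lt_of_le_of_lt ?_ (half_lt_self hδ)
    rw [dist_eq_norm]
    have hsub : avg c s (η s) φ w - φ w = avg c s (η s) (fun z => φ z - φ w) w := by
      simp only [avg, smul_sub]
      rw [integral_sub (hs.integrable_avg hS hφ hw) (hs.integrable_kernel.smul_const _),
        integral_smul_const, hs.integral_eq_one, one_smul]
    rw [hsub]
    have : ‖avg c s (η s) (fun z => φ z - φ w) w‖ ≤ ∫ y, η s y * (δ / 2) := by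
      refine norm_integral_le_of_norm_le (hs.integrable_kernel.mul_const _)
        (ae_of_all _ fun y => ?_)
      rw [norm_smul, Real.norm_of_nonneg (hs.nonneg y)]
      by_cases hy : η s y = 0
      · simp [hy]
      · refine mul_le_mul_of_nonneg_left ?_ (hs.nonneg y)
        rw [← dist_eq_norm]
        refine (hρφ (interior_subset (hs.mem w hw y hy)) ?_).le
        exact (dist_contract_add_le c hs.pos.le w y).trans_lt
          ((add_le_add_right (hsr y hy) _).trans_lt hsρ)
    rwa [integral_mul_const, hs.integral_eq_one, one_mul] at this

end Mollify

end WBTransport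

end

noncomputable section

namespace WBTransport

/-! ### Star-shaped domains and mollifiers adapted to them -/

section Geometry

variable {d : ℕ} {Ω : Set (Space d)}

instance : (volume : Measure (ℝ × Space d)).IsAddHaarMeasure :=
  inferInstanceAs ((volume : Measure ℝ).prod (volume : Measure (Space d))).IsAddHaarMeasure

/-- `Ω` is star-shaped with respect to all points of the ball with center `x₀` and radius `r`. -/
def StarShapedBall (Ω : Set (Space d)) (x₀ : Space d) (r : ℝ) : Prop :=
  0 < r ∧ r ≤ 1 ∧ Metric.ball x₀ r ⊆ Ω ∧ ∀ x ∈ Metric.ball x₀ r, StarConvex ℝ x Ω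

theorem StarShaped.exists_ball (h : StarShaped Ω) : ∃ x₀ r, StarShapedBall Ω x₀ r := by
  obtain ⟨S, hSΩ, ⟨x₀, hx₀⟩, hstar⟩ := h
  obtain ⟨r, hr, hball⟩ := Metric.isOpen_iff.1 isOpen_interior x₀ hx₀
  -- The radius is capped at `1` so that kernels of radius at most `s r` are supported in the ball
  -- of radius `s`.
  have hsub : Metric.ball x₀ (min r 1) ⊆ S :=
    (Metric.ball_subset_ball (min_le_left _ _)).trans (hball.trans interior_subset)
  exact ⟨x₀, min r 1, lt_min hr one_pos, min_le_right _ _, hsub.trans hSΩ, fun x hx =>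
    hstar x (hsub hx)⟩

/-- Every point `z` within distance `s r` of the contracted point is a convex combination `s x + (1
- s) w` with `x` in the ball of star centres. -/
theorem StarShapedBall.contract_mem {x₀ : Space d} {r : ℝ} (h : StarShapedBall Ω x₀ r) {s : ℝ}
    (hs : 0 < s) (hs1 : s < 1) {w : Space d} (hw : w ∈ Ω) {y : Space d} (hy : ‖y‖ < s * r) :
    contract x₀ s w + y ∈ interior Ω := by
  have hsub : Metric.ball (contract x₀ s w) (s * r) ⊆ Ω := by
    intro z hz
    set x := x₀ + s⁻¹ • (z - contract x₀ s w) with hx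
    have hxb : x ∈ Metric.ball x₀ r := by
      rw [Metric.mem_ball, dist_eq_norm] at hz ⊢
      rw [hx, add_sub_cancel_left, norm_smul, Real.norm_of_nonneg (inv_nonneg.2 hs.le),
        inv_mul_lt_iff₀ hs]
      exact hz
    have := h.2.2.2 x hxb hw hs.le (sub_nonneg.2 hs1.le) (by ring)
    convert this using 1
    rw [hx, smul_add, smul_inv_smul₀ hs.ne', contract]
    module
  refine interior_mono hsub ?_
  rw [Metric.isOpen_ball.interior_eq, Metric.mem_ball, dist_eq_norm, add_sub_cancel_left]
  exact hy

/-- The contracted copies of `Ω` lie in its interior and their volume `(1 - s)^d |Ω|` tends to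
`|Ω|`. The null boundary is needed because test functions are differentiable only in the interior.
-/
theorem StarShapedBall.volume_diff_interior {x₀ : Space d} {r : ℝ} (h : StarShapedBall Ω x₀ r)
    (hΩ : IsCompact Ω) : volume (Ω \ interior Ω) = 0 := by
  have hle : ∀ s ∈ Set.Ioo (0 : ℝ) 1,
      ENNReal.ofReal ((1 - s) ^ d) * volume Ω ≤ volume (interior Ω) := by
    intro s hs
    have : contract x₀ s '' Ω ⊆ interior Ω := by
      rintro _ ⟨w, hw, rfl⟩
      simpa using h.contract_mem hs.1 hs.2 hw (y := 0) (by simpa using mul_pos hs.1 h.1)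
    refine le_trans (le_of_eq ?_) (measure_mono this)
    have heq : contract x₀ s = AffineMap.homothety x₀ (1 - s) := by
      ext w : 1
      simp [contract, AffineMap.homothety_apply, add_comm]
    rw [heq, Measure.addHaar_image_homothety, finrank_euclideanSpace_fin, abs_of_nonneg]
    exact pow_nonneg (sub_nonneg.2 hs.2.le) _
  have hlim : Tendsto (fun s : ℝ => ENNReal.ofReal ((1 - s) ^ d) * volume Ω) (𝓝[>] 0)
      (𝓝 (volume Ω)) := by
    have h1 : Tendsto (fun s : ℝ => ENNReal.ofReal ((1 - s) ^ d)) (𝓝[>] 0) (𝓝 1) := by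
      have : Continuous fun s : ℝ => ENNReal.ofReal ((1 - s) ^ d) :=
        ENNReal.continuous_ofReal.comp (by fun_prop)
      have := this.tendsto 0
      simp only [sub_zero, one_pow, ENNReal.ofReal_one] at this
      exact this.mono_left nhdsWithin_le_nhds
    simpa using ENNReal.Tendsto.mul_const h1 (Or.inr hΩ.measure_lt_top.ne)
  have hfin : volume Ω ≤ volume (interior Ω) := by
    refine le_of_tendsto hlim ?_
    filter_upwards [Ioo_mem_nhdsGT (one_pos : (0 : ℝ) < 1)] with s hs using hle s hs
  rw [measure_sdiff interior_subset isOpen_interior.measurableSet.nullMeasurableSet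
    ((measure_mono interior_subset).trans_lt hΩ.measure_lt_top).ne]
  exact tsub_eq_zero_of_le hfin

theorem isCompact_timeSpace (hΩ : IsCompact Ω) : IsCompact (timeSpace Ω) :=
  isCompact_Icc.prod hΩ

theorem interior_timeSpace : interior (timeSpace Ω) = Set.Ioo 0 1 ×ˢ interior Ω := by
  rw [timeSpace, interior_prod_eq, interior_Icc]

/-- A pair of mollifiers for the time interval and for the space domain. -/
structure IsKernelPair (Ω : Set (Space d)) (x₀ : Space d) (s : ℝ) (η₁ : ℝ → ℝ)
    (η₂ : Space d → ℝ) : Prop where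
  time : IsMollifier (Set.Icc (0 : ℝ) 1) (1 / 2) s η₁
  space : IsMollifier Ω x₀ s η₂
  time_le : ∀ t, η₁ t ≤ 4 / s
  time_supp : ∀ t, η₁ t ≠ 0 → |t| < s / 4
  space_supp : ∀ y, η₂ y ≠ 0 → ‖y‖ ≤ s

theorem normed_ne_zero {E : Type} [NormedAddCommGroup E] [NormedSpace ℝ E] [HasContDiffBump E]
    [MeasureSpace E] {c : E} (f : ContDiffBump c) {y : E} (hy : f.normed volume y ≠ 0) :
    dist y c < f.rOut := by
  have h : f y ≠ 0 := fun h0 => hy (by rw [ContDiffBump.normed, h0, zero_div])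
  have : y ∈ Function.support f := h
  rwa [f.support_eq] at this

theorem StarShapedBall.exists_isKernelPair {x₀ : Space d} {r : ℝ} (h : StarShapedBall Ω x₀ r)
    {s : ℝ} (hs : 0 < s) (hs1 : s < 1) : ∃ η₁ η₂, IsKernelPair Ω x₀ s η₁ η₂ := by
  obtain ⟨hr, hr1, -, -⟩ := id h
  -- The inner radius `s/8` yields the bound `1 / (s/4) = 4 / s` for the normalized bump. The outer
  -- radius `s/4` stays below the margin `s/2` that the contraction of `[0,1]` leaves at both ends.
  let f : ContDiffBump (0 : ℝ) := ⟨s / 8, s / 4, by positivity, by linarith⟩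
  let g : ContDiffBump (0 : Space d) := ⟨s * r / 4, s * r / 2, by positivity, by
    have := mul_pos hs hr
    linarith⟩
  have hf : ∀ t, f.normed volume t ≠ 0 → |t| < s / 4 := fun t ht => by
    have := normed_ne_zero f ht
    rwa [Real.dist_eq, sub_zero] at this
  have hg : ∀ y, g.normed volume y ≠ 0 → ‖y‖ < s * r / 2 := fun y hy => by
    have := normed_ne_zero g hy
    rwa [dist_zero_right] at this
  have hsr : s * r ≤ s := mul_le_of_le_one_right hs.le hr1
  have hsr0 := mul_pos hs hr
  refine ⟨f.normed volume, g.normed volume, ⟨hs, hs1, f.contDiff_normed, f.hasCompactSupport_normed,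
    f.nonneg_normed, f.integral_normed, ?_⟩, ⟨hs, hs1, g.contDiff_normed,
    g.hasCompactSupport_normed, g.nonneg_normed, g.integral_normed, ?_⟩, ?_, hf, fun y hy => ?_⟩
  · intro w hw y hy
    have := abs_lt.1 (hf y hy)
    rw [interior_Icc, contract, smul_eq_mul]
    constructor <;> nlinarith [hw.1, hw.2]
  · intro w hw y hy
    exact h.contract_mem hs hs1 hw ((hg y hy).trans (by linarith))
  · intro t
    refine (f.normed_le_div_measure_closedBall_rIn volume t).trans ?_
    rw [measureReal_def, Real.volume_closedBall, ENNReal.toReal_ofReal (by positivity)]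
    rw [div_le_div_iff₀ (by positivity) hs]
    simp only [f]
    linarith
  · linarith [hg y hy]

theorem IsKernelPair.prod {x₀ : Space d} {s : ℝ} {η₁ : ℝ → ℝ} {η₂ : Space d → ℝ}
    (h : IsKernelPair Ω x₀ s η₁ η₂) :
    IsMollifier (timeSpace Ω) ((1 / 2 : ℝ), x₀) s fun p => η₁ p.1 * η₂ p.2 where
  pos := h.time.pos
  lt_one := h.time.lt_one
  smooth := (h.time.smooth.comp contDiff_fst).mul (h.space.smooth.comp contDiff_snd)
  compact := by
    refine HasCompactSupport.intro (h.time.compact.isCompact.prod h.space.compact.isCompact)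
      fun p hp => ?_
    by_contra hne
    exact hp ⟨subset_tsupport _ (left_ne_zero_of_mul hne), subset_tsupport _ (right_ne_zero_of_mul hne)⟩
  nonneg p := mul_nonneg (h.time.nonneg _) (h.space.nonneg _)
  integral_eq_one := by
    rw [Measure.volume_eq_prod, integral_prod_mul, h.time.integral_eq_one, h.space.integral_eq_one,
      one_mul]
  mem := by
    rintro ⟨t, x⟩ ⟨ht, hx⟩ ⟨u, y⟩ hne
    have h1 := h.time.mem t ht u (left_ne_zero_of_mul hne)
    have h2 := h.space.mem x hx y (right_ne_zero_of_mul hne)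
    rw [timeSpace, interior_prod_eq]
    exact ⟨h1, h2⟩

theorem IsKernelPair.prod_supp {x₀ : Space d} {s : ℝ} {η₁ : ℝ → ℝ} {η₂ : Space d → ℝ}
    (h : IsKernelPair Ω x₀ s η₁ η₂) (p : ℝ × Space d) (hp : η₁ p.1 * η₂ p.2 ≠ 0) : ‖p‖ ≤ s := by
  have h1 := h.time_supp _ (left_ne_zero_of_mul hp)
  have h2 := h.space_supp _ (right_ne_zero_of_mul hp)
  have := h.time.pos
  refine max_le ?_ h2
  rw [Real.norm_eq_abs]
  linarith

end Geometry

/-! ### Cutoffs in time and integration by parts in time -/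

section Time

variable {d : ℕ} {Ω : Set (Space d)} {x₀ : Space d} {s : ℝ} {η₁ : ℝ → ℝ} {η₂ : Space d → ℝ}

/-- The primitive of `η₁` translated by `τ` that vanishes at `0`. -/
def cutoff (η₁ : ℝ → ℝ) (τ t : ℝ) : ℝ := ∫ u in (0 : ℝ)..t, η₁ (u - τ)

theorem hasDerivAt_cutoff (hη : Continuous η₁) (τ t : ℝ) :
    HasDerivAt (cutoff η₁ τ) (η₁ (t - τ)) t := by
  have hc : Continuous fun u => η₁ (u - τ) := by fun_prop
  exact (hc.integral_hasStrictDerivAt 0 t).hasDerivAt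

theorem contDiff_cutoff (hη : ContDiff ℝ ∞ η₁) (τ : ℝ) : ContDiff ℝ ∞ (cutoff η₁ τ) := by
  rw [contDiff_infty_iff_deriv]
  refine ⟨fun t => (hasDerivAt_cutoff hη.continuous τ t).differentiableAt, ?_⟩
  have : deriv (cutoff η₁ τ) = fun t => η₁ (t - τ) :=
    funext fun t => (hasDerivAt_cutoff hη.continuous τ t).deriv
  rw [this]
  exact hη.comp (contDiff_id.sub contDiff_const)

theorem cutoff_zero (τ : ℝ) : cutoff η₁ τ 0 = 0 := by simp [cutoff]

theorem IsKernelPair.cutoff_nonneg (h : IsKernelPair Ω x₀ s η₁ η₂) (τ : ℝ) {t : ℝ} (ht : 0 ≤ t) :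
    0 ≤ cutoff η₁ τ t :=
  intervalIntegral.integral_nonneg ht fun _ _ => h.time.nonneg _

/-- The translated kernel is supported in `(τ - s/4, τ + s/4)`, which lies in `(0, t)`, so all of
its mass has been integrated. -/
theorem IsKernelPair.cutoff_eq_one (h : IsKernelPair Ω x₀ s η₁ η₂) {τ t : ℝ} (hτ : s / 2 ≤ τ)
    (ht : τ + s / 2 ≤ t) : cutoff η₁ τ t = 1 := by
  have hs := h.time.pos
  rw [cutoff, intervalIntegral.integral_of_le (by linarith),
    setIntegral_eq_integral_of_forall_compl_eq_zero,
    integral_sub_right_eq_self (fun u => η₁ u) τ, h.time.integral_eq_one]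
  intro u hu
  by_contra hne
  have := abs_lt.1 (h.time_supp _ hne)
  exact hu ⟨by linarith, by linarith⟩

theorem IsKernelPair.cutoff_le_one (h : IsKernelPair Ω x₀ s η₁ η₂) (τ : ℝ) {t : ℝ} (ht : 0 ≤ t) :
    cutoff η₁ τ t ≤ 1 := by
  rw [cutoff, intervalIntegral.integral_of_le ht, ← h.time.integral_eq_one,
    ← integral_sub_right_eq_self (fun u => η₁ u) τ]
  exact setIntegral_le_integral (h.time.integrable_kernel.comp_sub_right τ)
    (ae_of_all _ fun u => h.time.nonneg _)

theorem IsKernelPair.cutoff_eq_zero (h : IsKernelPair Ω x₀ s η₁ η₂) {τ t : ℝ} (ht : 0 ≤ t)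
    (hτ : t + s / 2 ≤ τ) : cutoff η₁ τ t = 0 := by
  have hs := h.time.pos
  rw [cutoff, intervalIntegral.integral_of_le ht]
  refine setIntegral_eq_zero_of_forall_eq_zero fun u hu => ?_
  by_contra hne
  have := abs_lt.1 (h.time_supp _ hne)
  linarith [hu.2]

theorem volume_restrict_timeSpace :
    (volume : Measure (ℝ × Space d)).restrict (timeSpace Ω) =
      (volume.restrict (Set.Icc (0 : ℝ) 1)).prod (volume.restrict Ω) := by
  rw [timeSpace, Measure.prod_restrict, Measure.volume_eq_prod]

theorem integrable_continuousOn_mul_snd (hΩ : IsCompact Ω) {φ : ℝ × Space d → ℝ}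
    (hφ : ContinuousOn φ (timeSpace Ω)) {f : Space d → ℝ} (hf : Integrable f (volume.restrict Ω)) :
    Integrable (fun z => φ z * f z.2) (volume.restrict (timeSpace Ω)) := by
  obtain ⟨C, hC⟩ := (isCompact_timeSpace hΩ).exists_bound_of_continuousOn hφ
  have hm := (isCompact_timeSpace hΩ).measurableSet
  have h1 : Integrable (fun z : ℝ × Space d => f z.2) (volume.restrict (timeSpace Ω)) := by
    rw [volume_restrict_timeSpace]
    exact hf.comp_snd _
  exact h1.bdd_mul (c := C) (hφ.aestronglyMeasurable hm)
    ((ae_restrict_iff' hm).2 (ae_of_all _ fun z hz => hC z hz))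

/-- Integration by parts in time against a density of product form. -/
theorem integral_by_parts_time (hΩ : IsCompact Ω) (h0 : volume (Ω \ interior Ω) = 0)
    {φ : ℝ × Space d → ℝ} {φ' : ℝ × Space d → ℝ × Space d →L[ℝ] ℝ}
    (hφ : ContinuousOn φ (timeSpace Ω)) (hφ' : ContinuousOn φ' (timeSpace Ω))
    (hd : ∀ z ∈ interior (timeSpace Ω), HasFDerivAt φ (φ' z) z)
    {a a' : ℝ → ℝ} (ha : ∀ t, HasDerivAt a (a' t) t) (ha' : Continuous a')
    {f : Space d → ℝ} (hf : Integrable f (volume.restrict Ω)) :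
    ∫ z in timeSpace Ω, φ' z (1, 0) * (a z.1 * f z.2) + φ z * (a' z.1 * f z.2) =
      (∫ x in Ω, φ (1, x) * (a 1 * f x)) - ∫ x in Ω, φ (0, x) * (a 0 * f x) := by
  have hac : Continuous a := continuous_iff_continuousAt.2 fun t => (ha t).continuousAt
  have hψ : ContinuousOn (fun z => φ' z (1, 0) * a z.1 + φ z * a' z.1) (timeSpace Ω) :=
    ((hφ'.clm_apply continuousOn_const).mul (hac.comp continuous_fst).continuousOn).add
      (hφ.mul (ha'.comp continuous_fst).continuousOn)
  have hslice : ∀ t ∈ Set.Icc (0 : ℝ) 1, ContinuousOn (fun x => φ (t, x)) Ω := fun t ht =>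
    hφ.comp (by fun_prop) fun x hx => ⟨ht, hx⟩
  have hint : ∀ t ∈ Set.Icc (0 : ℝ) 1, ∀ b : ℝ,
      Integrable (fun x => φ (t, x) * (b * f x)) (volume.restrict Ω) := fun t ht b => by
    obtain ⟨C, hC⟩ := hΩ.exists_bound_of_continuousOn (hslice t ht)
    exact (hf.const_mul b).bdd_mul (c := C) ((hslice t ht).aestronglyMeasurable hΩ.measurableSet)
      ((ae_restrict_iff' hΩ.measurableSet).2 (ae_of_all _ fun x hx => hC x hx))
  -- The segment `(0,1) × {x}` lies in the interior of the time-space domain only for interior `x`;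
  -- the remaining points form a null set.
  have hae : ∀ᵐ x ∂(volume.restrict Ω), x ∈ interior Ω := by
    rw [ae_restrict_iff' hΩ.measurableSet, ae_iff]
    convert h0 using 2
    ext x
    simp
  have hprod := integrable_continuousOn_mul_snd hΩ hψ hf
  have e : ∀ z : ℝ × Space d, φ' z (1, 0) * (a z.1 * f z.2) + φ z * (a' z.1 * f z.2) =
      (φ' z (1, 0) * a z.1 + φ z * a' z.1) * f z.2 := fun z => by ring
  simp only [e]
  rw [volume_restrict_timeSpace] at hprod ⊢
  rw [integral_prod_symm _ hprod, ← integral_sub (hint 1 (by simp) _) (hint 0 (by simp) _)]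
  refine integral_congr_ae ?_
  filter_upwards [hae] with x hx
  have hxΩ := interior_subset hx
  rw [integral_mul_const]
  have hline : ContinuousOn (fun t : ℝ => (t, x)) (Set.Icc 0 1) := by fun_prop
  have hmaps : Set.MapsTo (fun t : ℝ => (t, x)) (Set.Icc 0 1) (timeSpace Ω) := fun t ht => ⟨ht, hxΩ⟩
  have hcont : ContinuousOn (fun t => φ' (t, x) (1, 0) * a t + φ (t, x) * a' t)
      (Set.Icc 0 1) := hψ.comp hline hmaps
  have hftc : ∫ t in (0 : ℝ)..1, φ' (t, x) (1, 0) * a t + φ (t, x) * a' t =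
      φ (1, x) * a 1 - φ (0, x) * a 0 := by
    refine intervalIntegral.integral_eq_sub_of_hasDerivAt_of_le (f := fun t => φ (t, x) * a t)
      zero_le_one ((hφ.comp hline hmaps).mul hac.continuousOn) (fun t ht => ?_) ?_
    · have hz : ((t, x) : ℝ × Space d) ∈ interior (timeSpace Ω) := by
        rw [interior_timeSpace]
        exact ⟨ht, hx⟩
      have h1 : HasDerivAt (fun t : ℝ => ((t, x) : ℝ × Space d)) (1, 0) t :=
        (hasDerivAt_id t).prodMk (hasDerivAt_const t x)
      exact ((hd _ hz).comp_hasDerivAt t h1).mul (ha t)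
    · exact (hcont.mono (Set.uIcc_of_le zero_le_one).subset).intervalIntegrable
  rw [integral_Icc_eq_integral_Ioc, ← intervalIntegral.integral_of_le zero_le_one, hftc]
  ring

end Time

end WBTransport

end

noncomputable section

namespace WBTransport

/-! ### Lower semicontinuity of the action -/

section LowerSemicontinuity

variable {d n k : ℕ} {Λ₁ : Mat k k} {Λ₂ : Mat n n}

/-- The space of dual variables with its sup norm. -/
abbrev DualVar (n k : ℕ) : Type := (Fin n → Fin k → ℝ) × (Fin n → Fin n → ℝ)

/-- Dual variables as a pair of matrices. -/
def DualVar.toMat {n k : ℕ} (p : DualVar n k) : Mat n k × Mat n n := (Matrix.of p.1, Matrix.of p.2)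

/-- The matrix paired with `X` in `dualForm`. -/
def quadWeight (Λ₁ : Mat k k) (Λ₂ : Mat n n) (p : Mat n k × Mat n n) : Mat n n :=
  p.1 * Λ₁ * (p.1 * Λ₁)ᵀ + p.2 * Λ₂ * (p.2 * Λ₂)ᵀ

theorem dualForm_eq (p : Mat n k × Mat n n) (X : Mat n n) (Y : Mat n k) (Z : Mat n n) :
    dualForm Λ₁ Λ₂ p X Y Z =
      frob p.1 Y + frob p.2 Z - 1 / 2 * frob (quadWeight Λ₁ Λ₂ p) X := by
  have : frob (quadWeight Λ₁ Λ₂ p) X = frob X (quadWeight Λ₁ Λ₂ p) := by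
    simp only [frob_eq_sum, mul_comm]
  rw [this, dualForm, quadWeight, frob_add_right]

theorem continuous_toMat : Continuous (DualVar.toMat : DualVar n k → Mat n k × Mat n n) :=
  continuous_id

theorem continuous_quadWeight (i j : Fin n) :
    Continuous fun p : DualVar n k => quadWeight Λ₁ Λ₂ p.toMat i j := by
  have h : Continuous fun p : DualVar n k => quadWeight Λ₁ Λ₂ p.toMat := by
    have h0 := continuous_toMat (n := n) (k := k)
    unfold quadWeight
    fun_prop
  exact h.matrix_elem i j

theorem exists_dualVar_bound (C : ℝ) :
    ∃ B, ∀ p : DualVar n k, ‖p‖ ≤ C →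
      (∀ i j, |p.1 i j| ≤ B) ∧ (∀ i j, |p.2 i j| ≤ B) ∧
        ∀ i j, |quadWeight Λ₁ Λ₂ p.toMat i j| ≤ B := by
  have h : ∀ i j, ∃ B, ∀ p ∈ Metric.closedBall (0 : DualVar n k) C,
      ‖quadWeight Λ₁ Λ₂ p.toMat i j‖ ≤ B := fun i j =>
    (isCompact_closedBall 0 C).exists_bound_of_continuousOn (continuous_quadWeight i j).continuousOn
  choose B hB using h
  have hB0 : ∀ i j, B i j ≤ ∑ i, ∑ j, |B i j| := fun i j =>
    (le_abs_self _).trans ((Finset.single_le_sum (f := fun j => |B i j|)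
      (fun _ _ => abs_nonneg _) (Finset.mem_univ j)).trans
      (Finset.single_le_sum (f := fun i => ∑ j, |B i j|)
        (fun _ _ => Finset.sum_nonneg fun _ _ => abs_nonneg _) (Finset.mem_univ i)))
  refine ⟨max C (∑ i, ∑ j, |B i j|), fun p hp => ⟨fun i j => ?_, fun i j => ?_, fun i j => ?_⟩⟩
  · exact ((norm_le_pi_norm (p.1 i) j).trans ((norm_le_pi_norm p.1 i).trans
      ((norm_fst_le p).trans hp))).trans (le_max_left _ _)
  · exact ((norm_le_pi_norm (p.2 i) j).trans ((norm_le_pi_norm p.2 i).trans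
      ((norm_snd_le p).trans hp))).trans (le_max_left _ _)
  · exact (hB i j p (by simpa using hp)).trans ((hB0 i j).trans (le_max_right _ _))

theorem abs_frob_le {m m' : ℕ} {A B : Mat m m'} {C : ℝ} (h : ∀ i j, |A i j| ≤ C) :
    |frob A B| ≤ C * ∑ i, ∑ j, |B i j| := by
  rw [frob_eq_sum, Finset.mul_sum]
  refine (Finset.abs_sum_le_sum_abs _ _).trans (Finset.sum_le_sum fun i _ => ?_)
  rw [Finset.mul_sum]
  refine (Finset.abs_sum_le_sum_abs _ _).trans (Finset.sum_le_sum fun j _ => ?_)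
  rw [abs_mul]
  exact mul_le_mul_of_nonneg_right (h i j) (abs_nonneg _)

theorem exists_dualForm_bound (C : ℝ) :
    ∃ B, ∀ p : DualVar n k, ‖p‖ ≤ C → ∀ (X : Mat n n) (Y : Mat n k) (Z : Mat n n),
      |dualForm Λ₁ Λ₂ p.toMat X Y Z| ≤
        B * ((∑ i, ∑ j, |X i j|) + (∑ i, ∑ j, |Y i j|) + ∑ i, ∑ j, |Z i j|) := by
  obtain ⟨B, hB⟩ := exists_dualVar_bound (Λ₁ := Λ₁) (Λ₂ := Λ₂) C
  refine ⟨|B|, fun p hp X Y Z => ?_⟩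
  obtain ⟨h₁, h₂, h₃⟩ := hB p hp
  have e₁ := abs_frob_le (A := p.toMat.1) (B := Y) fun i j => (h₁ i j).trans (le_abs_self B)
  have e₂ := abs_frob_le (A := p.toMat.2) (B := Z) fun i j => (h₂ i j).trans (le_abs_self B)
  have e₃ := abs_frob_le (B := X) fun i j => (h₃ i j).trans (le_abs_self B)
  have e₄ : 0 ≤ |B| * ∑ i, ∑ j, |X i j| := (abs_nonneg _).trans e₃
  rw [dualForm_eq, abs_le]
  rw [abs_le] at e₁ e₂ e₃
  constructor <;> linarith

variable {X : Type} [MeasurableSpace X]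

theorem measurable_dualForm_comp {P : X → DualVar n k} (hP : Measurable P) {f : X → Mat n n}
    {g : X → Mat n k} {r : X → Mat n n} (hf : ∀ i j, Measurable fun z => f z i j)
    (hg : ∀ i j, Measurable fun z => g z i j) (hr : ∀ i j, Measurable fun z => r z i j) :
    Measurable fun z => dualForm Λ₁ Λ₂ (P z).toMat (f z) (g z) (r z) := by
  simp only [dualForm_eq]
  have h₁ : Measurable fun z => frob (P z).toMat.1 (g z) :=
    measurable_frob (fun i j => (measurable_pi_iff.1 (measurable_pi_iff.1 hP.fst i) j)) hg
  have h₂ : Measurable fun z => frob (P z).toMat.2 (r z) :=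
    measurable_frob (fun i j => (measurable_pi_iff.1 (measurable_pi_iff.1 hP.snd i) j)) hr
  have h₃ : Measurable fun z => frob (quadWeight Λ₁ Λ₂ (P z).toMat) (f z) :=
    measurable_frob (fun i j => (continuous_quadWeight i j).measurable.comp hP) hf
  exact (h₁.add h₂).sub (h₃.const_mul _)

/-- A measurable selection that nearly attains the supremum in the dual formula. -/
theorem exists_measurable_selection {f : X → Mat n n}
    {g : X → Mat n k} {r : X → Mat n n} (hf : ∀ i j, Measurable fun z => f z i j)
    (hg : ∀ i j, Measurable fun z => g z i j) (hr : ∀ i j, Measurable fun z => r z i j) (N : ℕ) :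
    ∃ P : X → DualVar n k, Measurable P ∧ (∃ C, ∀ z, ‖P z‖ ≤ C) ∧
      ∀ z, 0 ≤ dualForm Λ₁ Λ₂ (P z).toMat (f z) (g z) (r z) ∧
        ∀ i < N, dualForm Λ₁ Λ₂ (dualSeq n k i) (f z) (g z) (r z) ≤
          dualForm Λ₁ Λ₂ (P z).toMat (f z) (g z) (r z) := by
  induction N with
  | zero =>
    -- The zero dual variable gives the value zero, which starts the selection and keeps it
    -- nonnegative.
    refine ⟨fun _ => 0, measurable_const, ⟨0, by simp⟩, fun z => ⟨?_, by simp⟩⟩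
    have : (0 : DualVar n k).toMat = 0 := rfl
    simp [this, dualForm, frob]
  | succ N ih =>
    obtain ⟨P, hP, ⟨C, hC⟩, h⟩ := ih
    classical
    set p₀ : DualVar n k := ((dualSeq n k N).1, (dualSeq n k N).2) with hp₀
    have hp₀' : p₀.toMat = dualSeq n k N := rfl
    have hset : MeasurableSet {z | dualForm Λ₁ Λ₂ (P z).toMat (f z) (g z) (r z) <
        dualForm Λ₁ Λ₂ (dualSeq n k N) (f z) (g z) (r z)} :=
      measurableSet_lt (measurable_dualForm_comp hP hf hg hr) (measurable_dualForm hf hg hr _)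
    -- Greedy update: switch to the next dual variable exactly where it improves the current value.
    refine ⟨fun z => if dualForm Λ₁ Λ₂ (P z).toMat (f z) (g z) (r z) <
        dualForm Λ₁ Λ₂ (dualSeq n k N) (f z) (g z) (r z) then p₀ else P z,
      Measurable.ite hset measurable_const hP, ⟨max ‖p₀‖ C, fun z => ?_⟩, fun z => ?_⟩
    · dsimp only
      split_ifs
      · exact le_max_left _ _
      · exact (hC z).trans (le_max_right _ _)
    · obtain ⟨h0, hi⟩ := h z
      by_cases hz : dualForm Λ₁ Λ₂ (P z).toMat (f z) (g z) (r z) <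
        dualForm Λ₁ Λ₂ (dualSeq n k N) (f z) (g z) (r z)
      · simp only [hz, if_true, hp₀']
        refine ⟨h0.trans hz.le, fun i hiN => ?_⟩
        rcases Nat.lt_succ_iff_lt_or_eq.1 hiN with h' | rfl
        · exact (hi i h').trans hz.le
        · exact le_rfl
      · simp only [hz, if_false]
        refine ⟨h0, fun i hiN => ?_⟩
        rcases Nat.lt_succ_iff_lt_or_eq.1 hiN with h' | rfl
        · exact hi i h'
        · exact not_lt.1 hz

/-- Clamping of the coordinates to `[-C, C]`. -/
def clamp (C : ℝ) (p : DualVar n k) : DualVar n k :=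
  (fun i j => max (-C) (min C (p.1 i j)), fun i j => max (-C) (min C (p.2 i j)))

theorem continuous_clamp (C : ℝ) : Continuous (clamp C : DualVar n k → DualVar n k) := by
  unfold clamp
  fun_prop

theorem norm_clamp_le {C : ℝ} (hC : 0 ≤ C) (p : DualVar n k) : ‖clamp C p‖ ≤ C := by
  have h : ∀ x : ℝ, ‖max (-C) (min C x)‖ ≤ C := fun x => by
    rw [Real.norm_eq_abs, abs_le]
    exact ⟨le_max_left _ _, max_le (by linarith) (min_le_left _ _)⟩
  exact norm_prod_le_iff.2 ⟨(pi_norm_le_iff_of_nonneg hC).2 fun i =>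
    (pi_norm_le_iff_of_nonneg hC).2 fun j => h _, (pi_norm_le_iff_of_nonneg hC).2 fun i =>
    (pi_norm_le_iff_of_nonneg hC).2 fun j => h _⟩

theorem clamp_eq {C : ℝ} {p : DualVar n k} (hp : ‖p‖ ≤ C) : clamp C p = p := by
  have h : ∀ x : ℝ, ‖x‖ ≤ C → max (-C) (min C x) = x := fun x hx => by
    rw [Real.norm_eq_abs, abs_le] at hx
    rw [min_eq_right hx.2, max_eq_right hx.1]
  refine Prod.ext (funext fun i => funext fun j => h _ ?_) (funext fun i => funext fun j => h _ ?_)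
  · exact (norm_le_pi_norm (p.1 i) j).trans ((norm_le_pi_norm p.1 i).trans
      ((norm_fst_le p).trans hp))
  · exact (norm_le_pi_norm (p.2 i) j).trans ((norm_le_pi_norm p.2 i).trans
      ((norm_snd_le p).trans hp))

/-- Bounded continuous functions are dense in `L¹`, and convergence in `L¹` gives convergence almost
everywhere along a subsequence. -/
theorem exists_seq_continuous_tendsto_ae {Y : Type} [TopologicalSpace Y] [NormalSpace Y]
    [MeasurableSpace Y] [BorelSpace Y] [SecondCountableTopology Y] {lam : Measure Y}
    [lam.WeaklyRegular] {F : Type}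
    [NormedAddCommGroup F] [NormedSpace ℝ F] {f : Y → F} (hf : MemLp f 1 lam) :
    ∃ g : ℕ → Y → F, (∀ i, Continuous (g i)) ∧
      ∀ᵐ y ∂lam, Tendsto (fun i => g i y) atTop (𝓝 (f y)) := by
  have h : ∀ i : ℕ, ∃ g : BoundedContinuousFunction Y F,
      eLpNorm (f - (g : Y → F)) 1 lam ≤ ENNReal.ofReal (1 / ((i : ℝ) + 1)) ∧ MemLp g 1 lam :=
    fun i => hf.exists_boundedContinuous_eLpNorm_sub_le ENNReal.one_ne_top
      (by simpa using (by positivity : (0 : ℝ) < (i : ℝ) + 1))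
  choose g hg hgm using h
  have hlim : Tendsto (fun i => eLpNorm ((g i : Y → F) - f) 1 lam) atTop (𝓝 0) := by
    have h0 : Tendsto (fun i : ℕ => ENNReal.ofReal (1 / ((i : ℝ) + 1))) atTop (𝓝 0) := by
      simpa using ENNReal.tendsto_ofReal tendsto_one_div_add_atTop_nhds_zero_nat
    refine tendsto_of_tendsto_of_tendsto_of_le_of_le tendsto_const_nhds h0 (fun _ => zero_le)
      fun i => ?_
    simp only
    rw [eLpNorm_sub_comm]
    exact hg i
  have hmeas := tendstoInMeasure_of_tendsto_eLpNorm one_ne_zero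
    (fun i => (hgm i).aestronglyMeasurable) hf.aestronglyMeasurable hlim
  obtain ⟨ns, -, hns⟩ := hmeas.exists_seq_tendsto_ae
  exact ⟨fun i => g (ns i), fun i => (g (ns i)).continuous, hns⟩

end LowerSemicontinuity

end WBTransport

end

noncomputable section

namespace WBTransport

/-! ### The action as a supremum of weak* continuous functionals. -/

section LowerSemicontinuity

variable {d n k : ℕ} {Λ₁ : Mat k k} {Λ₂ : Mat n n}

theorem Triple.ae_mem_ref {μ : Triple d n k} {S : Set (ℝ × Space d)} (hS : MeasurableSet S)
    (hμ : μ.IsOn S) : ∀ᵐ z ∂μ.ref, z ∈ S := by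
  refine mem_ae_iff.2 ?_
  change μ.ref Sᶜ = 0
  simp only [Triple.ref, Measure.add_apply, dominating_compl_eq_zero hS hμ.1,
    dominating_compl_eq_zero hS hμ.2.1, dominating_compl_eq_zero hS hμ.2.2.1, add_zero]

theorem integrable_mul_of_bound {X : Type} [MeasurableSpace X] {lam : Measure X} {φ f : X → ℝ}
    (hφ : AEStronglyMeasurable φ lam) {C : ℝ} (hC : ∀ x, |φ x| ≤ C) (hf : Integrable f lam) :
    Integrable (fun x => φ x * f x) lam :=
  hf.bdd_mul (c := C) hφ (ae_of_all _ hC)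

theorem integrable_dualForm_comp {X : Type} [MeasurableSpace X] {lam : Measure X}
    {P : X → DualVar n k} (hP : Measurable P) {C : ℝ} (hC : ∀ z, ‖P z‖ ≤ C) {f : X → Mat n n}
    {g : X → Mat n k} {r : X → Mat n n} (hf : ∀ i j, Integrable (fun z => f z i j) lam)
    (hg : ∀ i j, Integrable (fun z => g z i j) lam) (hr : ∀ i j, Integrable (fun z => r z i j) lam) :
    Integrable (fun z => dualForm Λ₁ Λ₂ (P z).toMat (f z) (g z) (r z)) lam := by
  obtain ⟨B, hB⟩ := exists_dualVar_bound (Λ₁ := Λ₁) (Λ₂ := Λ₂) C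
  simp only [dualForm_eq, frob_eq_sum]
  refine ((integrable_finsetSum _ fun i _ => integrable_finsetSum _ fun j _ => ?_).add
    (integrable_finsetSum _ fun i _ => integrable_finsetSum _ fun j _ => ?_)).sub
    ((integrable_finsetSum _ fun i _ => integrable_finsetSum _ fun j _ => ?_).const_mul _)
  · exact integrable_mul_of_bound
      (measurable_pi_iff.1 (measurable_pi_iff.1 hP.fst i) j).aestronglyMeasurable
      (fun z => (hB _ (hC z)).1 i j) (hg i j)
  · exact integrable_mul_of_bound
      (measurable_pi_iff.1 (measurable_pi_iff.1 hP.snd i) j).aestronglyMeasurable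
      (fun z => (hB _ (hC z)).2.1 i j) (hr i j)
  · exact integrable_mul_of_bound
      ((continuous_quadWeight i j).measurable.comp hP).aestronglyMeasurable
      (fun z => (hB _ (hC z)).2.2 i j) (hf i j)

/-- The linear functional of the triple `μ` given by continuous dual variables. -/
def dualPairing (Λ₁ : Mat k k) (Λ₂ : Mat n n) (P : ℝ × Space d → DualVar n k)
    (μ : Triple d n k) : ℝ :=
  pairing μ.q (fun z => (P z).toMat.1) + pairing μ.R (fun z => (P z).toMat.2) -
    1 / 2 * pairing μ.G (fun z => quadWeight Λ₁ Λ₂ (P z).toMat)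

theorem HasMatDensity.pairing_eq_integral_frob {X : Type} [MeasurableSpace X] {m m' : ℕ}
    {ν : MatMeasure X m m'} {lam : Measure X} {f : X → Mat m m'} (h : HasMatDensity ν lam f)
    {φ : X → Mat m m'} (hφ : ∀ i j, AEStronglyMeasurable (fun x => φ x i j) lam) {C : ℝ}
    (hC : ∀ i j x, |φ x i j| ≤ C) :
    Integrable (fun x => frob (φ x) (f x)) lam ∧ pairing ν φ = ∫ x, frob (φ x) (f x) ∂lam := by
  have hint : ∀ i j, Integrable (fun x => φ x i j * f x i j) lam := fun i j =>
    integrable_mul_of_bound (hφ i j) (hC i j) (h.integrable i j)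
  simp only [frob_eq_sum]
  refine ⟨integrable_finsetSum _ fun i _ => integrable_finsetSum _ fun j _ => hint i j, ?_⟩
  rw [h.pairing_eq hint, integral_finsetSum _ fun i _ => integrable_finsetSum _ fun j _ => hint i j]
  exact Finset.sum_congr rfl fun i _ => (integral_finsetSum _ fun j _ => hint i j).symm

theorem dualPairing_eq_integral {P : ℝ × Space d → DualVar n k} (hP : Continuous P) {C : ℝ}
    (hC : ∀ z, ‖P z‖ ≤ C) (μ : Triple d n k) :
    dualPairing Λ₁ Λ₂ P μ = ∫ z, dualForm Λ₁ Λ₂ (P z).toMat (density μ.G μ.ref z)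
      (density μ.q μ.ref z) (density μ.R μ.ref z) ∂μ.ref := by
  obtain ⟨B, hB⟩ := exists_dualVar_bound (Λ₁ := Λ₁) (Λ₂ := Λ₂) C
  obtain ⟨hG, hQ, hR⟩ := μ.hasMatDensity_ref
  obtain ⟨i₁, e₁⟩ := hQ.pairing_eq_integral_frob (φ := fun z => (P z).toMat.1)
    (fun i j => (measurable_pi_iff.1 (measurable_pi_iff.1 hP.measurable.fst i) j).aestronglyMeasurable)
    (fun i j z => (hB _ (hC z)).1 i j)
  obtain ⟨i₂, e₂⟩ := hR.pairing_eq_integral_frob (φ := fun z => (P z).toMat.2)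
    (fun i j => (measurable_pi_iff.1 (measurable_pi_iff.1 hP.measurable.snd i) j).aestronglyMeasurable)
    (fun i j z => (hB _ (hC z)).2.1 i j)
  obtain ⟨i₃, e₃⟩ := hG.pairing_eq_integral_frob (φ := fun z => quadWeight Λ₁ Λ₂ (P z).toMat)
    (fun i j => ((continuous_quadWeight i j).measurable.comp hP.measurable).aestronglyMeasurable)
    (fun i j z => (hB _ (hC z)).2.2 i j)
  simp only [dualForm_eq]
  rw [dualPairing, e₁, e₂, e₃, ← integral_add i₁ i₂, ← integral_const_mul]
  exact (integral_sub (i₁.add i₂) (i₃.const_mul _)).symm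

/-- The pointwise dual inequality, integrated. The positive part of `dualForm` is inserted because
the action takes values in `ℝ≥0∞`. -/
theorem ofReal_dualPairing_le_action (hΛ₁ : Λ₁.PosSemidef) (hΛ₂ : Λ₂.PosDef)
    {P : ℝ × Space d → DualVar n k} (hP : Continuous P) {C : ℝ} (hC : ∀ z, ‖P z‖ ≤ C)
    {S : Set (ℝ × Space d)} (hS : MeasurableSet S) {μ : Triple d n k} (hμ : μ.IsOn S) :
    ENNReal.ofReal (dualPairing Λ₁ Λ₂ P μ) ≤ action Λ₁ Λ₂ S μ := by
  obtain ⟨hG, hQ, hR⟩ := μ.hasMatDensity_ref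
  have hint := integrable_dualForm_comp (Λ₁ := Λ₁) (Λ₂ := Λ₂) hP.measurable hC
    hG.integrable hQ.integrable hR.integrable
  rw [dualPairing_eq_integral hP hC, action,
    Measure.restrict_eq_self_of_ae_mem (Triple.ae_mem_ref hS hμ)]
  refine (ENNReal.ofReal_le_ofReal (integral_mono hint hint.pos_part fun z => le_max_left _ 0)).trans ?_
  rw [ofReal_integral_eq_lintegral_ofReal hint.pos_part (ae_of_all _ fun z => le_max_right _ _)]
  refine lintegral_mono fun z => ?_
  refine le_trans (le_of_eq ?_) (ofReal_dualForm_le hΛ₁ hΛ₂ (density_isSymm hμ.2.2.2 μ.ref z) _ _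
    (P z).toMat)
  rw [ENNReal.ofReal_max, ENNReal.ofReal_zero, max_eq_left zero_le]

/-- Monotone convergence reduces the pointwise supremum to finitely many dual variables, a
measurable selection attains the finite maximum or exceeds it, and this selection is approximated by
continuous functions. The result depends on `μ` only through pairings with continuous functions. -/
theorem exists_lt_dualPairing (hΛ₁ : Λ₁.PosSemidef) (hΛ₂ : Λ₂.PosDef)
    {S : Set (ℝ × Space d)} (hS : MeasurableSet S) {μ : Triple d n k} (hμ : μ.IsOn S) {M : ℝ≥0∞}
    (hM : M < action Λ₁ Λ₂ S μ) :
    ∃ P : ℝ × Space d → DualVar n k, Continuous P ∧ (∃ C, ∀ z, ‖P z‖ ≤ C) ∧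
      M < ENNReal.ofReal (dualPairing Λ₁ Λ₂ P μ) := by
  obtain ⟨hG, hQ, hR⟩ := μ.hasMatDensity_ref
  have hGm := measurable_density μ.G μ.ref
  have hQm := measurable_density μ.q μ.ref
  have hRm := measurable_density μ.R μ.ref
  have hsymm := density_isSymm hμ.2.2.2 μ.ref
  set L : (Mat n k × Mat n n) → ℝ × Space d → ℝ := fun p z =>
    dualForm Λ₁ Λ₂ p (density μ.G μ.ref z) (density μ.q μ.ref z) (density μ.R μ.ref z) with hL
  rw [action, Measure.restrict_eq_self_of_ae_mem (Triple.ae_mem_ref hS hμ)] at hM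
  have hsup : ∀ z, actionDensity Λ₁ Λ₂ (density μ.G μ.ref z) (density μ.q μ.ref z)
      (density μ.R μ.ref z) = ⨆ N : ℕ, ⨆ i : Fin N, ENNReal.ofReal (L (dualSeq n k i) z) := by
    intro z
    rw [actionDensity_eq_iSup_dualSeq hΛ₁ hΛ₂ (hsymm z)]
    refine le_antisymm (iSup_le fun i => ?_) (iSup_le fun N => iSup_le fun i => ?_)
    · exact le_iSup_of_le (i + 1) (le_iSup_of_le (⟨i, i.lt_succ_self⟩ : Fin (i + 1)) le_rfl)
    · exact le_iSup (fun i => ENNReal.ofReal (L (dualSeq n k i) z)) (i : ℕ)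
  simp only [hsup] at hM
  rw [lintegral_iSup] at hM
  rotate_left
  · intro N
    exact Measurable.iSup fun i => (measurable_dualForm hGm hQm hRm _).ennreal_ofReal
  · intro N N' hNN' z
    exact iSup_le fun i => le_iSup_of_le (Fin.castLE hNN' i) le_rfl
  obtain ⟨N, hN⟩ := lt_iSup_iff.1 hM
  obtain ⟨P, hP, ⟨C₀, hC₀⟩, hPN⟩ := exists_measurable_selection (Λ₁ := Λ₁) (Λ₂ := Λ₂) hGm hQm hRm N
  set C := max C₀ 0
  have hC : ∀ z, ‖P z‖ ≤ C := fun z => (hC₀ z).trans (le_max_left _ _)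
  have hC0 : 0 ≤ C := le_max_right _ _
  have hint := integrable_dualForm_comp (Λ₁ := Λ₁) (Λ₂ := Λ₂) hP hC
    hG.integrable hQ.integrable hR.integrable
  have hlt : M < ENNReal.ofReal (∫ z, L (P z).toMat z ∂μ.ref) := by
    refine hN.trans_le ?_
    rw [ofReal_integral_eq_lintegral_ofReal hint (ae_of_all _ fun z => (hPN z).1)]
    exact lintegral_mono fun z => iSup_le fun i => ENNReal.ofReal_le_ofReal ((hPN z).2 i i.2)
  obtain ⟨g, hgc, hg⟩ := exists_seq_continuous_tendsto_ae (lam := μ.ref) (f := P)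
    (MemLp.of_bound hP.aestronglyMeasurable C (ae_of_all _ hC))
  obtain ⟨B, hB⟩ := exists_dualForm_bound (n := n) (k := k) (Λ₁ := Λ₁) (Λ₂ := Λ₂) C
  -- Clamping leaves the limit `P` unchanged and bounds the approximations uniformly, which supplies
  -- the dominating function.
  have hlim : Tendsto (fun i => ∫ z, L (clamp C (g i z)).toMat z ∂μ.ref) atTop
      (𝓝 (∫ z, L (P z).toMat z ∂μ.ref)) := by
    refine tendsto_integral_of_dominated_convergence (fun z =>
      B * ((∑ i, ∑ j, |density μ.G μ.ref z i j|) + (∑ i, ∑ j, |density μ.q μ.ref z i j|) +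
        ∑ i, ∑ j, |density μ.R μ.ref z i j|)) (fun i => ?_) ?_ (fun i => ae_of_all _ fun z => ?_) ?_
    · exact (measurable_dualForm_comp ((continuous_clamp C).comp (hgc i)).measurable
        hGm hQm hRm).aestronglyMeasurable
    · refine Integrable.const_mul (((integrable_finsetSum _ fun i _ => integrable_finsetSum _
        fun j _ => (hG.integrable i j).abs).add (integrable_finsetSum _ fun i _ =>
        integrable_finsetSum _ fun j _ => (hQ.integrable i j).abs)).add (integrable_finsetSum _
        fun i _ => integrable_finsetSum _ fun j _ => (hR.integrable i j).abs)) _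
    · exact hB _ (norm_clamp_le hC0 _) _ _ _
    · filter_upwards [hg] with z hz
      have h1 : Tendsto (fun i => clamp C (g i z)) atTop (𝓝 (P z)) := by
        have := ((continuous_clamp C).tendsto (P z)).comp hz
        rwa [clamp_eq (hC z)] at this
      exact (((continuous_dualForm _ _ _).comp continuous_toMat).tendsto (P z)).comp h1
  obtain ⟨i, hi⟩ := ((ENNReal.tendsto_ofReal hlim).eventually (lt_mem_nhds hlt)).exists
  have hPc : Continuous fun z => clamp C (g i z) := (continuous_clamp C).comp (hgc i)
  refine ⟨fun z => clamp C (g i z), hPc, ⟨C, fun z => norm_clamp_le hC0 _⟩, ?_⟩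
  rwa [dualPairing_eq_integral hPc fun z => norm_clamp_le hC0 _]

/-- Weak* lower semicontinuity of the action. -/
theorem eventually_lt_action (hΛ₁ : Λ₁.PosSemidef) (hΛ₂ : Λ₂.PosDef)
    {S : Set (ℝ × Space d)} (hS : MeasurableSet S) {μ : Triple d n k} (hμ : μ.IsOn S)
    {με : ℝ → Triple d n k} (hε : ∀ᶠ ε in 𝓝[>] (0 : ℝ), (με ε).IsOn S)
    (hG : WeakStarTendsto S (fun ε => (με ε).G) μ.G)
    (hq : WeakStarTendsto S (fun ε => (με ε).q) μ.q)
    (hR : WeakStarTendsto S (fun ε => (με ε).R) μ.R) {M : ℝ≥0∞} (hM : M < action Λ₁ Λ₂ S μ) :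
    ∀ᶠ ε in 𝓝[>] (0 : ℝ), M < action Λ₁ Λ₂ S (με ε) := by
  -- One fixed continuous dual variable certifies the bound for `μ`. Its pairing passes to the weak*
  -- limit and bounds every regularized action from below.
  obtain ⟨P, hP, ⟨C, hC⟩, hlt⟩ := exists_lt_dualPairing hΛ₁ hΛ₂ hS hμ hM
  have h0 := (continuous_toMat (n := n) (k := k)).comp hP
  have hQc : Continuous fun z => quadWeight Λ₁ Λ₂ (P z).toMat :=
    continuous_pi fun i => continuous_pi fun j => (continuous_quadWeight i j).comp hP
  have hlim : Tendsto (fun ε => dualPairing Λ₁ Λ₂ P (με ε)) (𝓝[>] 0)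
      (𝓝 (dualPairing Λ₁ Λ₂ P μ)) :=
    ((hq _ (continuous_fst.comp h0).continuousOn).add
      (hR _ (continuous_snd.comp h0).continuousOn)).sub
      ((hG _ hQc.continuousOn).const_mul _)
  filter_upwards [(ENNReal.tendsto_ofReal hlim).eventually (lt_mem_nhds hlt), hε] with ε h₁ h₂
  exact h₁.trans_le (ofReal_dualPairing_le_action hΛ₁ hΛ₂ hP hC hS h₂)

end LowerSemicontinuity

end WBTransport

end

noncomputable section

namespace WBTransport

/-! ### Regularization of a solution of the continuity equation -/

section Identities

variable {d : ℕ} {Ω : Set (Space d)} {x₀ : Space d} {s : ℝ} {η₁ : ℝ → ℝ} {η₂ : Space d → ℝ}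

theorem contract_half_zero (s : ℝ) : contract (1 / 2 : ℝ) s 0 = s / 2 := by
  rw [contract, smul_eq_mul]
  ring

theorem contract_half_one (s : ℝ) : contract (1 / 2 : ℝ) s 1 = 1 - s / 2 := by
  rw [contract, smul_eq_mul]
  ring

/-- The space-time mollifier. -/
abbrev prodKernel (η₁ : ℝ → ℝ) (η₂ : Space d → ℝ) (p : ℝ × Space d) : ℝ := η₁ p.1 * η₂ p.2

/-- A measure on `Ω` is placed on the time slice `τ`. Its space-time mollification factorizes, and
the time factor is the derivative of the cutoff centred at the contracted time. -/
theorem moll_map_prodMk (lam : Measure (Space d)) (f : Space d → ℝ) (τ : ℝ) (z : ℝ × Space d) :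
    moll ((1 / 2 : ℝ), x₀) s (prodKernel η₁ η₂) (lam.map (Prod.mk τ)) (fun w => f w.2) z =
      η₁ (z.1 - contract (1 / 2) s τ) * moll x₀ s η₂ lam f z.2 := by
  rw [moll, (measurableEmbedding_prodMk_left τ).integral_map, moll, ← integral_const_mul]
  refine integral_congr_ae (ae_of_all _ fun y => ?_)
  exact mul_assoc _ _ _

theorem map_prodMk_compl_timeSpace {lam : Measure (Space d)} (hΩ : MeasurableSet Ω)
    (h0 : lam Ωᶜ = 0) {τ : ℝ} (hτ : τ ∈ Set.Icc (0 : ℝ) 1) :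
    lam.map (Prod.mk τ) (timeSpace Ω)ᶜ = 0 := by
  have hm : MeasurableSet (timeSpace Ω)ᶜ := (measurableSet_Icc.prod hΩ).compl
  rw [Measure.map_apply measurable_prodMk_left hm]
  refine measure_mono_null (fun x hx hxΩ => hx ⟨hτ, hxΩ⟩) h0

variable {φ : ℝ × Space d → ℝ} {φ' : ℝ × Space d → ℝ × Space d →L[ℝ] ℝ}

theorem integral_timeDeriv_mul (hΩ : IsCompact Ω) (h0 : volume (Ω \ interior Ω) = 0)
    (hφ : ContinuousOn φ (timeSpace Ω)) (hφ' : ContinuousOn φ' (timeSpace Ω))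
    (hd : ∀ z ∈ interior (timeSpace Ω), HasFDerivAt φ (φ' z) z)
    {f : Space d → ℝ} (hf : Integrable f (volume.restrict Ω)) :
    ∫ z in timeSpace Ω, φ' z (1, 0) * f z.2 =
      (∫ x in Ω, φ (1, x) * f x) - ∫ x in Ω, φ (0, x) * f x := by
  have := integral_by_parts_time hΩ h0 hφ hφ' hd (a := fun _ => 1) (a' := fun _ => 0)
    (fun t => hasDerivAt_const t 1) continuous_const hf
  simpa using this

/-- This moves smeared boundary data to the true end point: the test function averaged around time
`τ` is exchanged for its value at time `1`, at the price of a density whose time derivative is the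
mollified slice measure. For `τ = 0` the value at time `0` is recovered by subtracting this from the
case of a density constant in time. -/
theorem IsKernelPair.integral_timeDeriv_mul_cutoff (K : IsKernelPair Ω x₀ s η₁ η₂)
    (hΩ : IsCompact Ω) (h0 : volume (Ω \ interior Ω) = 0)
    (hφ : ContinuousOn φ (timeSpace Ω)) (hφ' : ContinuousOn φ' (timeSpace Ω))
    (hd : ∀ z ∈ interior (timeSpace Ω), HasFDerivAt φ (φ' z) z)
    {lam : Measure (Space d)} [IsFiniteMeasure lam] (hlam : lam Ωᶜ = 0)
    {f : Space d → ℝ} (hf : Integrable f lam) {τ : ℝ} (hτ : τ ∈ Set.Icc (0 : ℝ) 1) :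
    ∫ z in timeSpace Ω, φ' z (1, 0) *
        (cutoff η₁ (contract (1 / 2) s τ) z.1 * moll x₀ s η₂ lam f z.2) =
      (∫ x in Ω, φ (1, x) * moll x₀ s η₂ lam f x) -
        ∫ y, avg ((1 / 2 : ℝ), x₀) s (prodKernel η₁ η₂) φ (τ, y) * f y ∂lam := by
  set c := contract (1 / 2 : ℝ) s τ with hc
  have hs := K.time.pos
  have hs1 := K.time.lt_one
  have hc' : c = 1 / 2 + (1 - s) * (τ - 1 / 2) := rfl
  -- The contracted time has distance at least `s/2` from both ends, so the cutoff is `1` at time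
  -- `1`.
  have hc1 : s / 2 ≤ c := by nlinarith [hτ.1]
  have hc2 : c + s / 2 ≤ 1 := by nlinarith [hτ.2]
  have hQ := isCompact_timeSpace hΩ
  have hmsm := K.space.contDiff_moll hf
  have hmi : Integrable (moll x₀ s η₂ lam f) (volume.restrict Ω) :=
    hmsm.continuous.continuousOn.integrableOn_compact hΩ
  have hcut : Continuous (cutoff η₁ c) := (contDiff_cutoff K.time.smooth c).continuous
  have hη : Continuous fun t => η₁ (t - c) := by
    have := K.time.smooth.continuous
    fun_prop
  have key := integral_by_parts_time hΩ h0 hφ hφ' hd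
    (fun t => hasDerivAt_cutoff K.time.smooth.continuous c t) hη hmi
  rw [K.cutoff_eq_one hc1 hc2, cutoff_zero] at key
  simp only [one_mul, zero_mul, mul_zero, integral_zero, sub_zero] at key
  have hf' : Integrable (fun w : ℝ × Space d => f w.2) (lam.map (Prod.mk τ)) :=
    (measurableEmbedding_prodMk_left τ).integrable_map_iff.2 hf
  have hadj := K.prod.setIntegral_mul_moll hQ
    (map_prodMk_compl_timeSpace hΩ.measurableSet hlam hτ) hφ hf'
  rw [(measurableEmbedding_prodMk_left τ).integral_map] at hadj
  simp only [moll_map_prodMk] at hadj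
  have i₁ : Integrable (fun z => φ' z (1, 0) * (cutoff η₁ c z.1 * moll x₀ s η₂ lam f z.2))
      (volume.restrict (timeSpace Ω)) :=
    ((hφ'.clm_apply continuousOn_const).mul ((hcut.comp continuous_fst).mul
      (hmsm.continuous.comp continuous_snd)).continuousOn).integrableOn_compact hQ
  have i₂ : Integrable (fun z => φ z * (η₁ (z.1 - c) * moll x₀ s η₂ lam f z.2))
      (volume.restrict (timeSpace Ω)) :=
    (hφ.mul ((hη.comp continuous_fst).mul
      (hmsm.continuous.comp continuous_snd)).continuousOn).integrableOn_compact hQ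
  rw [integral_add i₁ i₂] at key
  have hadj' : ∫ z in timeSpace Ω, φ z * (η₁ (z.1 - c) * moll x₀ s η₂ lam f z.2) =
      ∫ y, avg ((1 / 2 : ℝ), x₀) s (prodKernel η₁ η₂) φ (τ, y) * f y ∂lam := hadj
  rw [hadj'] at key
  linarith

end Identities

/-! ### Matrix-valued mollification -/

section MatMoll

variable {E : Type} [NormedAddCommGroup E] [NormedSpace ℝ E] [MeasureSpace E] {m m' : ℕ}

/-- Entrywise mollification of a matrix-valued density. -/
def matMoll (c : E) (s : ℝ) (η : E → ℝ) (lam : Measure E) (f : E → Mat m m') (z : E) : Mat m m' :=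
  Matrix.of fun i j => moll c s η lam (fun w => f w i j) z

theorem matMoll_apply (c : E) (s : ℝ) (η : E → ℝ) (lam : Measure E) (f : E → Mat m m') (z : E)
    (i : Fin m) (j : Fin m') :
    matMoll c s η lam f z i j = moll c s η lam (fun w => f w i j) z := rfl

variable [FiniteDimensional ℝ E] [BorelSpace E] [(volume : Measure E).IsAddHaarMeasure]
  {S : Set E} {c : E} {s : ℝ} {η : E → ℝ} {lam : Measure E}

theorem IsMollifier.isSmooth_matMoll (h : IsMollifier S c s η) {f : E → Mat m m'}
    (hf : ∀ i j, Integrable (fun x => f x i j) lam) : IsSmooth (matMoll c s η lam f) :=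
  fun i j => h.contDiff_moll (hf i j)

theorem IsSmooth.integrable {g : E → Mat m m'} (hg : IsSmooth g) (hS : IsCompact S) (i : Fin m)
    (j : Fin m') : Integrable (fun z => g z i j) (volume.restrict S) :=
  (hg i j).continuous.continuousOn.integrableOn_compact hS

theorem IsSmooth.add {g g' : E → Mat m m'} (hg : IsSmooth g) (hg' : IsSmooth g') :
    IsSmooth fun z => g z + g' z := fun i j => (hg i j).add (hg' i j)

theorem IsSmooth.smul {a : E → ℝ} (ha : ContDiff ℝ ∞ a) {g : E → Mat m m'} (hg : IsSmooth g) :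
    IsSmooth fun z => a z • g z := fun i j => ha.mul (hg i j)

theorem isSmooth_const (A : Mat m m') : IsSmooth fun _ : E => A := fun _ _ => contDiff_const

theorem IsSmooth.comp {E' : Type} [NormedAddCommGroup E'] [NormedSpace ℝ E'] {g : E → Mat m m'}
    (hg : IsSmooth g) {a : E' → E} (ha : ContDiff ℝ ∞ a) : IsSmooth fun z => g (a z) :=
  fun i j => (hg i j).comp ha

omit [FiniteDimensional ℝ E] [BorelSpace E] [(volume : Measure E).IsAddHaarMeasure] in
theorem matMoll_isSymm {f : E → Mat m m} (hf : ∀ x, (f x).IsSymm) (z : E) :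
    (matMoll c s η lam f z).IsSymm := by
  ext i j
  simp only [Matrix.transpose_apply, matMoll_apply]
  congr 1
  ext w
  exact (hf w).apply i j

theorem dotProduct_mulVec_eq_sum (A : Mat m m) (v : Fin m → ℝ) :
    v ⬝ᵥ (A *ᵥ v) = ∑ i, ∑ j, v i * v j * A i j := by
  simp only [dotProduct, Matrix.mulVec, Finset.mul_sum]
  exact Finset.sum_congr rfl fun i _ => Finset.sum_congr rfl fun j _ => by ring

theorem IsMollifier.matMoll_posSemidef (h : IsMollifier S c s η) {f : E → Mat m m}
    (hf : ∀ i j, Integrable (fun x => f x i j) lam) (hs : ∀ x, (f x).IsSymm)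
    (hp : ∀ v : Fin m → ℝ, ∀ᵐ x ∂lam, 0 ≤ v ⬝ᵥ (f x *ᵥ v)) (z : E) :
    (matMoll c s η lam f z).PosSemidef := by
  refine Matrix.PosSemidef.of_dotProduct_mulVec_nonneg
    ((isHermitian_iff_isSymm _).2 (matMoll_isSymm hs z)) fun v => ?_
  have : star v ⬝ᵥ (matMoll c s η lam f z *ᵥ v) =
      moll c s η lam (fun w => v ⬝ᵥ (f w *ᵥ v)) z := by
    rw [star_trivial]
    simp only [dotProduct_mulVec_eq_sum]
    rw [h.moll_sum _ fun i => integrable_finsetSum _ fun j _ => (hf i j).const_mul _]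
    refine Finset.sum_congr rfl fun i _ => ?_
    rw [h.moll_sum _ fun j => (hf i j).const_mul _]
    refine Finset.sum_congr rfl fun j _ => ?_
    rw [IsMollifier.moll_const_mul]
    rfl
  rw [this]
  exact h.moll_nonneg (hp v) z

end MatMoll

/-! ### Densities of positive semidefinite measures -/

section PSD

variable {X : Type} [MeasurableSpace X] {m : ℕ}

theorem HasMatDensity.ae_nonneg_quadratic {ν : MatMeasure X m m} {lam : Measure X}
    [SigmaFinite lam] {f : X → Mat m m} (h : HasMatDensity ν lam f) (hν : ∀ E, (ν E).PosSemidef)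
    (v : Fin m → ℝ) : ∀ᵐ x ∂lam, 0 ≤ v ⬝ᵥ (f x *ᵥ v) := by
  simp only [dotProduct_mulVec_eq_sum]
  have hint : ∀ i j, Integrable (fun x => v i * v j * f x i j) lam := fun i j =>
    (h.integrable i j).const_mul _
  refine ae_nonneg_of_forall_setIntegral_nonneg
    (integrable_finsetSum _ fun i _ => integrable_finsetSum _ fun j _ => hint i j)
    fun E hE _ => ?_
  rw [integral_finsetSum _ fun i _ => integrable_finsetSum _ fun j _ => (hint i j).integrableOn]
  have h0 := (hν E).dotProduct_mulVec_nonneg v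
  rw [star_trivial, dotProduct_mulVec_eq_sum] at h0
  refine h0.trans_eq (Finset.sum_congr rfl fun i _ => ?_)
  rw [integral_finsetSum _ fun j _ => (hint i j).integrableOn]
  refine Finset.sum_congr rfl fun j _ => ?_
  rw [integral_const_mul, h.apply hE]

/-- For each fixed vector the quadratic form is nonnegative almost everywhere. A countable dense set
of vectors gives one common null set, and continuity does the rest. -/
theorem HasMatDensity.ae_posSemidef {ν : MatMeasure X m m} {lam : Measure X}
    [SigmaFinite lam] {f : X → Mat m m} (h : HasMatDensity ν lam f) (hν : ∀ E, (ν E).PosSemidef)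
    (hs : ∀ x, (f x).IsSymm) : ∀ᵐ x ∂lam, (f x).PosSemidef := by
  have hall := ae_all_iff.2 fun i : ℕ =>
    h.ae_nonneg_quadratic hν (TopologicalSpace.denseSeq (Fin m → ℝ) i)
  filter_upwards [hall] with x hx
  refine Matrix.PosSemidef.of_dotProduct_mulVec_nonneg ((isHermitian_iff_isSymm _).2 (hs x))
    fun v => ?_
  rw [star_trivial]
  have hc : Continuous fun v : Fin m → ℝ => v ⬝ᵥ (f x *ᵥ v) := by
    simp only [dotProduct_mulVec_eq_sum]
    fun_prop
  have hcl : IsClosed {v : Fin m → ℝ | 0 ≤ v ⬝ᵥ (f x *ᵥ v)} := isClosed_le continuous_const hc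
  have hsub : Set.range (TopologicalSpace.denseSeq (Fin m → ℝ)) ⊆
      {v : Fin m → ℝ | 0 ≤ v ⬝ᵥ (f x *ᵥ v)} := by
    rintro _ ⟨i, rfl⟩
    exact hx i
  exact (hcl.closure_subset_iff.2 hsub)
    ((TopologicalSpace.denseRange_denseSeq (Fin m → ℝ)).closure_range ▸ Set.mem_univ v)

theorem HasMatDensity.posSemidef {ν : MatMeasure X m m} {lam : Measure X}
    {f : X → Mat m m} (h : HasMatDensity ν lam f) (hf : ∀ x, (f x).PosSemidef) (E : Set X) :
    (ν E).PosSemidef := by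
  by_cases hE : MeasurableSet E
  swap
  · rw [VectorMeasure.not_measurable _ hE]
    exact Matrix.PosSemidef.zero
  have hs : (ν E).IsSymm := h.isSymmValued (fun x => (hf x).isSymm_real) E
  refine Matrix.PosSemidef.of_dotProduct_mulVec_nonneg ((isHermitian_iff_isSymm _).2 hs)
    fun v => ?_
  have hint : ∀ i j, Integrable (fun x => v i * v j * f x i j) (lam.restrict E) := fun i j =>
    ((h.integrable i j).const_mul _).integrableOn
  have : star v ⬝ᵥ (ν E *ᵥ v) = ∫ x in E, v ⬝ᵥ (f x *ᵥ v) ∂lam := by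
    rw [star_trivial]
    simp only [dotProduct_mulVec_eq_sum]
    rw [integral_finsetSum _ fun i _ => integrable_finsetSum _ fun j _ => hint i j]
    refine Finset.sum_congr rfl fun i _ => ?_
    rw [integral_finsetSum _ fun j _ => hint i j]
    refine Finset.sum_congr rfl fun j _ => ?_
    rw [integral_const_mul, h.apply hE]
  rw [this]
  refine integral_nonneg fun x => ?_
  simpa using (hf x).dotProduct_mulVec_nonneg v

end PSD

end WBTransport

end

noncomputable section

namespace WBTransport

/-! ### The regularized triple -/

section Operators

variable {d n k m m' : ℕ}

theorem linearMap_apply_eq_sum (L : Mat n n →ₗ[ℝ] Mat m m') (A : Mat n n) (a : Fin m)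
    (b : Fin m') :
    L A a b = ∑ i, ∑ j, L (Matrix.single i j 1) a b * A i j := by
  conv_lhs => rw [Matrix.matrix_eq_sum_single A]
  simp only [map_sum, Matrix.sum_apply]
  refine Finset.sum_congr rfl fun i _ => Finset.sum_congr rfl fun j _ => ?_
  have : Matrix.single i j (A i j) = A i j • Matrix.single i j (1 : ℝ) := by
    rw [Matrix.smul_single, smul_eq_mul, mul_one]
  rw [this, map_smul, Matrix.smul_apply, smul_eq_mul, mul_comm]

/-- The adjoint of the zeroth order part of `D*`. -/
def DiffOp.zerothAdj (D : DiffOp d n k) (Y : Mat n k) : Mat n n :=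
  Matrix.of fun i j => ∑ a, ∑ b, D.zeroth (Matrix.single i j 1) a b * Y a b

theorem DiffOp.zerothAdj_apply (D : DiffOp d n k) (Y : Mat n k) (i j : Fin n) :
    D.zerothAdj Y i j = ∑ a, ∑ b, D.zeroth (Matrix.single i j 1) a b * Y a b := rfl

theorem DiffOp.apply_apply (D : DiffOp d n k) (Φ : ℝ × Space d → Mat n n)
    (Φ' : ℝ × Space d → Matrix (Fin n) (Fin n) (ℝ × Space d →L[ℝ] ℝ)) (z : ℝ × Space d)
    (a : Fin n) (b : Fin k) :
    D.apply Φ Φ' z a b = (∑ i, ∑ j, D.zeroth (Matrix.single i j 1) a b * Φ z i j) +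
      ∑ l, ∑ i, ∑ j, D.first l (Matrix.single i j 1) a b *
        Φ' z i j (0, EuclideanSpace.single l 1) := by
  rw [DiffOp.apply, Matrix.add_apply, Matrix.sum_apply, linearMap_apply_eq_sum]
  congr 1
  refine Finset.sum_congr rfl fun l _ => ?_
  rw [linearMap_apply_eq_sum]
  rfl

end Operators

/-! ### Linearity of the averaging of test functions. -/

section Avg

variable {E : Type} [NormedAddCommGroup E] [NormedSpace ℝ E] [MeasureSpace E]
  [FiniteDimensional ℝ E] [BorelSpace E] [(volume : Measure E).IsAddHaarMeasure]
  {S : Set E} {c : E} {s : ℝ} {η : E → ℝ}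

theorem IsMollifier.avg_sum (h : IsMollifier S c s η) (hS : IsCompact S) {ι : Type*}
    (t : Finset ι) {φ : ι → E → ℝ} (hφ : ∀ i, ContinuousOn (φ i) S) {w : E} (hw : w ∈ S) :
    avg c s η (fun z => ∑ i ∈ t, φ i z) w = ∑ i ∈ t, avg c s η (φ i) w := by
  simp only [avg, Finset.smul_sum]
  exact integral_finsetSum _ fun i _ => h.integrable_avg hS (hφ i) hw

theorem IsMollifier.avg_add (h : IsMollifier S c s η) (hS : IsCompact S)
    {φ ψ : E → ℝ} (hφ : ContinuousOn φ S) (hψ : ContinuousOn ψ S) {w : E} (hw : w ∈ S) :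
    avg c s η (fun z => φ z + ψ z) w = avg c s η φ w + avg c s η ψ w := by
  simp only [avg, smul_add]
  exact integral_add (h.integrable_avg hS hφ hw) (h.integrable_avg hS hψ hw)

theorem avg_const_mul (a : ℝ) (φ : E → ℝ) (w : E) :
    avg c s η (fun z => a * φ z) w = a * avg c s η φ w := by
  simp only [avg, smul_eq_mul, ← integral_const_mul]
  refine integral_congr_ae (ae_of_all _ fun y => ?_)
  ring

theorem IsMollifier.avg_congr (h : IsMollifier S c s η) {φ ψ : E → ℝ}
    (hφ : ∀ z ∈ S, φ z = ψ z) {w : E} (hw : w ∈ S) : avg c s η φ w = avg c s η ψ w := by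
  refine integral_congr_ae (ae_of_all _ fun y => ?_)
  by_cases hy : η y = 0
  · simp [hy]
  · simp only
    rw [hφ _ (interior_subset (h.mem w hw y hy))]

end Avg

/-! ### Densities of the regularized triple and of its end points. -/

section Reg

variable {d n k : ℕ}

/-- The variation of the momentum, as a density. -/
def Triple.momentumDensity (μ : Triple d n k) (z : ℝ × Space d) : ℝ :=
  ∑ a, ∑ b, |density μ.q μ.ref z a b|

/-- The spatial marginal of the variation of the momentum `q`. -/
def Triple.momentumMarginal (μ : Triple d n k) : Measure (Space d) :=
  (μ.ref.withDensity fun z => ENNReal.ofReal (μ.momentumDensity z)).map Prod.snd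

variable (Ω : Set (Space d)) (x₀ : Space d) (s : ℝ) (η₁ : ℝ → ℝ) (η₂ : Space d → ℝ)
  (D : DiffOp d n k) (μ : Triple d n k) (G G₀ G₁ : MatMeasure (Space d) n n)

/-- The mollified momentum marginal. -/
def mollMarginal : Space d → ℝ := moll x₀ s η₂ μ.momentumMarginal fun _ => 1

/-- The multiple of the identity that is added to the regularized measures. -/
def background (x : Space d) : ℝ := √s * mollMarginal x₀ s η₂ μ x + s

/-- The mollified density of a measure on `Ω`. -/
def endMoll : Space d → Mat n n := matMoll x₀ s η₂ (dominating G) (density G (dominating G))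

/-- The regularized density of a measure on `Ω`. -/
def endReg (x : Space d) : Mat n n :=
  endMoll x₀ s η₂ G x + background x₀ s η₂ μ x • (1 : Mat n n)

/-- The mollification in space-time of a density with respect to the reference measure. -/
abbrev refMoll {m m' : ℕ} (f : ℝ × Space d → Mat m m') : ℝ × Space d → Mat m m' :=
  matMoll ((1 / 2 : ℝ), x₀) s (prodKernel η₁ η₂) μ.ref f

/-- The part of the regularized density that comes from the end points. -/
def endPart (z : ℝ × Space d) : Mat n n :=
  (1 - cutoff η₁ (contract (1 / 2) s 0) z.1) • endMoll x₀ s η₂ G₀ z.2 +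
    cutoff η₁ (contract (1 / 2) s 1) z.1 • endMoll x₀ s η₂ G₁ z.2

/-- The regularized density of `G`. -/
def regG (z : ℝ × Space d) : Mat n n :=
  (1 - s) • refMoll x₀ s η₁ η₂ μ (density μ.G μ.ref) z + endPart x₀ s η₁ η₂ G₀ G₁ z +
    background x₀ s η₂ μ z.2 • (1 : Mat n n)

/-- The regularized density of `q`. -/
def regq (z : ℝ × Space d) : Mat n k :=
  (1 - s) • refMoll x₀ s η₁ η₂ μ (density μ.q μ.ref) z

/-- The contribution of the zeroth order part of `D*` to the regularized density of `R`. -/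
def regError (z : ℝ × Space d) : Mat n n :=
  s • refMoll x₀ s η₁ η₂ μ (fun w => D.zerothAdj (density μ.q μ.ref w)) z

/-- The regularized density of `R`. -/
def regR (z : ℝ × Space d) : Mat n n :=
  refMoll x₀ s η₁ η₂ μ (density μ.R μ.ref) z + regError x₀ s η₁ η₂ D μ z

/-- The regularized triple. -/
def regTriple : Triple d n k where
  G := matWithDensity (volume.restrict (timeSpace Ω)) (regG x₀ s η₁ η₂ μ G₀ G₁)
  q := matWithDensity (volume.restrict (timeSpace Ω)) (regq x₀ s η₁ η₂ μ)
  R := matWithDensity (volume.restrict (timeSpace Ω)) (regR x₀ s η₁ η₂ D μ)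

/-- The regularized end point. -/
def regEnd : MatMeasure (Space d) n n :=
  matWithDensity (volume.restrict Ω) (endReg x₀ s η₂ μ G)

end Reg

/-! ### Smoothness, symmetry and positivity of the regularized densities. -/

section RegLemmas

variable {d n k : ℕ} {Ω : Set (Space d)} {x₀ : Space d} {s : ℝ} {η₁ : ℝ → ℝ}
  {η₂ : Space d → ℝ} {D : DiffOp d n k} {μ : Triple d n k} {G G₀ G₁ : MatMeasure (Space d) n n}

theorem integrable_density_dominating (ν : MatMeasure (Space d) n n) (i j : Fin n) :
    Integrable (fun x => density ν (dominating ν) x i j) (dominating ν) :=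
  (hasMatDensity_density Measure.AbsolutelyContinuous.rfl).integrable i j

theorem Triple.integrable_momentumDensity (μ : Triple d n k) :
    Integrable μ.momentumDensity μ.ref :=
  integrable_finsetSum _ fun a _ => integrable_finsetSum _ fun b _ =>
    (μ.hasMatDensity_ref.2.1.integrable a b).abs

theorem integrable_zerothAdj (D : DiffOp d n k) (μ : Triple d n k) (i j : Fin n) :
    Integrable (fun z => D.zerothAdj (density μ.q μ.ref z) i j) μ.ref := by
  simp only [DiffOp.zerothAdj_apply]
  exact integrable_finsetSum _ fun a _ => integrable_finsetSum _ fun b _ =>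
    (μ.hasMatDensity_ref.2.1.integrable a b).const_mul _

instance (μ : Triple d n k) : IsFiniteMeasure μ.momentumMarginal := by
  have : IsFiniteMeasure (μ.ref.withDensity fun z => ENNReal.ofReal (μ.momentumDensity z)) :=
    isFiniteMeasure_withDensity_ofReal μ.integrable_momentumDensity.2
  unfold Triple.momentumMarginal
  infer_instance

theorem momentumMarginal_compl (hΩ : IsCompact Ω) (hμ : μ.IsOn (timeSpace Ω)) :
    μ.momentumMarginal Ωᶜ = 0 := by
  rw [Triple.momentumMarginal, Measure.map_apply measurable_snd hΩ.measurableSet.compl]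
  refine withDensity_absolutelyContinuous _ _ ?_
  have := Triple.ae_mem_ref (isCompact_timeSpace hΩ).measurableSet hμ
  rw [ae_iff] at this
  exact measure_mono_null (t := {z | z ∉ timeSpace Ω})
    (fun z (hz : z.2 ∉ Ω) (hz' : z ∈ timeSpace Ω) => hz hz'.2) this

theorem IsKernelPair.contDiff_mollMarginal (K : IsKernelPair Ω x₀ s η₁ η₂) (μ : Triple d n k) :
    ContDiff ℝ ∞ (mollMarginal x₀ s η₂ μ) :=
  K.space.contDiff_moll (integrable_const _)

theorem IsKernelPair.mollMarginal_nonneg (K : IsKernelPair Ω x₀ s η₁ η₂) (μ : Triple d n k)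
    (x : Space d) : 0 ≤ mollMarginal x₀ s η₂ μ x :=
  K.space.moll_nonneg (ae_of_all _ fun _ => zero_le_one) x

theorem IsKernelPair.contDiff_background (K : IsKernelPair Ω x₀ s η₁ η₂) (μ : Triple d n k) :
    ContDiff ℝ ∞ (background x₀ s η₂ μ) :=
  (contDiff_const.mul (K.contDiff_mollMarginal μ)).add contDiff_const

theorem IsKernelPair.le_background (K : IsKernelPair Ω x₀ s η₁ η₂) (μ : Triple d n k)
    (x : Space d) : s ≤ background x₀ s η₂ μ x :=
  le_add_of_nonneg_left (mul_nonneg (Real.sqrt_nonneg _) (K.mollMarginal_nonneg μ x))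

theorem IsKernelPair.isSmooth_endMoll (K : IsKernelPair Ω x₀ s η₁ η₂)
    (G : MatMeasure (Space d) n n) : IsSmooth (endMoll x₀ s η₂ G) :=
  K.space.isSmooth_matMoll (integrable_density_dominating G)

theorem IsKernelPair.isSmooth_endReg (K : IsKernelPair Ω x₀ s η₁ η₂) (μ : Triple d n k)
    (G : MatMeasure (Space d) n n) : IsSmooth (endReg x₀ s η₂ μ G) :=
  (K.isSmooth_endMoll G).add (IsSmooth.smul (K.contDiff_background μ) (isSmooth_const 1))

theorem IsKernelPair.isSmooth_endPart (K : IsKernelPair Ω x₀ s η₁ η₂)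
    (G₀ G₁ : MatMeasure (Space d) n n) : IsSmooth (endPart x₀ s η₁ η₂ G₀ G₁) :=
  (IsSmooth.smul (contDiff_const.sub ((contDiff_cutoff K.time.smooth _).comp contDiff_fst))
    ((K.isSmooth_endMoll G₀).comp contDiff_snd)).add
      (IsSmooth.smul ((contDiff_cutoff K.time.smooth _).comp contDiff_fst)
        ((K.isSmooth_endMoll G₁).comp contDiff_snd))

theorem IsKernelPair.isSmooth_regG (K : IsKernelPair Ω x₀ s η₁ η₂) (μ : Triple d n k)
    (G₀ G₁ : MatMeasure (Space d) n n) : IsSmooth (regG x₀ s η₁ η₂ μ G₀ G₁) :=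
  ((IsSmooth.smul contDiff_const (K.prod.isSmooth_matMoll μ.hasMatDensity_ref.1.integrable)).add
    (K.isSmooth_endPart G₀ G₁)).add
      (IsSmooth.smul ((K.contDiff_background μ).comp contDiff_snd) (isSmooth_const 1))

theorem IsKernelPair.isSmooth_regq (K : IsKernelPair Ω x₀ s η₁ η₂) (μ : Triple d n k) :
    IsSmooth (regq x₀ s η₁ η₂ μ) :=
  IsSmooth.smul contDiff_const (K.prod.isSmooth_matMoll μ.hasMatDensity_ref.2.1.integrable)

theorem IsKernelPair.isSmooth_regError (K : IsKernelPair Ω x₀ s η₁ η₂) (D : DiffOp d n k)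
    (μ : Triple d n k) : IsSmooth (regError x₀ s η₁ η₂ D μ) :=
  IsSmooth.smul contDiff_const (K.prod.isSmooth_matMoll (integrable_zerothAdj D μ))

theorem IsKernelPair.isSmooth_regR (K : IsKernelPair Ω x₀ s η₁ η₂) (D : DiffOp d n k)
    (μ : Triple d n k) : IsSmooth (regR x₀ s η₁ η₂ D μ) :=
  (K.prod.isSmooth_matMoll μ.hasMatDensity_ref.2.2.integrable).add (K.isSmooth_regError D μ)

theorem IsKernelPair.hasMatDensity_regTriple (K : IsKernelPair Ω x₀ s η₁ η₂) (hΩ : IsCompact Ω)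
    (D : DiffOp d n k) (μ : Triple d n k) (G₀ G₁ : MatMeasure (Space d) n n) :
    HasMatDensity (regTriple Ω x₀ s η₁ η₂ D μ G₀ G₁).G (volume.restrict (timeSpace Ω))
        (regG x₀ s η₁ η₂ μ G₀ G₁) ∧
      HasMatDensity (regTriple Ω x₀ s η₁ η₂ D μ G₀ G₁).q (volume.restrict (timeSpace Ω))
        (regq x₀ s η₁ η₂ μ) ∧
      HasMatDensity (regTriple Ω x₀ s η₁ η₂ D μ G₀ G₁).R (volume.restrict (timeSpace Ω))
        (regR x₀ s η₁ η₂ D μ) :=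
  ⟨hasMatDensity_matWithDensity ((K.isSmooth_regG μ G₀ G₁).integrable (isCompact_timeSpace hΩ)),
    hasMatDensity_matWithDensity ((K.isSmooth_regq μ).integrable (isCompact_timeSpace hΩ)),
    hasMatDensity_matWithDensity ((K.isSmooth_regR D μ).integrable (isCompact_timeSpace hΩ))⟩

theorem IsKernelPair.hasMatDensity_regEnd (K : IsKernelPair Ω x₀ s η₁ η₂) (hΩ : IsCompact Ω)
    (μ : Triple d n k) (G : MatMeasure (Space d) n n) :
    HasMatDensity (regEnd Ω x₀ s η₂ μ G) (volume.restrict Ω) (endReg x₀ s η₂ μ G) :=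
  hasMatDensity_matWithDensity ((K.isSmooth_endReg μ G).integrable hΩ)

theorem _root_.Matrix.PosSemidef.smul_real {m : ℕ} {A : Mat m m} (hA : A.PosSemidef) {c : ℝ}
    (hc : 0 ≤ c) : (c • A).PosSemidef := hA.smul hc

theorem IsPSDMeasureOn.isSymmValued {ν : MatMeasure (Space d) n n} (h : IsPSDMeasureOn Ω ν) :
    IsSymmValued ν := fun E => (h.2 E).isSymm_real

theorem IsKernelPair.endMoll_posSemidef (K : IsKernelPair Ω x₀ s η₁ η₂)
    (hG : IsPSDMeasureOn Ω G) (x : Space d) : (endMoll x₀ s η₂ G x).PosSemidef :=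
  K.space.matMoll_posSemidef (integrable_density_dominating G)
    (density_isSymm hG.isSymmValued _)
    (fun v => (hasMatDensity_density Measure.AbsolutelyContinuous.rfl).ae_nonneg_quadratic hG.2 v) x

theorem IsKernelPair.endReg_posSemidef (K : IsKernelPair Ω x₀ s η₁ η₂)
    (hG : IsPSDMeasureOn Ω G) (x : Space d) : (endReg x₀ s η₂ μ G x).PosSemidef :=
  (K.endMoll_posSemidef hG x).add
    (Matrix.PosSemidef.one.smul_real (K.time.pos.le.trans (K.le_background μ x)))

theorem IsKernelPair.isPSDMeasureOn_regEnd (K : IsKernelPair Ω x₀ s η₁ η₂) (hΩ : IsCompact Ω)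
    (hG : IsPSDMeasureOn Ω G) : IsPSDMeasureOn Ω (regEnd Ω x₀ s η₂ μ G) := by
  refine ⟨(K.hasMatDensity_regEnd hΩ μ G).livesOn hΩ.measurableSet ?_,
    (K.hasMatDensity_regEnd hΩ μ G).posSemidef (K.endReg_posSemidef hG)⟩
  rw [Measure.restrict_apply hΩ.measurableSet.compl, Set.compl_inter_self, measure_empty]

/-- Finite action forces a positive semidefinite density almost everywhere, because `J_Λ` is
infinite otherwise. This is the only source of positivity for `G` itself. -/
theorem ae_nonneg_quadratic_of_action {Λ₁ : Mat k k} {Λ₂ : Mat n n} (hΛ₁ : Λ₁.PosSemidef)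
    (hΛ₂ : Λ₂.PosDef) (hΩ : IsCompact Ω) (hμ : μ.IsOn (timeSpace Ω))
    (h : action Λ₁ Λ₂ (timeSpace Ω) μ < ⊤) (v : Fin n → ℝ) :
    ∀ᵐ z ∂μ.ref, 0 ≤ v ⬝ᵥ (density μ.G μ.ref z *ᵥ v) := by
  have hQ := (isCompact_timeSpace hΩ).measurableSet
  have hmem := Triple.ae_mem_ref hQ hμ
  have hr : μ.ref.restrict (timeSpace Ω) = μ.ref := Measure.restrict_eq_self_of_ae_mem hmem
  rw [action, hr] at h
  have hm := aemeasurable_actionDensity hΛ₁ hΛ₂ (lam := μ.ref)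
    (measurable_density μ.G μ.ref) (measurable_density μ.q μ.ref)
    (measurable_density μ.R μ.ref) (ae_of_all _ (density_isSymm hμ.2.2.2 _))
  filter_upwards [ae_lt_top' hm h.ne] with z hz
  by_cases hp : (density μ.G μ.ref z).PosSemidef
  · simpa using hp.dotProduct_mulVec_nonneg v
  · rw [actionDensity_eq_top _ _ _ hp] at hz
    exact absurd hz (lt_irrefl _)

theorem IsKernelPair.refMoll_posSemidef (K : IsKernelPair Ω x₀ s η₁ η₂)
    (hμ : μ.IsOn (timeSpace Ω))
    (hp : ∀ v : Fin n → ℝ, ∀ᵐ z ∂μ.ref, 0 ≤ v ⬝ᵥ (density μ.G μ.ref z *ᵥ v))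
    (z : ℝ × Space d) : (refMoll x₀ s η₁ η₂ μ (density μ.G μ.ref) z).PosSemidef :=
  K.prod.matMoll_posSemidef μ.hasMatDensity_ref.1.integrable (density_isSymm hμ.2.2.2 _) hp z

theorem endMoll_isSymm (hG : IsPSDMeasureOn Ω G) (x : Space d) :
    (endMoll x₀ s η₂ G x).IsSymm :=
  matMoll_isSymm (density_isSymm hG.isSymmValued _) x

theorem regG_isSymm (hμ : μ.IsOn (timeSpace Ω)) (hG₀ : IsPSDMeasureOn Ω G₀)
    (hG₁ : IsPSDMeasureOn Ω G₁) (z : ℝ × Space d) :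
    (regG x₀ s η₁ η₂ μ G₀ G₁ z).IsSymm :=
  (((matMoll_isSymm (density_isSymm hμ.2.2.2 _) z).smul _).add
    (((endMoll_isSymm hG₀ z.2).smul _).add ((endMoll_isSymm hG₁ z.2).smul _))).add
      (Matrix.isSymm_one.smul _)

theorem IsKernelPair.endPart_posSemidef (K : IsKernelPair Ω x₀ s η₁ η₂)
    (hG₀ : IsPSDMeasureOn Ω G₀) (hG₁ : IsPSDMeasureOn Ω G₁) {z : ℝ × Space d}
    (hz : z ∈ timeSpace Ω) : (endPart x₀ s η₁ η₂ G₀ G₁ z).PosSemidef :=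
  ((K.endMoll_posSemidef hG₀ z.2).smul_real (sub_nonneg.2 (K.cutoff_le_one _ hz.1.1))).add
    ((K.endMoll_posSemidef hG₁ z.2).smul_real (K.cutoff_nonneg _ hz.1.1))

theorem IsKernelPair.regG_sub_posSemidef (K : IsKernelPair Ω x₀ s η₁ η₂)
    (hμ : μ.IsOn (timeSpace Ω))
    (hp : ∀ v : Fin n → ℝ, ∀ᵐ z ∂μ.ref, 0 ≤ v ⬝ᵥ (density μ.G μ.ref z *ᵥ v))
    (hG₀ : IsPSDMeasureOn Ω G₀) (hG₁ : IsPSDMeasureOn Ω G₁) {z : ℝ × Space d}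
    (hz : z ∈ timeSpace Ω) :
    (regG x₀ s η₁ η₂ μ G₀ G₁ z - s • (1 : Mat n n)).PosSemidef := by
  -- The summand `s` of `background` pays for the subtracted `s • 1`; everything else is positive
  -- semidefinite.
  rw [regG, add_sub_assoc, ← sub_smul]
  exact (((K.refMoll_posSemidef hμ hp z).smul_real (sub_nonneg.2 K.time.lt_one.le)).add
    (K.endPart_posSemidef hG₀ hG₁ hz)).add
      (Matrix.PosSemidef.one.smul_real (sub_nonneg.2 (K.le_background μ z.2)))

theorem IsKernelPair.isOn_regTriple (K : IsKernelPair Ω x₀ s η₁ η₂) (hΩ : IsCompact Ω)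
    (hμ : μ.IsOn (timeSpace Ω)) (hG₀ : IsPSDMeasureOn Ω G₀) (hG₁ : IsPSDMeasureOn Ω G₁) :
    (regTriple Ω x₀ s η₁ η₂ D μ G₀ G₁).IsOn (timeSpace Ω) := by
  have hQ := (isCompact_timeSpace hΩ).measurableSet
  have h0 : (volume.restrict (timeSpace Ω)) (timeSpace Ω)ᶜ = 0 := by
    rw [Measure.restrict_apply hQ.compl, Set.compl_inter_self, measure_empty]
  obtain ⟨h₁, h₂, h₃⟩ := K.hasMatDensity_regTriple hΩ D μ G₀ G₁
  exact ⟨h₁.livesOn hQ h0, h₂.livesOn hQ h0, h₃.livesOn hQ h0,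
    h₁.isSymmValued (regG_isSymm hμ hG₀ hG₁)⟩

end RegLemmas

end WBTransport

end

noncomputable section

namespace WBTransport

/-! ### The regularized triple solves the continuity equation -/

section CE

variable {d n k : ℕ} {Ω : Set (Space d)} {x₀ : Space d} {s : ℝ} {η₁ : ℝ → ℝ}
  {η₂ : Space d → ℝ} {D : DiffOp d n k} {μ : Triple d n k} {G G₀ G₁ : MatMeasure (Space d) n n}

theorem dominating_compl (hΩ : IsCompact Ω) (hG : IsPSDMeasureOn Ω G) : dominating G Ωᶜ = 0 :=
  dominating_compl_eq_zero hΩ.measurableSet hG.1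

theorem integrable_continuousOn_mul {X : Type} [TopologicalSpace X] [T2Space X]
    [MeasurableSpace X] [BorelSpace X] {S : Set X} {lam : Measure X} {φ f : X → ℝ}
    (hS : IsCompact S) (h0 : lam Sᶜ = 0) (hφ : ContinuousOn φ S) (hf : Integrable f lam) :
    Integrable (fun x => φ x * f x) lam := by
  have hr : lam.restrict S = lam := Measure.restrict_eq_self_of_ae_mem h0
  obtain ⟨C, hC⟩ := hS.exists_bound_of_continuousOn hφ
  refine hf.bdd_mul (c := C) ?_ ?_
  · rw [← hr]
    exact hφ.aestronglyMeasurable hS.measurableSet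
  · have hmem : ∀ᵐ x ∂lam, x ∈ S := h0
    filter_upwards [hmem] with x hx using hC x hx

theorem HasMatDensity.pairing_eq_of_continuousOn {X : Type} [TopologicalSpace X] [T2Space X]
    [MeasurableSpace X] [BorelSpace X] {S : Set X} {lam : Measure X} {m m' : ℕ}
    {ν : MatMeasure X m m'} {f φ : X → Mat m m'} (h : HasMatDensity ν lam f) (hS : IsCompact S)
    (h0 : lam Sᶜ = 0) (hφ : ∀ i j, ContinuousOn (fun x => φ x i j) S) :
    pairing ν φ = ∑ i, ∑ j, ∫ x, φ x i j * f x i j ∂lam :=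
  h.pairing_eq fun i j => integrable_continuousOn_mul hS h0 (hφ i j) (h.integrable i j)

theorem restrict_compl_self {X : Type} [MeasurableSpace X] (lam : Measure X) {S : Set X}
    (hS : MeasurableSet S) : lam.restrict S Sᶜ = 0 := by
  rw [Measure.restrict_apply hS.compl, Set.compl_inter_self, measure_empty]

theorem integral_combination {X : Type} [MeasurableSpace X] {lam : Measure X}
    {f₁ f₂ f₃ f₄ f₅ : X → ℝ} (h₁ : Integrable f₁ lam) (h₂ : Integrable f₂ lam)
    (h₃ : Integrable f₃ lam) (h₄ : Integrable f₄ lam) (h₅ : Integrable f₅ lam) :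
    ∫ x, f₁ x + f₂ x - f₃ x + f₄ x + f₅ x ∂lam =
      (∫ x, f₁ x ∂lam) + (∫ x, f₂ x ∂lam) - (∫ x, f₃ x ∂lam) + (∫ x, f₄ x ∂lam) +
        ∫ x, f₅ x ∂lam := by
  rw [integral_add (f := fun x => f₁ x + f₂ x - f₃ x + f₄ x) (((h₁.add h₂).sub h₃).add h₄) h₅,
    integral_add (f := fun x => f₁ x + f₂ x - f₃ x) ((h₁.add h₂).sub h₃) h₄,
    integral_sub (f := fun x => f₁ x + f₂ x) (h₁.add h₂) h₃, integral_add h₁ h₂]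

/-- The time derivative paired with one entry of the regularized density of `G`. -/
theorem IsKernelPair.integral_timeDeriv_mul_regG (K : IsKernelPair Ω x₀ s η₁ η₂)
    (hΩ : IsCompact Ω) (h0 : volume (Ω \ interior Ω) = 0) (hμ : μ.IsOn (timeSpace Ω))
    (hG₀ : IsPSDMeasureOn Ω G₀) (hG₁ : IsPSDMeasureOn Ω G₁)
    {φ : ℝ × Space d → ℝ} {φ' : ℝ × Space d → ℝ × Space d →L[ℝ] ℝ}
    (hφ : ContinuousOn φ (timeSpace Ω)) (hφ' : ContinuousOn φ' (timeSpace Ω))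
    (hd : ∀ z ∈ interior (timeSpace Ω), HasFDerivAt φ (φ' z) z) (i j : Fin n) :
    ∫ z in timeSpace Ω, φ' z (1, 0) * regG x₀ s η₁ η₂ μ G₀ G₁ z i j =
      (1 - s) * (∫ w, avg ((1 / 2 : ℝ), x₀) s (prodKernel η₁ η₂) (fun z => φ' z (1, 0)) w *
          density μ.G μ.ref w i j ∂μ.ref) +
        ((∫ x in Ω, φ (1, x) * endReg x₀ s η₂ μ G₁ x i j) -
          ∫ x in Ω, φ (0, x) * endReg x₀ s η₂ μ G₀ x i j) +
        ((∫ y, avg ((1 / 2 : ℝ), x₀) s (prodKernel η₁ η₂) φ (0, y) *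
            density G₀ (dominating G₀) y i j ∂dominating G₀) -
          ∫ y, avg ((1 / 2 : ℝ), x₀) s (prodKernel η₁ η₂) φ (1, y) *
            density G₁ (dominating G₁) y i j ∂dominating G₁) := by
  have hQ := isCompact_timeSpace hΩ
  have hv : ContinuousOn (fun z => φ' z (1, 0)) (timeSpace Ω) := hφ'.clm_apply continuousOn_const
  have hI : ∀ {f : ℝ × Space d → ℝ}, ContDiff ℝ ∞ f →
      Integrable (fun z => φ' z (1, 0) * f z) (volume.restrict (timeSpace Ω)) := fun hf =>
    (hv.mul hf.continuous.continuousOn).integrableOn_compact hQ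
  have hJ : ∀ (τ : ℝ), τ ∈ Set.Icc (0 : ℝ) 1 → ∀ {f : Space d → ℝ}, ContDiff ℝ ∞ f →
      Integrable (fun x => φ (τ, x) * f x) (volume.restrict Ω) := fun τ hτ f hf =>
    ((hφ.comp (by fun_prop) fun x hx => ⟨hτ, hx⟩).mul
      hf.continuous.continuousOn).integrableOn_compact hΩ
  have hm : ∀ G : MatMeasure (Space d) n n, ContDiff ℝ ∞ fun x => endMoll x₀ s η₂ G x i j :=
    fun G => K.isSmooth_endMoll G i j
  have hb : ContDiff ℝ ∞ fun x => (background x₀ s η₂ μ x • (1 : Mat n n)) i j :=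
    (IsSmooth.smul (K.contDiff_background μ) (isSmooth_const 1)) i j
  have hc : ∀ τ, ContDiff ℝ ∞ (cutoff η₁ τ) := contDiff_cutoff K.time.smooth
  have hX : ContDiff ℝ ∞ fun z => refMoll x₀ s η₁ η₂ μ (density μ.G μ.ref) z i j :=
    K.prod.isSmooth_matMoll μ.hasMatDensity_ref.1.integrable i j
  have hμ0 : μ.ref (timeSpace Ω)ᶜ = 0 := Triple.ae_mem_ref hQ.measurableSet hμ
  have e₁ := K.prod.setIntegral_mul_moll hQ hμ0 hv (μ.hasMatDensity_ref.1.integrable i j)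
  have e₂ := integral_timeDeriv_mul hΩ h0 hφ hφ' hd ((hm G₀).continuous.continuousOn.integrableOn_compact hΩ)
  have e₃ := integral_timeDeriv_mul hΩ h0 hφ hφ' hd (hb.continuous.continuousOn.integrableOn_compact hΩ)
  have e₄ := K.integral_timeDeriv_mul_cutoff hΩ h0 hφ hφ' hd (dominating_compl hΩ hG₀)
    (integrable_density_dominating G₀ i j) (Set.left_mem_Icc.2 zero_le_one)
  have e₅ := K.integral_timeDeriv_mul_cutoff hΩ h0 hφ hφ' hd (dominating_compl hΩ hG₁)
    (integrable_density_dominating G₁ i j) (Set.right_mem_Icc.2 zero_le_one)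
  have i₁ : Integrable (fun z => (1 - s) * (φ' z (1, 0) *
      refMoll x₀ s η₁ η₂ μ (density μ.G μ.ref) z i j)) (volume.restrict (timeSpace Ω)) :=
    (hI hX).const_mul (1 - s)
  have i₂ : Integrable (fun z => φ' z (1, 0) * endMoll x₀ s η₂ G₀ z.2 i j)
      (volume.restrict (timeSpace Ω)) := hI ((hm G₀).comp contDiff_snd)
  have i₃ : Integrable (fun z => φ' z (1, 0) * (background x₀ s η₂ μ z.2 • (1 : Mat n n)) i j)
      (volume.restrict (timeSpace Ω)) := hI (hb.comp contDiff_snd)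
  have i₄ : Integrable (fun z => φ' z (1, 0) *
      (cutoff η₁ (contract (1 / 2) s 0) z.1 * endMoll x₀ s η₂ G₀ z.2 i j))
      (volume.restrict (timeSpace Ω)) :=
    hI (((hc _).comp contDiff_fst).mul ((hm G₀).comp contDiff_snd))
  have i₅ : Integrable (fun z => φ' z (1, 0) *
      (cutoff η₁ (contract (1 / 2) s 1) z.1 * endMoll x₀ s η₂ G₁ z.2 i j))
      (volume.restrict (timeSpace Ω)) :=
    hI (((hc _).comp contDiff_fst).mul ((hm G₁).comp contDiff_snd))
  -- The factor `1 - cutoff` is split, so that the `G₀` part becomes a term constant in time minus a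
  -- cutoff term, each covered by one of the identities above.
  have key : ∀ z, φ' z (1, 0) * regG x₀ s η₁ η₂ μ G₀ G₁ z i j =
      (1 - s) * (φ' z (1, 0) * refMoll x₀ s η₁ η₂ μ (density μ.G μ.ref) z i j) +
        φ' z (1, 0) * endMoll x₀ s η₂ G₀ z.2 i j -
        φ' z (1, 0) * (cutoff η₁ (contract (1 / 2) s 0) z.1 * endMoll x₀ s η₂ G₀ z.2 i j) +
        φ' z (1, 0) * (cutoff η₁ (contract (1 / 2) s 1) z.1 * endMoll x₀ s η₂ G₁ z.2 i j) +
        φ' z (1, 0) * (background x₀ s η₂ μ z.2 • (1 : Mat n n)) i j := fun z => by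
    simp only [regG, endPart, Matrix.add_apply, Matrix.smul_apply, smul_eq_mul]
    ring
  have key' : ∀ (τ : ℝ), τ ∈ Set.Icc (0 : ℝ) 1 → ∀ G : MatMeasure (Space d) n n,
      ∫ x in Ω, φ (τ, x) * endReg x₀ s η₂ μ G x i j =
        (∫ x in Ω, φ (τ, x) * endMoll x₀ s η₂ G x i j) +
          ∫ x in Ω, φ (τ, x) * (background x₀ s η₂ μ x • (1 : Mat n n)) i j := fun τ hτ G => by
    rw [← integral_add (hJ τ hτ (hm G)) (hJ τ hτ hb)]
    refine integral_congr_ae (ae_of_all _ fun x => ?_)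
    simp only [endReg, Matrix.add_apply, mul_add]
  simp only [key]
  rw [key' 1 (Set.right_mem_Icc.2 zero_le_one), key' 0 (Set.left_mem_Icc.2 zero_le_one)]
  refine (integral_combination i₁ i₂ i₄ i₅ i₃).trans ?_
  rw [integral_const_mul]
  simp only [endMoll, matMoll_apply] at e₁ e₂ e₃ e₄ e₅ ⊢
  rw [e₁, e₂, e₃, e₄, e₅]
  ring

theorem IsC1On.continuousOn_apply {Φ : ℝ × Space d → Mat n n}
    {Φ' : ℝ × Space d → Matrix (Fin n) (Fin n) (ℝ × Space d →L[ℝ] ℝ)} {S : Set (ℝ × Space d)}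
    (h : IsC1On S Φ Φ') (D : DiffOp d n k) (a : Fin n) (b : Fin k) :
    ContinuousOn (fun z => D.apply Φ Φ' z a b) S := by
  simp only [DiffOp.apply_apply]
  refine ContinuousOn.add ?_ ?_
  · exact continuousOn_finsetSum _ fun i _ => continuousOn_finsetSum _ fun j _ =>
      continuousOn_const.mul (h i j).1
  · exact continuousOn_finsetSum _ fun l _ => continuousOn_finsetSum _ fun i _ =>
      continuousOn_finsetSum _ fun j _ =>
        continuousOn_const.mul ((h i j).2.1.clm_apply continuousOn_const)

variable {Φ : ℝ × Space d → Mat n n}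
  {Φ' : ℝ × Space d → Matrix (Fin n) (Fin n) (ℝ × Space d →L[ℝ] ℝ)}

/-- The entrywise average of a test function. -/
def matAvg (x₀ : Space d) (s : ℝ) (η₁ : ℝ → ℝ) (η₂ : Space d → ℝ) (Φ : ℝ × Space d → Mat n n)
    (z : ℝ × Space d) : Mat n n :=
  Matrix.of fun i j => avg ((1 / 2 : ℝ), x₀) s (prodKernel η₁ η₂) (fun z => Φ z i j) z

/-- The derivative of the entrywise average of a test function. -/
def matAvgDeriv (x₀ : Space d) (s : ℝ) (η₁ : ℝ → ℝ) (η₂ : Space d → ℝ)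
    (Φ' : ℝ × Space d → Matrix (Fin n) (Fin n) (ℝ × Space d →L[ℝ] ℝ)) (z : ℝ × Space d) :
    Matrix (Fin n) (Fin n) (ℝ × Space d →L[ℝ] ℝ) :=
  Matrix.of fun i j =>
    (1 - s) • avg ((1 / 2 : ℝ), x₀) s (prodKernel η₁ η₂) (fun z => Φ' z i j) z

theorem IsKernelPair.isC1On_matAvg (K : IsKernelPair Ω x₀ s η₁ η₂) (hΩ : IsCompact Ω)
    (h : IsC1On (timeSpace Ω) Φ Φ') :
    IsC1On (timeSpace Ω) (matAvg x₀ s η₁ η₂ Φ) (matAvgDeriv x₀ s η₁ η₂ Φ') := fun i j =>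
  ⟨K.prod.continuousOn_avg (isCompact_timeSpace hΩ) (h i j).1,
    (K.prod.continuousOn_avg (isCompact_timeSpace hΩ) (h i j).2.1).const_smul (1 - s),
    fun _ hz => K.prod.hasFDerivAt_avg (isCompact_timeSpace hΩ) (h i j).1 (h i j).2.1
      (h i j).2.2 hz⟩

theorem IsKernelPair.matAvg_isSymm (K : IsKernelPair Ω x₀ s η₁ η₂)
    (hs : ∀ z ∈ timeSpace Ω, (Φ z).IsSymm) {w : ℝ × Space d} (hw : w ∈ timeSpace Ω) :
    (matAvg x₀ s η₁ η₂ Φ w).IsSymm := by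
  ext i j
  exact K.prod.avg_congr (fun z hz => (hs z hz).apply i j) hw

theorem IsKernelPair.matAvgDeriv_apply (K : IsKernelPair Ω x₀ s η₁ η₂) (hΩ : IsCompact Ω)
    (h : IsC1On (timeSpace Ω) Φ Φ') {w : ℝ × Space d} (hw : w ∈ timeSpace Ω) (i j : Fin n)
    (v : ℝ × Space d) :
    matAvgDeriv x₀ s η₁ η₂ Φ' w i j v =
      (1 - s) * avg ((1 / 2 : ℝ), x₀) s (prodKernel η₁ η₂) (fun z => Φ' z i j v) w := by
  rw [← K.prod.avg_apply (isCompact_timeSpace hΩ) (h i j).2.1 hw v]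
  rfl

/-- First order terms gain the factor `1 - s` under averaging, zeroth order terms do not. Factoring
out `1 - s` leaves `s` times the zeroth order part, the term that `regError` absorbs. -/
theorem IsKernelPair.apply_matAvg (K : IsKernelPair Ω x₀ s η₁ η₂) (hΩ : IsCompact Ω)
    (h : IsC1On (timeSpace Ω) Φ Φ') (D : DiffOp d n k) {w : ℝ × Space d}
    (hw : w ∈ timeSpace Ω) (a : Fin n) (b : Fin k) :
    D.apply (matAvg x₀ s η₁ η₂ Φ) (matAvgDeriv x₀ s η₁ η₂ Φ') w a b =
      (1 - s) * avg ((1 / 2 : ℝ), x₀) s (prodKernel η₁ η₂) (fun z => D.apply Φ Φ' z a b) w +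
        s * ∑ i, ∑ j, D.zeroth (Matrix.single i j 1) a b * matAvg x₀ s η₁ η₂ Φ w i j := by
  have hQ := isCompact_timeSpace hΩ
  have c₀ : ∀ i j, ContinuousOn (fun z => D.zeroth (Matrix.single i j 1) a b * Φ z i j)
      (timeSpace Ω) := fun i j => continuousOn_const.mul (h i j).1
  have c₁ : ∀ l i j, ContinuousOn (fun z => D.first l (Matrix.single i j 1) a b *
      Φ' z i j (0, EuclideanSpace.single l 1)) (timeSpace Ω) := fun l i j =>
    continuousOn_const.mul ((h i j).2.1.clm_apply continuousOn_const)
  simp only [DiffOp.apply_apply]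
  rw [K.prod.avg_add hQ
      (continuousOn_finsetSum _ fun i _ => continuousOn_finsetSum _ fun j _ => c₀ i j)
      (continuousOn_finsetSum _ fun l _ => continuousOn_finsetSum _ fun i _ =>
        continuousOn_finsetSum _ fun j _ => c₁ l i j),
    K.prod.avg_sum hQ _ (fun i => continuousOn_finsetSum _ fun j _ => c₀ i j) hw,
    K.prod.avg_sum hQ _ (fun l => continuousOn_finsetSum _ fun i _ =>
      continuousOn_finsetSum _ fun j _ => c₁ l i j) hw]
  swap
  · exact hw
  simp_rw [K.prod.avg_sum hQ _ (fun j => c₀ _ j) hw,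
    K.prod.avg_sum hQ _ (fun i => continuousOn_finsetSum _ fun j _ => c₁ _ i j) hw,
    K.prod.avg_sum hQ _ (fun j => c₁ _ _ j) hw, avg_const_mul,
    K.matAvgDeriv_apply hΩ h hw]
  have : ∀ l i j, D.first l (Matrix.single i j 1) a b * ((1 - s) *
      avg ((1 / 2 : ℝ), x₀) s (prodKernel η₁ η₂)
        (fun z => Φ' z i j (0, EuclideanSpace.single l 1)) w) =
      (1 - s) * (D.first l (Matrix.single i j 1) a b *
        avg ((1 / 2 : ℝ), x₀) s (prodKernel η₁ η₂)
          (fun z => Φ' z i j (0, EuclideanSpace.single l 1)) w) := fun l i j => by ring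
  simp_rw [this, ← Finset.mul_sum]
  simp only [matAvg, Matrix.of_apply]
  ring

/-- Test the original equation with the averaged test function and move the averages onto the
measures. The smeared end terms cancel against those produced by `endPart`. -/
theorem IsKernelPair.regTriple_mem_CE (K : IsKernelPair Ω x₀ s η₁ η₂) (hΩ : IsCompact Ω)
    (h0 : volume (Ω \ interior Ω) = 0)
    (hG₀ : IsPSDMeasureOn Ω G₀) (hG₁ : IsPSDMeasureOn Ω G₁) (hμ : μ ∈ CE Ω D G₀ G₁) :
    regTriple Ω x₀ s η₁ η₂ D μ G₀ G₁ ∈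
      CE Ω D (regEnd Ω x₀ s η₂ μ G₀) (regEnd Ω x₀ s η₂ μ G₁) := by
  obtain ⟨hon, hCE⟩ := hμ
  refine ⟨K.isOn_regTriple hΩ hon hG₀ hG₁, fun Φ Φ' hΦ hs => ?_⟩
  have hQ := isCompact_timeSpace hΩ
  obtain ⟨d₁, d₂, d₃⟩ := K.hasMatDensity_regTriple hΩ D μ G₀ G₁
  obtain ⟨r₁, r₂, r₃⟩ := μ.hasMatDensity_ref
  have hμ0 : μ.ref (timeSpace Ω)ᶜ = 0 := Triple.ae_mem_ref hQ.measurableSet hon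
  have hA := K.isC1On_matAvg hΩ hΦ
  have key := hCE _ _ hA fun z hz => K.matAvg_isSymm hs hz
  have hcut : ∀ (τ : ℝ), τ ∈ Set.Icc (0 : ℝ) 1 → ∀ {φ : ℝ × Space d → ℝ},
      ContinuousOn φ (timeSpace Ω) → ContinuousOn (fun x => φ (τ, x)) Ω := fun τ hτ φ hφ =>
    hφ.comp (by fun_prop) fun x hx => ⟨hτ, hx⟩
  have hl : (0 : ℝ) ∈ Set.Icc (0 : ℝ) 1 := Set.left_mem_Icc.2 zero_le_one
  have hr : (1 : ℝ) ∈ Set.Icc (0 : ℝ) 1 := Set.right_mem_Icc.2 zero_le_one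
  have hresQ := restrict_compl_self volume hQ.measurableSet
  have hresΩ := restrict_compl_self volume hΩ.measurableSet
  have hdir : ∀ i j, ContinuousOn (fun z => Φ' z i j (1, 0)) (timeSpace Ω) := fun i j =>
    (hΦ i j).2.1.clm_apply continuousOn_const
  -- the pairings of the regularized triple
  have p₁ : pairing (regTriple Ω x₀ s η₁ η₂ D μ G₀ G₁).G (dirDeriv (1, 0) Φ') =
      ∑ i, ∑ j, ∫ z in timeSpace Ω, Φ' z i j (1, 0) * regG x₀ s η₁ η₂ μ G₀ G₁ z i j :=
    d₁.pairing_eq_of_continuousOn hQ hresQ hdir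
  have p₂ : pairing (regTriple Ω x₀ s η₁ η₂ D μ G₀ G₁).q (D.apply Φ Φ') =
      ∑ a, ∑ b, (1 - s) * ∫ w, avg ((1 / 2 : ℝ), x₀) s (prodKernel η₁ η₂)
        (fun z => D.apply Φ Φ' z a b) w * density μ.q μ.ref w a b ∂μ.ref := by
    rw [d₂.pairing_eq_of_continuousOn hQ hresQ (hΦ.continuousOn_apply D)]
    refine Finset.sum_congr rfl fun a _ => Finset.sum_congr rfl fun b _ => ?_
    rw [← K.prod.setIntegral_mul_moll hQ hμ0 (hΦ.continuousOn_apply D a b) (r₂.integrable a b),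
      ← integral_const_mul]
    refine integral_congr_ae (ae_of_all _ fun z => ?_)
    simp only [regq, Matrix.smul_apply, smul_eq_mul, matMoll_apply]
    ring
  have p₃ : pairing (regTriple Ω x₀ s η₁ η₂ D μ G₀ G₁).R Φ =
      ∑ i, ∑ j, ((∫ w, matAvg x₀ s η₁ η₂ Φ w i j * density μ.R μ.ref w i j ∂μ.ref) +
        s * ∫ w, matAvg x₀ s η₁ η₂ Φ w i j * D.zerothAdj (density μ.q μ.ref w) i j ∂μ.ref) := by
    rw [d₃.pairing_eq_of_continuousOn hQ hresQ fun i j => (hΦ i j).1]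
    refine Finset.sum_congr rfl fun i _ => Finset.sum_congr rfl fun j _ => ?_
    have i₁ := K.prod.integrable_mul_moll hQ (hΦ i j).1 (r₃.integrable i j)
    have i₂ := (K.prod.integrable_mul_moll hQ (hΦ i j).1 (integrable_zerothAdj D μ i j)).const_mul s
    have e₁ := K.prod.setIntegral_mul_moll hQ hμ0 (hΦ i j).1 (r₃.integrable i j)
    have e₂ := K.prod.setIntegral_mul_moll hQ hμ0 (hΦ i j).1 (integrable_zerothAdj D μ i j)
    simp only [matAvg, Matrix.of_apply] at e₁ e₂ ⊢
    rw [← e₁, ← e₂, ← integral_const_mul, ← integral_add i₁ i₂]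
    refine integral_congr_ae (ae_of_all _ fun z => ?_)
    simp only [regR, regError, Matrix.add_apply, Matrix.smul_apply, smul_eq_mul, matMoll_apply]
    ring
  have p₄ : ∀ (τ : ℝ), τ ∈ Set.Icc (0 : ℝ) 1 → ∀ G : MatMeasure (Space d) n n,
      pairing (regEnd Ω x₀ s η₂ μ G) (fun x => Φ (τ, x)) =
        ∑ i, ∑ j, ∫ x in Ω, Φ (τ, x) i j * endReg x₀ s η₂ μ G x i j := fun τ hτ G =>
    (K.hasMatDensity_regEnd hΩ μ G).pairing_eq_of_continuousOn hΩ hresΩ fun i j =>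
      hcut τ hτ (hΦ i j).1
  -- the pairings of the original triple
  have q₁ : pairing μ.G (dirDeriv (1, 0) (matAvgDeriv x₀ s η₁ η₂ Φ')) =
      ∑ i, ∑ j, (1 - s) * ∫ w, avg ((1 / 2 : ℝ), x₀) s (prodKernel η₁ η₂)
        (fun z => Φ' z i j (1, 0)) w * density μ.G μ.ref w i j ∂μ.ref := by
    refine (r₁.pairing_eq_of_continuousOn hQ hμ0 fun i j =>
      (hA i j).2.1.clm_apply continuousOn_const).trans ?_
    refine Finset.sum_congr rfl fun i _ => Finset.sum_congr rfl fun j _ => ?_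
    rw [← integral_const_mul]
    have hmem : ∀ᵐ w ∂μ.ref, w ∈ timeSpace Ω := hμ0
    refine integral_congr_ae ?_
    filter_upwards [hmem] with w hw
    rw [← mul_assoc, ← K.matAvgDeriv_apply hΩ hΦ hw]
  have q₂ : pairing μ.q (D.apply (matAvg x₀ s η₁ η₂ Φ) (matAvgDeriv x₀ s η₁ η₂ Φ')) =
      (∑ a, ∑ b, (1 - s) * ∫ w, avg ((1 / 2 : ℝ), x₀) s (prodKernel η₁ η₂)
        (fun z => D.apply Φ Φ' z a b) w * density μ.q μ.ref w a b ∂μ.ref) +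
      ∑ i, ∑ j, s * ∫ w, matAvg x₀ s η₁ η₂ Φ w i j *
        D.zerothAdj (density μ.q μ.ref w) i j ∂μ.ref := by
    -- The defect of `apply_matAvg` is rewritten entry by entry through the adjoint `D.zerothAdj`,
    -- so that it appears as a source term paired with the averaged test function and matches the
    -- extra term in the pairing of `R`.
    have hz : ∀ i j a b, Integrable (fun w => matAvg x₀ s η₁ η₂ Φ w i j *
        (D.zeroth (Matrix.single i j 1) a b * density μ.q μ.ref w a b)) μ.ref := fun i j a b =>
      integrable_continuousOn_mul hQ hμ0 (hA i j).1 ((r₂.integrable a b).const_mul _)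
    rw [r₂.pairing_eq_of_continuousOn hQ hμ0 (hA.continuousOn_apply D)]
    have e : ∀ a b, ∫ w, D.apply (matAvg x₀ s η₁ η₂ Φ) (matAvgDeriv x₀ s η₁ η₂ Φ') w a b *
        density μ.q μ.ref w a b ∂μ.ref =
        (1 - s) * (∫ w, avg ((1 / 2 : ℝ), x₀) s (prodKernel η₁ η₂)
          (fun z => D.apply Φ Φ' z a b) w * density μ.q μ.ref w a b ∂μ.ref) +
        s * ∑ i, ∑ j, ∫ w, matAvg x₀ s η₁ η₂ Φ w i j *
          (D.zeroth (Matrix.single i j 1) a b * density μ.q μ.ref w a b) ∂μ.ref := fun a b => by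
      have i₁ : Integrable (fun w => avg ((1 / 2 : ℝ), x₀) s (prodKernel η₁ η₂)
          (fun z => D.apply Φ Φ' z a b) w * density μ.q μ.ref w a b) μ.ref :=
        integrable_continuousOn_mul hQ hμ0 (K.prod.continuousOn_avg hQ (hΦ.continuousOn_apply D a b)) (r₂.integrable a b)
      have hsum : ∑ i, ∑ j, ∫ w, matAvg x₀ s η₁ η₂ Φ w i j *
          (D.zeroth (Matrix.single i j 1) a b * density μ.q μ.ref w a b) ∂μ.ref =
          ∫ w, ∑ i, ∑ j, matAvg x₀ s η₁ η₂ Φ w i j *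
            (D.zeroth (Matrix.single i j 1) a b * density μ.q μ.ref w a b) ∂μ.ref := by
        rw [integral_finsetSum _ fun i _ => integrable_finsetSum _ fun j _ => hz i j a b]
        exact Finset.sum_congr rfl fun i _ => (integral_finsetSum _ fun j _ => hz i j a b).symm
      rw [hsum, ← integral_const_mul, ← integral_const_mul, ← integral_add (i₁.const_mul _)
        ((integrable_finsetSum _ fun i _ => integrable_finsetSum _ fun j _ =>
          hz i j a b).const_mul s)]
      have hmem : ∀ᵐ w ∂μ.ref, w ∈ timeSpace Ω := hμ0
      refine integral_congr_ae ?_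
      filter_upwards [hmem] with w hw
      rw [K.apply_matAvg hΩ hΦ D hw, add_mul, mul_assoc, mul_assoc, Finset.sum_mul]
      simp only [Finset.sum_mul]
      congr 2
      refine Finset.sum_congr rfl fun i _ => Finset.sum_congr rfl fun j _ => ?_
      ring
    simp only [e, Finset.sum_add_distrib, ← Finset.mul_sum]
    congr 2
    have hadj : ∀ i j, ∫ w, matAvg x₀ s η₁ η₂ Φ w i j *
        D.zerothAdj (density μ.q μ.ref w) i j ∂μ.ref =
        ∑ a, ∑ b, ∫ w, matAvg x₀ s η₁ η₂ Φ w i j *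
          (D.zeroth (Matrix.single i j 1) a b * density μ.q μ.ref w a b) ∂μ.ref := fun i j => by
      simp only [DiffOp.zerothAdj_apply, Finset.mul_sum]
      rw [integral_finsetSum _ fun a _ => integrable_finsetSum _ fun b _ => hz i j a b]
      exact Finset.sum_congr rfl fun a _ => integral_finsetSum _ fun b _ => hz i j a b
    simp only [hadj]
    calc _ = ∑ a, ∑ i, ∑ j, ∑ b, ∫ w, matAvg x₀ s η₁ η₂ Φ w i j *
          (D.zeroth (Matrix.single i j 1) a b * density μ.q μ.ref w a b) ∂μ.ref :=
          Finset.sum_congr rfl fun a _ => by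
            rw [Finset.sum_comm]
            exact Finset.sum_congr rfl fun i _ => Finset.sum_comm
      _ = _ := by
          rw [Finset.sum_comm]
          exact Finset.sum_congr rfl fun i _ => Finset.sum_comm
  have q₃ : pairing μ.R (matAvg x₀ s η₁ η₂ Φ) =
      ∑ i, ∑ j, ∫ w, matAvg x₀ s η₁ η₂ Φ w i j * density μ.R μ.ref w i j ∂μ.ref :=
    r₃.pairing_eq_of_continuousOn hQ hμ0 fun i j => (hA i j).1
  have q₄ : ∀ (τ : ℝ), τ ∈ Set.Icc (0 : ℝ) 1 → ∀ G : MatMeasure (Space d) n n,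
      IsPSDMeasureOn Ω G → pairing G (fun x => matAvg x₀ s η₁ η₂ Φ (τ, x)) =
        ∑ i, ∑ j, ∫ y, avg ((1 / 2 : ℝ), x₀) s (prodKernel η₁ η₂) (fun z => Φ z i j) (τ, y) *
          density G (dominating G) y i j ∂dominating G := fun τ hτ G hG =>
    (hasMatDensity_density Measure.AbsolutelyContinuous.rfl).pairing_eq_of_continuousOn
      hΩ (dominating_compl hΩ hG) fun i j => hcut τ hτ (hA i j).1
  rw [q₁, q₂, q₃, q₄ 1 hr G₁ hG₁, q₄ 0 hl G₀ hG₀] at key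
  rw [p₁, p₂, p₃, p₄ 1 hr G₁, p₄ 0 hl G₀]
  have e₁ := fun i j => K.integral_timeDeriv_mul_regG hΩ h0 hon hG₀ hG₁ (hΦ i j).1 (hΦ i j).2.1
    (hΦ i j).2.2 i j
  simp only [e₁, Finset.sum_add_distrib, Finset.sum_sub_distrib] at key ⊢
  linarith

end CE

end WBTransport

end

noncomputable section

namespace WBTransport

/-! ### The action of the regularized triple -/

section Jensen

variable {E : Type} [NormedAddCommGroup E] [NormedSpace ℝ E] [MeasureSpace E]
  [FiniteDimensional ℝ E] [BorelSpace E] [(volume : Measure E).IsAddHaarMeasure]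
  {S : Set E} {c : E} {s : ℝ} {η : E → ℝ} {lam : Measure E} {n k : ℕ}
  {Λ₁ : Mat k k} {Λ₂ : Mat n n}

theorem IsMollifier.frob_matMoll (h : IsMollifier S c s η) {m m' : ℕ} (A : Mat m m')
    {f : E → Mat m m'} (hf : ∀ i j, Integrable (fun x => f x i j) lam) (z : E) :
    frob A (matMoll c s η lam f z) = moll c s η lam (fun w => frob A (f w)) z := by
  simp only [frob_eq_sum]
  rw [h.moll_sum (f := fun i w => ∑ j, A i j * f w i j) _ fun i =>
    integrable_finsetSum _ fun j _ => (hf i j).const_mul _]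
  refine Finset.sum_congr rfl fun i _ => ?_
  rw [h.moll_sum (f := fun j w => A i j * f w i j) _ fun j => (hf i j).const_mul _]
  refine Finset.sum_congr rfl fun j _ => ?_
  rw [IsMollifier.moll_const_mul]
  rfl

theorem integrable_frob {X : Type} [MeasurableSpace X] {lam : Measure X} {m m' : ℕ} (A : Mat m m')
    {f : X → Mat m m'} (hf : ∀ i j, Integrable (fun x => f x i j) lam) :
    Integrable (fun x => frob A (f x)) lam := by
  simp only [frob_eq_sum]
  exact integrable_finsetSum _ fun i _ => integrable_finsetSum _ fun j _ => (hf i j).const_mul _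

theorem IsMollifier.dualForm_matMoll (h : IsMollifier S c s η) {X Z : E → Mat n n}
    {Y : E → Mat n k} (hX : ∀ i j, Integrable (fun x => X x i j) lam)
    (hY : ∀ i j, Integrable (fun x => Y x i j) lam)
    (hZ : ∀ i j, Integrable (fun x => Z x i j) lam) (p : Mat n k × Mat n n) (z : E) :
    dualForm Λ₁ Λ₂ p (matMoll c s η lam X z) (matMoll c s η lam Y z) (matMoll c s η lam Z z) =
      moll c s η lam (fun w => dualForm Λ₁ Λ₂ p (X w) (Y w) (Z w)) z := by
  simp only [dualForm_eq, sub_eq_add_neg, ← neg_mul]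
  rw [h.frob_matMoll _ hX, h.frob_matMoll _ hY, h.frob_matMoll _ hZ,
    h.moll_add (f := fun w => frob p.1 (Y w) + frob p.2 (Z w))
      ((integrable_frob _ hY).add (integrable_frob _ hZ))
      ((integrable_frob _ hX).const_mul _),
    h.moll_add (integrable_frob _ hY) (integrable_frob _ hZ), IsMollifier.moll_const_mul]

/-- Jensen's inequality through duality: each linear functional commutes with the mollification and
is bounded by the action density under the integral. The kernel in `w` need not have mass one,
because the functionals have no constant term. -/
theorem IsMollifier.actionDensity_matMoll_le (h : IsMollifier S c s η) (hΛ₁ : Λ₁.PosSemidef)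
    (hΛ₂ : Λ₂.PosDef) {X Z : E → Mat n n}
    {Y : E → Mat n k} (hX : ∀ i j, Integrable (fun x => X x i j) lam)
    (hY : ∀ i j, Integrable (fun x => Y x i j) lam)
    (hZ : ∀ i j, Integrable (fun x => Z x i j) lam) (hs : ∀ x, (X x).IsSymm) (z : E) :
    actionDensity Λ₁ Λ₂ (matMoll c s η lam X z) (matMoll c s η lam Y z) (matMoll c s η lam Z z) ≤
      ∫⁻ w, ENNReal.ofReal (η (z - contract c s w)) * actionDensity Λ₁ Λ₂ (X w) (Y w) (Z w) ∂lam := by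
  refine actionDensity_le_of_dualForm_le hΛ₁ hΛ₂ (matMoll_isSymm hs z) fun p => ?_
  rw [h.dualForm_matMoll hX hY hZ]
  have hd : Integrable (fun w => dualForm Λ₁ Λ₂ p (X w) (Y w) (Z w)) lam := by
    simp only [dualForm_eq]
    exact ((integrable_frob _ hY).add (integrable_frob _ hZ)).sub ((integrable_frob _ hX).const_mul _)
  have hint := h.integrable_mul hd z
  refine (ENNReal.ofReal_le_ofReal (integral_mono hint hint.pos_part fun z => le_max_left _ 0)).trans ?_
  rw [ofReal_integral_eq_lintegral_ofReal hint.pos_part (ae_of_all _ fun z => le_max_right _ _)]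
  refine lintegral_mono fun w => ?_
  refine le_trans (le_of_eq ?_) (mul_le_mul_right (ofReal_dualForm_le hΛ₁ hΛ₂ (hs w) _ _ p) _)
  rw [ENNReal.ofReal_max, ENNReal.ofReal_zero, max_eq_left zero_le, ENNReal.ofReal_mul (h.nonneg _)]

theorem IsMollifier.lintegral_ofReal_moll_le [SFinite lam] (h : IsMollifier S c s η) {f : E → ℝ}
    (hf : Integrable f lam) (h0 : ∀ x, 0 ≤ f x) (A : Set E) :
    ∫⁻ z in A, ENNReal.ofReal (moll c s η lam f z) ≤ ENNReal.ofReal (∫ w, f w ∂lam) := by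
  have : ∀ z, ENNReal.ofReal (moll c s η lam f z) =
      ∫⁻ w, ENNReal.ofReal (η (z - contract c s w)) * ENNReal.ofReal (f w) ∂lam := fun z => by
    rw [moll, ofReal_integral_eq_lintegral_ofReal (h.integrable_mul hf z)
      (ae_of_all _ fun w => mul_nonneg (h.nonneg _) (h0 w))]
    exact lintegral_congr fun w => ENNReal.ofReal_mul (h.nonneg _)
  simp only [this]
  rw [ofReal_integral_eq_lintegral_ofReal hf (ae_of_all _ h0)]
  exact h.lintegral_moll_le hf.aemeasurable.ennreal_ofReal A

end Jensen

/-! ### The error from the zeroth order part and the upper bound for the action. -/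

section Action

variable {d n k : ℕ} {Ω : Set (Space d)} {x₀ : Space d} {s : ℝ} {η₁ : ℝ → ℝ}
  {η₂ : Space d → ℝ} {D : DiffOp d n k} {μ : Triple d n k} {G G₀ G₁ : MatMeasure (Space d) n n}
  {Λ₁ : Mat k k} {Λ₂ : Mat n n}

theorem Triple.momentumDensity_nonneg (μ : Triple d n k) (z : ℝ × Space d) :
    0 ≤ μ.momentumDensity z :=
  Finset.sum_nonneg fun _ _ => Finset.sum_nonneg fun _ _ => abs_nonneg _

theorem Triple.measurable_momentumDensity (μ : Triple d n k) : Measurable μ.momentumDensity :=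
  Finset.measurable_sum _ fun a _ => Finset.measurable_sum _ fun b _ =>
    (measurable_density μ.q μ.ref a b).abs

theorem IsKernelPair.mollMarginal_eq (K : IsKernelPair Ω x₀ s η₁ η₂) (μ : Triple d n k)
    (x : Space d) :
    mollMarginal x₀ s η₂ μ x =
      ∫ w, μ.momentumDensity w * η₂ (x - contract x₀ s w.2) ∂μ.ref := by
  have hc : Continuous fun y => η₂ (x - contract x₀ s y) :=
    K.space.smooth.continuous.comp (continuous_const.sub (continuous_contract x₀ s))
  rw [mollMarginal, moll, Triple.momentumMarginal,
    integral_map (f := fun y => η₂ (x - contract x₀ s y) * 1) measurable_snd.aemeasurable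
      (hc.mul continuous_const).aestronglyMeasurable,
    integral_withDensity_eq_integral_toReal_smul (μ.measurable_momentumDensity.ennreal_ofReal)
      (ae_of_all _ fun _ => ENNReal.ofReal_lt_top)]
  refine integral_congr_ae (ae_of_all _ fun w => ?_)
  simp only [mul_one, smul_eq_mul]
  rw [ENNReal.toReal_ofReal (μ.momentumDensity_nonneg w)]

/-- The time kernel is at most `4 / s`; after this factor is taken out only the spatial kernel
remains, and integrating over time produces the spatial marginal. It justifies a time-independent
`background`. -/
theorem IsKernelPair.moll_momentum_le (K : IsKernelPair Ω x₀ s η₁ η₂) (μ : Triple d n k)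
    (z : ℝ × Space d) :
    s * moll ((1 / 2 : ℝ), x₀) s (prodKernel η₁ η₂) μ.ref μ.momentumDensity z ≤
      4 * mollMarginal x₀ s η₂ μ z.2 := by
  have hs := K.time.pos
  have hY := μ.integrable_momentumDensity
  have hc : Continuous fun w : ℝ × Space d => η₂ (z.2 - contract x₀ s w.2) :=
    K.space.smooth.continuous.comp
      (continuous_const.sub ((continuous_contract x₀ s).comp continuous_snd))
  obtain ⟨C, hC⟩ := K.space.exists_bound
  have hi : Integrable (fun w => μ.momentumDensity w * η₂ (z.2 - contract x₀ s w.2)) μ.ref :=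
    hY.mul_bdd (c := C) hc.aestronglyMeasurable (ae_of_all _ fun w => hC _)
  rw [K.mollMarginal_eq, moll, ← integral_const_mul, ← integral_const_mul]
  refine integral_mono ((K.prod.integrable_mul hY z).const_mul s) (hi.const_mul 4) fun w => ?_
  have h₁ : s * η₁ (z.1 - (contract ((1 / 2 : ℝ), x₀) s w).1) ≤ 4 := by
    have := mul_le_mul_of_nonneg_left (K.time_le (z.1 - (contract ((1 / 2 : ℝ), x₀) s w).1)) hs.le
    rwa [mul_div_cancel₀ _ hs.ne'] at this
  have h₂ : 0 ≤ μ.momentumDensity w * η₂ (z.2 - contract x₀ s w.2) :=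
    mul_nonneg (μ.momentumDensity_nonneg w) (K.space.nonneg _)
  refine le_trans (le_of_eq ?_) (mul_le_mul_of_nonneg_right h₁ h₂)
  change s * (η₁ (z.1 - (contract ((1 / 2 : ℝ), x₀) s w).1) * η₂ (z.2 - contract x₀ s w.2) *
    μ.momentumDensity w) = _
  ring

/-- A bound for the zeroth order part of `D*`. -/
def DiffOp.zerothBound (D : DiffOp d n k) : ℝ :=
  ∑ i, ∑ j, ∑ a, ∑ b, |D.zeroth (Matrix.single i j 1) a b|

theorem DiffOp.zerothBound_nonneg (D : DiffOp d n k) : 0 ≤ D.zerothBound :=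
  Finset.sum_nonneg fun _ _ => Finset.sum_nonneg fun _ _ => Finset.sum_nonneg fun _ _ =>
    Finset.sum_nonneg fun _ _ => abs_nonneg _

theorem DiffOp.abs_zeroth_le (D : DiffOp d n k) (i j a : Fin n) (b : Fin k) :
    |D.zeroth (Matrix.single i j 1) a b| ≤ D.zerothBound := by
  refine (Finset.single_le_sum (f := fun b => |D.zeroth (Matrix.single i j 1) a b|)
    (fun _ _ => abs_nonneg _) (Finset.mem_univ b)).trans ?_
  refine (Finset.single_le_sum (f := fun a => ∑ b, |D.zeroth (Matrix.single i j 1) a b|)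
    (fun _ _ => Finset.sum_nonneg fun _ _ => abs_nonneg _) (Finset.mem_univ a)).trans ?_
  refine (Finset.single_le_sum (f := fun j => ∑ a, ∑ b, |D.zeroth (Matrix.single i j 1) a b|)
    (fun _ _ => Finset.sum_nonneg fun _ _ => Finset.sum_nonneg fun _ _ => abs_nonneg _)
    (Finset.mem_univ j)).trans ?_
  exact Finset.single_le_sum
    (f := fun i => ∑ j, ∑ a, ∑ b, |D.zeroth (Matrix.single i j 1) a b|)
    (fun _ _ => Finset.sum_nonneg fun _ _ => Finset.sum_nonneg fun _ _ =>
      Finset.sum_nonneg fun _ _ => abs_nonneg _) (Finset.mem_univ i)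

theorem DiffOp.abs_zerothAdj_le (D : DiffOp d n k) (μ : Triple d n k) (z : ℝ × Space d)
    (i j : Fin n) :
    |D.zerothAdj (density μ.q μ.ref z) i j| ≤ D.zerothBound * μ.momentumDensity z := by
  rw [D.zerothAdj_apply, Triple.momentumDensity, Finset.mul_sum]
  refine (Finset.abs_sum_le_sum_abs _ _).trans (Finset.sum_le_sum fun a _ => ?_)
  rw [Finset.mul_sum]
  refine (Finset.abs_sum_le_sum_abs _ _).trans (Finset.sum_le_sum fun b _ => ?_)
  rw [abs_mul]
  exact mul_le_mul_of_nonneg_right (D.abs_zeroth_le i j a b) (abs_nonneg _)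

theorem IsKernelPair.abs_regError_le (K : IsKernelPair Ω x₀ s η₁ η₂) (D : DiffOp d n k)
    (μ : Triple d n k) (z : ℝ × Space d) (i j : Fin n) :
    |regError x₀ s η₁ η₂ D μ z i j| ≤ D.zerothBound *
      (s * moll ((1 / 2 : ℝ), x₀) s (prodKernel η₁ η₂) μ.ref μ.momentumDensity z) := by
  have hY := μ.integrable_momentumDensity
  have h₁ := (K.prod.abs_moll_le (lam := μ.ref)
    (fun w => D.zerothAdj (density μ.q μ.ref w) i j) z).trans
    (K.prod.moll_mono (integrable_zerothAdj D μ i j).abs (hY.const_mul D.zerothBound)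
      (ae_of_all _ fun w => D.abs_zerothAdj_le μ w i j) z)
  rw [IsMollifier.moll_const_mul] at h₁
  have h₂ := mul_le_mul_of_nonneg_left h₁ K.time.pos.le
  rw [regError, Matrix.smul_apply, smul_eq_mul, abs_mul, abs_of_pos K.time.pos]
  refine h₂.trans_eq ?_
  rw [mul_left_comm]

/-- Subadditivity separates three pieces: the shrunken mollification, which costs the factor `(1 -
s)⁻¹`; `endPart`, which costs nothing since it carries no `q` and `R`; and the background, which
pays for `regError` at order `√s`. The constant does not depend on `s` or on the kernels. -/
theorem exists_action_regTriple_le (hΩ : IsCompact Ω) (hΛ₁ : Λ₁.PosSemidef) (hΛ₂ : Λ₂.PosDef)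
    (D : DiffOp d n k) (hμ : μ.IsOn (timeSpace Ω)) (hG₀ : IsPSDMeasureOn Ω G₀)
    (hG₁ : IsPSDMeasureOn Ω G₁) :
    ∃ C : ℝ, ∀ (s : ℝ) (η₁ : ℝ → ℝ) (η₂ : Space d → ℝ), IsKernelPair Ω x₀ s η₁ η₂ →
      action Λ₁ Λ₂ (timeSpace Ω) (regTriple Ω x₀ s η₁ η₂ D μ G₀ G₁) ≤
        ENNReal.ofReal (1 - s)⁻¹ * action Λ₁ Λ₂ (timeSpace Ω) μ + ENNReal.ofReal (C * √s) := by
  obtain ⟨C, hC, hbound⟩ := exists_actionDensity_scalar_le (n := n) hΛ₁ hΛ₂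
  refine ⟨C * (4 * D.zerothBound ^ 2) * ∫ w, μ.momentumDensity w ∂μ.ref, fun s η₁ η₂ K => ?_⟩
  have hs := K.time.pos
  have hs1 := K.time.lt_one
  have hsq : 0 < √s := Real.sqrt_pos.2 hs
  have hQ := (isCompact_timeSpace hΩ).measurableSet
  obtain ⟨d₁, d₂, d₃⟩ := K.hasMatDensity_regTriple hΩ D μ G₀ G₁
  have hmem := Triple.ae_mem_ref hQ hμ
  have hr : μ.ref.restrict (timeSpace Ω) = μ.ref := Measure.restrict_eq_self_of_ae_mem hmem
  have hon : (regTriple Ω x₀ s η₁ η₂ D μ G₀ G₁).IsOn (timeSpace Ω) :=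
    K.isOn_regTriple hΩ hμ hG₀ hG₁
  have hb0 := D.zerothBound_nonneg
  set M := moll ((1 / 2 : ℝ), x₀) s (prodKernel η₁ η₂) μ.ref μ.momentumDensity with hM
  have hM0 : ∀ z, 0 ≤ M z :=
    K.prod.moll_nonneg (ae_of_all _ μ.momentumDensity_nonneg)
  rw [action_eq_lintegral hΛ₁ hΛ₂ hon.2.2.2 d₁ d₂ d₃ _ hQ, Measure.restrict_restrict hQ,
    Set.inter_self]
  have hpt : ∀ z ∈ timeSpace Ω, actionDensity Λ₁ Λ₂ (regG x₀ s η₁ η₂ μ G₀ G₁ z)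
      (regq x₀ s η₁ η₂ μ z) (regR x₀ s η₁ η₂ D μ z) ≤
      ENNReal.ofReal (1 - s)⁻¹ * (∫⁻ w, ENNReal.ofReal
        (prodKernel η₁ η₂ (z - contract ((1 / 2 : ℝ), x₀) s w)) *
          actionDensity Λ₁ Λ₂ (density μ.G μ.ref w) (density μ.q μ.ref w)
            (density μ.R μ.ref w) ∂μ.ref) +
        ENNReal.ofReal (C * (4 * D.zerothBound ^ 2) * √s) * ENNReal.ofReal (M z) := by
    intro z hz
    have hX : (refMoll x₀ s η₁ η₂ μ (density μ.G μ.ref) z).IsSymm :=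
      matMoll_isSymm (density_isSymm hμ.2.2.2 _) z
    have hP := K.endPart_posSemidef (x₀ := x₀) hG₀ hG₁ hz
    -- Explicit zeros distribute momentum and source over the three pieces of the regularized
    -- density.
    have e : actionDensity Λ₁ Λ₂ (regG x₀ s η₁ η₂ μ G₀ G₁ z)
        (regq x₀ s η₁ η₂ μ z) (regR x₀ s η₁ η₂ D μ z) =
        actionDensity Λ₁ Λ₂ ((1 - s) • refMoll x₀ s η₁ η₂ μ (density μ.G μ.ref) z +
          endPart x₀ s η₁ η₂ G₀ G₁ z + background x₀ s η₂ μ z.2 • (1 : Mat n n))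
          ((1 - s) • refMoll x₀ s η₁ η₂ μ (density μ.q μ.ref) z + 0 + 0)
          (refMoll x₀ s η₁ η₂ μ (density μ.R μ.ref) z + 0 + regError x₀ s η₁ η₂ D μ z) := by
      simp only [add_zero]
      rfl
    rw [e]
    refine (actionDensity_add_le hΛ₁ hΛ₂ ((hX.smul _).add hP.isSymm_real)
      (Matrix.isSymm_one.smul _) _ _ _ _).trans (add_le_add ?_ ?_)
    · refine (actionDensity_add_le hΛ₁ hΛ₂ (hX.smul _) hP.isSymm_real _ _ _ _).trans ?_
      rw [actionDensity_zero_zero hP, add_zero]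
      refine (actionDensity_shrink hΛ₁ hΛ₂ hX _ _ (sub_pos.2 hs1) (by linarith)).trans ?_
      exact mul_le_mul_right (K.prod.actionDensity_matMoll_le hΛ₁ hΛ₂
        μ.hasMatDensity_ref.1.integrable μ.hasMatDensity_ref.2.1.integrable
        μ.hasMatDensity_ref.2.2.integrable (density_isSymm hμ.2.2.2 _) z) _
    · have hm := K.mollMarginal_nonneg μ z.2
      have h₁ := K.moll_momentum_le μ z
      -- With `β` the background and `e = b s M`, where `b` is `D.zerothBound`, use `s M ≤ 4 m` for
      -- one of the two factors in `e²`. Then `κ = 4 b² √s M` works, since `β ≥ √s m`.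
      refine (hbound (background x₀ s η₂ μ z.2) (D.zerothBound * (s * M z))
        (4 * D.zerothBound ^ 2 * √s * M z) _ (hs.le.trans (K.le_background μ _))
        (by have := hM0 z; positivity) (fun i j => K.abs_regError_le D μ z i j) ?_).trans ?_
      · have hsM : 0 ≤ s * M z := mul_nonneg hs.le (hM0 z)
        have h₂ : √s * √s = s := Real.mul_self_sqrt hs.le
        calc (D.zerothBound * (s * M z)) ^ 2
            = D.zerothBound ^ 2 * ((s * M z) * (s * M z)) := by ring
          _ ≤ D.zerothBound ^ 2 * ((4 * mollMarginal x₀ s η₂ μ z.2) * (s * M z)) := by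
              gcongr
          _ = (√s * mollMarginal x₀ s η₂ μ z.2) *
                (4 * D.zerothBound ^ 2 * √s * M z) := by
              linear_combination
                (-(4 * D.zerothBound ^ 2 * mollMarginal x₀ s η₂ μ z.2 * M z)) * h₂
          _ ≤ background x₀ s η₂ μ z.2 * (4 * D.zerothBound ^ 2 * √s * M z) := by
              have := hM0 z
              refine mul_le_mul_of_nonneg_right ?_ (by positivity)
              rw [background]
              linarith
      · rw [← ENNReal.ofReal_mul (by positivity)]
        refine ENNReal.ofReal_le_ofReal (le_of_eq ?_)
        ring
  refine (setLIntegral_mono' hQ hpt).trans ?_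
  have hMc : Measurable M := (K.prod.contDiff_moll μ.integrable_momentumDensity).continuous.measurable
  rw [lintegral_add_right _ (hMc.ennreal_ofReal.const_mul _),
    lintegral_const_mul' _ _ ENNReal.ofReal_ne_top, lintegral_const_mul' _ _ ENNReal.ofReal_ne_top]
  refine add_le_add ?_ ?_
  · rw [action, hr]
    exact mul_le_mul_right (K.prod.lintegral_moll_le
      (aemeasurable_actionDensity hΛ₁ hΛ₂ (measurable_density μ.G μ.ref)
        (measurable_density μ.q μ.ref) (measurable_density μ.R μ.ref)
        (ae_of_all _ (density_isSymm hμ.2.2.2 _))) _) _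
  · refine (mul_le_mul_right (K.prod.lintegral_ofReal_moll_le μ.integrable_momentumDensity
      μ.momentumDensity_nonneg _) _).trans ?_
    rw [← ENNReal.ofReal_mul (by positivity)]
    refine ENNReal.ofReal_le_ofReal (le_of_eq ?_)
    ring

end Action

end WBTransport

end

noncomputable section

namespace WBTransport

/-! ### Weak convergence of the regularized measures -/

section Bounds

variable {E : Type} [NormedAddCommGroup E] [NormedSpace ℝ E] [MeasureSpace E]
  [FiniteDimensional ℝ E] [BorelSpace E] [(volume : Measure E).IsAddHaarMeasure]
  {S : Set E} {c : E} {s : ℝ} {η : E → ℝ} {lam : Measure E}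

theorem IsMollifier.setIntegral_moll [SFinite lam] (h : IsMollifier S c s η) (hS : IsCompact S)
    (h0 : lam Sᶜ = 0) {f : E → ℝ} (hf : Integrable f lam) :
    ∫ z in S, moll c s η lam f z = ∫ w, f w ∂lam := by
  have := h.setIntegral_mul_moll hS h0 (φ := fun _ => 1) continuousOn_const hf
  simpa [avg, h.integral_eq_one] using this

theorem IsMollifier.integral_abs_moll_le [SFinite lam] (h : IsMollifier S c s η)
    (hS : IsCompact S) (h0 : lam Sᶜ = 0) {f : E → ℝ} (hf : Integrable f lam) :
    ∫ z in S, |moll c s η lam f z| ≤ ∫ w, |f w| ∂lam := by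
  rw [← h.setIntegral_moll hS h0 hf.abs]
  exact integral_mono_of_nonneg (ae_of_all _ fun _ => abs_nonneg _)
    ((h.contDiff_moll hf.abs).continuous.continuousOn.integrableOn_compact hS)
    (ae_of_all _ fun z => h.abs_moll_le f z)

end Bounds

/-! ### Smallness of the time layers that carry the end point data. -/

section Strips

variable {d : ℕ} {Ω : Set (Space d)} {x₀ : Space d} {s : ℝ} {η₁ : ℝ → ℝ} {η₂ : Space d → ℝ}

theorem abs_integral_timeSpace_le (hΩ : IsCompact Ω) {φ : ℝ × Space d → ℝ} {C : ℝ}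
    (hC : ∀ z ∈ timeSpace Ω, |φ z| ≤ C) {g : ℝ → ℝ} (hg : Continuous g) {m : Space d → ℝ}
    (hm : Continuous m) :
    |∫ z in timeSpace Ω, φ z * (g z.1 * m z.2)| ≤
      C * ((∫ t in Set.Icc (0 : ℝ) 1, |g t|) * ∫ x in Ω, |m x|) := by
  have hQ := isCompact_timeSpace hΩ
  have e : ∫ z in timeSpace Ω, |g z.1| * |m z.2| =
      (∫ t in Set.Icc (0 : ℝ) 1, |g t|) * ∫ x in Ω, |m x| := by
    rw [volume_restrict_timeSpace]
    exact integral_prod_mul (fun t => |g t|) fun x => |m x|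
  rw [← e, ← integral_const_mul, ← Real.norm_eq_abs]
  refine norm_integral_le_of_norm_le ?_ ?_
  · exact ((hg.comp continuous_fst).abs.mul
      (hm.comp continuous_snd).abs).continuousOn.integrableOn_compact hQ |>.const_mul C
  · filter_upwards [ae_restrict_mem hQ.measurableSet] with z hz
    rw [Real.norm_eq_abs, abs_mul, abs_mul]
    exact mul_le_mul_of_nonneg_right (hC z hz) (by positivity)

theorem integral_abs_le_of_strip {g : ℝ → ℝ} (hs : 0 ≤ s) {a : ℝ}
    (h1 : ∀ t ∈ Set.Icc (0 : ℝ) 1, |g t| ≤ 1)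
    (h0 : ∀ t ∈ Set.Icc (0 : ℝ) 1, t ∉ Set.Icc a (a + s) → g t = 0) :
    ∫ t in Set.Icc (0 : ℝ) 1, |g t| ≤ s := by
  have hle : ∀ t ∈ Set.Icc (0 : ℝ) 1, |g t| ≤ (Set.Icc a (a + s)).indicator (fun _ => 1) t := by
    intro t ht
    by_cases h : t ∈ Set.Icc a (a + s)
    · rw [Set.indicator_of_mem h]
      exact h1 t ht
    · rw [Set.indicator_of_notMem h, h0 t ht h, abs_zero]
  have hi : Integrable ((Set.Icc a (a + s)).indicator fun _ => (1 : ℝ)) :=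
    (integrable_indicator_iff measurableSet_Icc).2 (integrableOn_const (by simp))
  calc _ ≤ ∫ t in Set.Icc (0 : ℝ) 1, (Set.Icc a (a + s)).indicator (fun _ => (1 : ℝ)) t := by
        refine integral_mono_of_nonneg (ae_of_all _ fun _ => abs_nonneg _) hi.integrableOn ?_
        filter_upwards [ae_restrict_mem measurableSet_Icc] with t ht using hle t ht
    _ ≤ ∫ t, (Set.Icc a (a + s)).indicator (fun _ => (1 : ℝ)) t :=
        setIntegral_le_integral hi (ae_of_all _ fun t =>
          Set.indicator_nonneg (fun _ _ => zero_le_one) t)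
    _ = s := by
        rw [integral_indicator measurableSet_Icc, setIntegral_const]
        simp [hs]

theorem IsKernelPair.integral_abs_one_sub_cutoff_le (K : IsKernelPair Ω x₀ s η₁ η₂) :
    ∫ t in Set.Icc (0 : ℝ) 1, |1 - cutoff η₁ (contract (1 / 2) s 0) t| ≤ s := by
  have hs := K.time.pos
  rw [contract_half_zero]
  refine integral_abs_le_of_strip (a := 0) hs.le (fun t ht => ?_) fun t ht hts => ?_
  · have h₁ := K.cutoff_nonneg (s / 2) ht.1
    have h₂ := K.cutoff_le_one (s / 2) ht.1
    rw [abs_le]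
    constructor <;> linarith
  · have : s ≤ t := by
      by_contra h
      exact hts ⟨ht.1, by linarith⟩
    rw [K.cutoff_eq_one le_rfl (by linarith), sub_self]

theorem IsKernelPair.integral_abs_cutoff_le (K : IsKernelPair Ω x₀ s η₁ η₂) :
    ∫ t in Set.Icc (0 : ℝ) 1, |cutoff η₁ (contract (1 / 2) s 1) t| ≤ s := by
  have hs := K.time.pos
  rw [contract_half_one]
  refine integral_abs_le_of_strip (a := 1 - s) hs.le (fun t ht => ?_) fun t ht hts => ?_
  · rw [abs_of_nonneg (K.cutoff_nonneg _ ht.1)]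
    exact K.cutoff_le_one _ ht.1
  · have : t ≤ 1 - s := by
      by_contra h
      exact hts ⟨by linarith, by linarith [ht.2]⟩
    exact K.cutoff_eq_zero ht.1 (by linarith)

end Strips

/-! ### Weak* limits of the individual densities. -/

section Weak

variable {d n k : ℕ} {Ω : Set (Space d)} {x₀ : Space d} {η₁ : ℝ → ℝ → ℝ}
  {η₂ : ℝ → Space d → ℝ} {D : DiffOp d n k} {μ : Triple d n k} {G G₀ G₁ : MatMeasure (Space d) n n}

theorem tendsto_self_nhdsGT : Tendsto (fun s : ℝ => s) (𝓝[>] 0) (𝓝 0) := tendsto_nhdsWithin_of_tendsto_nhds tendsto_id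

theorem tendsto_sqrt_nhdsGT : Tendsto (fun s : ℝ => √s) (𝓝[>] 0) (𝓝 0) := by
  have := (Real.continuous_sqrt.tendsto 0).mono_left (nhdsWithin_le_nhds (s := Set.Ioi 0))
  rwa [Real.sqrt_zero] at this

theorem tendsto_one_sub_nhdsGT : Tendsto (fun s : ℝ => 1 - s) (𝓝[>] 0) (𝓝 1) := by
  simpa using tendsto_const_nhds.sub tendsto_self_nhdsGT

theorem tendsto_setIntegral_mul_spaceMoll
    (hK : ∀ᶠ s in 𝓝[>] (0 : ℝ), IsKernelPair Ω x₀ s (η₁ s) (η₂ s)) (hΩ : IsCompact Ω)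
    {lam : Measure (Space d)} [SFinite lam] (h0 : lam Ωᶜ = 0) {φ f : Space d → ℝ}
    (hφ : ContinuousOn φ Ω) (hf : Integrable f lam) :
    Tendsto (fun s => ∫ x in Ω, φ x * moll x₀ s (η₂ s) lam f x) (𝓝[>] 0)
      (𝓝 (∫ y, φ y * f y ∂lam)) :=
  tendsto_setIntegral_mul_moll hΩ h0 (hK.mono fun _ K => K.space) tendsto_self_nhdsGT
    (hK.mono fun _ K => K.space_supp) hφ hf

theorem tendsto_setIntegral_mul_refMoll
    (hK : ∀ᶠ s in 𝓝[>] (0 : ℝ), IsKernelPair Ω x₀ s (η₁ s) (η₂ s)) (hΩ : IsCompact Ω)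
    (hμ : μ.IsOn (timeSpace Ω)) {φ f : ℝ × Space d → ℝ}
    (hφ : ContinuousOn φ (timeSpace Ω)) (hf : Integrable f μ.ref) :
    Tendsto (fun s => ∫ z in timeSpace Ω, φ z *
      moll ((1 / 2 : ℝ), x₀) s (prodKernel (η₁ s) (η₂ s)) μ.ref f z) (𝓝[>] 0)
      (𝓝 (∫ w, φ w * f w ∂μ.ref)) :=
  tendsto_setIntegral_mul_moll (isCompact_timeSpace hΩ)
    (Triple.ae_mem_ref (isCompact_timeSpace hΩ).measurableSet hμ) (hK.mono fun _ K => K.prod)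
    tendsto_self_nhdsGT (hK.mono fun _ K => K.prod_supp) hφ hf

theorem tendsto_setIntegral_mul_background
    (hK : ∀ᶠ s in 𝓝[>] (0 : ℝ), IsKernelPair Ω x₀ s (η₁ s) (η₂ s)) (hΩ : IsCompact Ω)
    (hμ : μ.IsOn (timeSpace Ω)) {φ : Space d → ℝ} (hφ : ContinuousOn φ Ω) :
    Tendsto (fun s => ∫ x in Ω, φ x * background x₀ s (η₂ s) μ x) (𝓝[>] 0) (𝓝 0) := by
  have h₁ := tendsto_setIntegral_mul_spaceMoll hK hΩ (momentumMarginal_compl hΩ hμ) hφ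
    (integrable_const (1 : ℝ))
  have h₂ := (tendsto_sqrt_nhdsGT.mul h₁).add
    (tendsto_self_nhdsGT.mul (tendsto_const_nhds (x := ∫ x in Ω, φ x)))
  simp only [zero_mul, add_zero] at h₂
  refine h₂.congr' ?_
  filter_upwards [hK] with s K
  have i₁ : Integrable (fun x => φ x * mollMarginal x₀ s (η₂ s) μ x) (volume.restrict Ω) :=
    (hφ.mul (K.contDiff_mollMarginal μ).continuous.continuousOn).integrableOn_compact hΩ
  have i₂ : Integrable φ (volume.restrict Ω) := hφ.integrableOn_compact hΩ
  change √s * (∫ x in Ω, φ x * mollMarginal x₀ s (η₂ s) μ x) + s * _ = _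
  rw [← integral_const_mul, ← integral_const_mul, ← integral_add (i₁.const_mul _) (i₂.const_mul _)]
  refine integral_congr_ae (ae_of_all _ fun x => ?_)
  simp only [background]
  ring

/-- The background is nonnegative and independent of time, so its space-time mass equals its spatial
mass, which is of order `√s`. -/
theorem tendsto_setIntegral_timeSpace_mul_background
    (hK : ∀ᶠ s in 𝓝[>] (0 : ℝ), IsKernelPair Ω x₀ s (η₁ s) (η₂ s)) (hΩ : IsCompact Ω)
    (hμ : μ.IsOn (timeSpace Ω)) {φ : ℝ × Space d → ℝ} (hφ : ContinuousOn φ (timeSpace Ω)) :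
    Tendsto (fun s => ∫ z in timeSpace Ω, φ z * background x₀ s (η₂ s) μ z.2) (𝓝[>] 0) (𝓝 0) := by
  obtain ⟨C, hC⟩ := (isCompact_timeSpace hΩ).exists_bound_of_continuousOn hφ
  have h₁ := (tendsto_setIntegral_mul_background hK hΩ hμ
    (φ := fun _ => 1) continuousOn_const).const_mul |C|
  simp only [one_mul, mul_zero] at h₁
  refine squeeze_zero_norm' ?_ h₁
  filter_upwards [hK] with s K
  have h₂ := abs_integral_timeSpace_le hΩ
    (fun z hz => (hC z hz).trans (le_abs_self C)) (g := fun _ => 1) continuous_const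
    (K.contDiff_background μ).continuous
  simp only [one_mul, abs_one, integral_const, MeasurableSet.univ, measureReal_restrict_apply,
    Set.univ_inter, Real.volume_real_Icc_of_le zero_le_one, sub_zero, smul_eq_mul] at h₂
  have h₃ : ∀ x, |background x₀ s (η₂ s) μ x| = background x₀ s (η₂ s) μ x := fun x =>
    abs_of_nonneg (K.time.pos.le.trans (K.le_background μ x))
  simp only [h₃] at h₂
  exact h₂

/-- The two time factors live on layers of length at most `s`, while the mollified end points keep a
bounded `L¹` norm. -/
theorem tendsto_setIntegral_mul_endPart
    (hK : ∀ᶠ s in 𝓝[>] (0 : ℝ), IsKernelPair Ω x₀ s (η₁ s) (η₂ s)) (hΩ : IsCompact Ω)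
    (hG₀ : IsPSDMeasureOn Ω G₀) (hG₁ : IsPSDMeasureOn Ω G₁)
    {φ : ℝ × Space d → ℝ} (hφ : ContinuousOn φ (timeSpace Ω)) (i j : Fin n) :
    Tendsto (fun s => ∫ z in timeSpace Ω, φ z * endPart x₀ s (η₁ s) (η₂ s) G₀ G₁ z i j)
      (𝓝[>] 0) (𝓝 0) := by
  obtain ⟨C, hC⟩ := (isCompact_timeSpace hΩ).exists_bound_of_continuousOn hφ
  set M : MatMeasure (Space d) n n → ℝ := fun G =>
    ∫ x, |density G (dominating G) x i j| ∂dominating G with hM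
  have h₁ : Tendsto (fun s : ℝ => |C| * (s * M G₀) + |C| * (s * M G₁)) (𝓝[>] 0) (𝓝 0) := by
    have := ((tendsto_self_nhdsGT.mul_const (M G₀)).const_mul |C|).add
      ((tendsto_self_nhdsGT.mul_const (M G₁)).const_mul |C|)
    simpa using this
  refine squeeze_zero_norm' ?_ h₁
  filter_upwards [hK] with s K
  have hm : ∀ G : MatMeasure (Space d) n n, Continuous fun x => endMoll x₀ s (η₂ s) G x i j :=
    fun G => (K.isSmooth_endMoll G i j).continuous
  have hc : ∀ τ, Continuous (cutoff (η₁ s) τ) := fun τ => (contDiff_cutoff K.time.smooth τ).continuous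
  have hMle : ∀ G : MatMeasure (Space d) n n, IsPSDMeasureOn Ω G →
      ∫ x in Ω, |endMoll x₀ s (η₂ s) G x i j| ≤ M G := fun G hG =>
    K.space.integral_abs_moll_le hΩ (dominating_compl hΩ hG) (integrable_density_dominating G i j)
  have hI : ∀ {f : ℝ × Space d → ℝ}, Continuous f →
      Integrable (fun z => φ z * f z) (volume.restrict (timeSpace Ω)) := fun hf =>
    (hφ.mul hf.continuousOn).integrableOn_compact (isCompact_timeSpace hΩ)
  have i₀ : Integrable (fun z => φ z * ((1 - cutoff (η₁ s) (contract (1 / 2) s 0) z.1) *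
      endMoll x₀ s (η₂ s) G₀ z.2 i j)) (volume.restrict (timeSpace Ω)) :=
    hI ((continuous_const.sub ((hc _).comp continuous_fst)).mul ((hm G₀).comp continuous_snd))
  have i₁ : Integrable (fun z => φ z * (cutoff (η₁ s) (contract (1 / 2) s 1) z.1 *
      endMoll x₀ s (η₂ s) G₁ z.2 i j)) (volume.restrict (timeSpace Ω)) :=
    hI (((hc _).comp continuous_fst).mul ((hm G₁).comp continuous_snd))
  have e : ∫ z in timeSpace Ω, φ z * endPart x₀ s (η₁ s) (η₂ s) G₀ G₁ z i j =
      (∫ z in timeSpace Ω, φ z * ((1 - cutoff (η₁ s) (contract (1 / 2) s 0) z.1) *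
        endMoll x₀ s (η₂ s) G₀ z.2 i j)) +
      ∫ z in timeSpace Ω, φ z * (cutoff (η₁ s) (contract (1 / 2) s 1) z.1 *
        endMoll x₀ s (η₂ s) G₁ z.2 i j) := by
    rw [← integral_add i₀ i₁]
    refine integral_congr_ae (ae_of_all _ fun z => ?_)
    simp only [endPart, Matrix.add_apply, Matrix.smul_apply, smul_eq_mul]
    ring
  rw [e]
  have hC' : ∀ z ∈ timeSpace Ω, |φ z| ≤ |C| := fun z hz => (hC z hz).trans (le_abs_self C)
  refine (norm_add_le _ _).trans (add_le_add ?_ ?_)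
  · refine (abs_integral_timeSpace_le hΩ hC'
      (continuous_const.sub (hc _)) (hm G₀)).trans ?_
    refine mul_le_mul_of_nonneg_left ?_ (abs_nonneg C)
    exact mul_le_mul K.integral_abs_one_sub_cutoff_le (hMle G₀ hG₀)
      (integral_nonneg fun _ => abs_nonneg _) K.time.pos.le
  · refine (abs_integral_timeSpace_le hΩ hC' (hc _) (hm G₁)).trans ?_
    refine mul_le_mul_of_nonneg_left ?_ (abs_nonneg C)
    exact mul_le_mul K.integral_abs_cutoff_le (hMle G₁ hG₁)
      (integral_nonneg fun _ => abs_nonneg _) K.time.pos.le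

theorem continuousOn_entry {X : Type} [TopologicalSpace X] {m m' : ℕ} {S : Set X}
    {φ : X → Mat m m'} (hφ : ContinuousOn φ S) (i : Fin m) (j : Fin m') :
    ContinuousOn (fun x => φ x i j) S :=
  (continuous_id.matrix_elem i j).comp_continuousOn hφ

theorem weakStarTendsto_regEnd
    (hK : ∀ᶠ s in 𝓝[>] (0 : ℝ), IsKernelPair Ω x₀ s (η₁ s) (η₂ s)) (hΩ : IsCompact Ω)
    (hμ : μ.IsOn (timeSpace Ω)) (hG : IsPSDMeasureOn Ω G) :
    WeakStarTendsto Ω (fun s => regEnd Ω x₀ s (η₂ s) μ G) G := by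
  intro φ hφ
  have hφ' := continuousOn_entry hφ
  have hG0 := dominating_compl hΩ hG
  rw [(hasMatDensity_density (ν := G) Measure.AbsolutelyContinuous.rfl).pairing_eq_of_continuousOn
    hΩ hG0 hφ']
  have h : Tendsto (fun s => ∑ i, ∑ j, ((∫ x in Ω, φ x i j * endMoll x₀ s (η₂ s) G x i j) +
      ∫ x in Ω, φ x i j * (1 : Mat n n) i j * background x₀ s (η₂ s) μ x)) (𝓝[>] 0)
      (𝓝 (∑ i, ∑ j, ((∫ x, φ x i j * density G (dominating G) x i j ∂dominating G) + 0))) :=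
    tendsto_finsetSum _ fun i _ => tendsto_finsetSum _ fun j _ =>
      (tendsto_setIntegral_mul_spaceMoll hK hΩ hG0 (hφ' i j)
        (integrable_density_dominating G i j)).add
      (tendsto_setIntegral_mul_background hK hΩ hμ ((hφ' i j).mul continuousOn_const))
  simp only [add_zero] at h
  refine h.congr' ?_
  filter_upwards [hK] with s K
  rw [(K.hasMatDensity_regEnd hΩ μ G).pairing_eq_of_continuousOn hΩ
    (restrict_compl_self volume hΩ.measurableSet) hφ']
  refine Finset.sum_congr rfl fun i _ => Finset.sum_congr rfl fun j _ => ?_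
  have hb : ContinuousOn (fun x => φ x i j * (1 : Mat n n) i j) Ω := (hφ' i j).mul continuousOn_const
  rw [← integral_add]
  · refine integral_congr_ae (ae_of_all _ fun x => ?_)
    simp only [endReg, Matrix.add_apply, Matrix.smul_apply, smul_eq_mul]
    ring
  · exact ((hφ' i j).mul (K.isSmooth_endMoll G i j).continuous.continuousOn).integrableOn_compact hΩ
  · exact (hb.mul (K.contDiff_background μ).continuous.continuousOn).integrableOn_compact hΩ

theorem weakStarTendsto_regG
    (hK : ∀ᶠ s in 𝓝[>] (0 : ℝ), IsKernelPair Ω x₀ s (η₁ s) (η₂ s)) (hΩ : IsCompact Ω)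
    (D : DiffOp d n k) (hμ : μ.IsOn (timeSpace Ω)) (hG₀ : IsPSDMeasureOn Ω G₀)
    (hG₁ : IsPSDMeasureOn Ω G₁) :
    WeakStarTendsto (timeSpace Ω) (fun s => (regTriple Ω x₀ s (η₁ s) (η₂ s) D μ G₀ G₁).G) μ.G := by
  intro φ hφ
  have hφ' := continuousOn_entry hφ
  have hQ := isCompact_timeSpace hΩ
  obtain ⟨r₁, r₂, r₃⟩ := μ.hasMatDensity_ref
  rw [r₁.pairing_eq_of_continuousOn hQ (Triple.ae_mem_ref hQ.measurableSet hμ) hφ']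
  have h : Tendsto (fun s => ∑ i, ∑ j, (((1 - s) * (∫ z in timeSpace Ω, φ z i j *
        refMoll x₀ s (η₁ s) (η₂ s) μ (density μ.G μ.ref) z i j)) +
      (∫ z in timeSpace Ω, φ z i j * endPart x₀ s (η₁ s) (η₂ s) G₀ G₁ z i j) +
      ∫ z in timeSpace Ω, φ z i j * (1 : Mat n n) i j * background x₀ s (η₂ s) μ z.2)) (𝓝[>] 0)
      (𝓝 (∑ i, ∑ j, (1 * (∫ z, φ z i j * density μ.G μ.ref z i j ∂μ.ref) + 0 + 0))) :=
    tendsto_finsetSum _ fun i _ => tendsto_finsetSum _ fun j _ =>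
      ((tendsto_one_sub_nhdsGT.mul (tendsto_setIntegral_mul_refMoll hK hΩ hμ (hφ' i j)
        (r₁.integrable i j))).add (tendsto_setIntegral_mul_endPart hK hΩ hG₀ hG₁ (hφ' i j) i j)).add
      (tendsto_setIntegral_timeSpace_mul_background hK hΩ hμ ((hφ' i j).mul continuousOn_const))
  simp only [add_zero, one_mul] at h
  refine h.congr' ?_
  filter_upwards [hK] with s K
  rw [(K.hasMatDensity_regTriple hΩ D μ G₀ G₁).1.pairing_eq_of_continuousOn hQ
    (restrict_compl_self volume hQ.measurableSet) hφ']
  refine Finset.sum_congr rfl fun i _ => Finset.sum_congr rfl fun j _ => ?_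
  have hI : ∀ {f : ℝ × Space d → ℝ}, Continuous f →
      Integrable (fun z => φ z i j * f z) (volume.restrict (timeSpace Ω)) := fun hf =>
    ((hφ' i j).mul hf.continuousOn).integrableOn_compact hQ
  have i₁ := (hI (K.prod.isSmooth_matMoll r₁.integrable i j).continuous).const_mul (1 - s)
  have i₂ := hI (K.isSmooth_endPart G₀ G₁ i j).continuous
  have i₃ : Integrable (fun z => φ z i j * (1 : Mat n n) i j * background x₀ s (η₂ s) μ z.2)
      (volume.restrict (timeSpace Ω)) :=
    (((hφ' i j).mul continuousOn_const).mul ((K.contDiff_background μ).continuous.comp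
      continuous_snd).continuousOn).integrableOn_compact hQ
  rw [← integral_const_mul, ← integral_add i₁ i₂]
  refine (integral_add (i₁.add i₂) i₃).symm.trans ?_
  refine integral_congr_ae (ae_of_all _ fun z => ?_)
  simp only [regG, Matrix.add_apply, Matrix.smul_apply, smul_eq_mul, Pi.add_apply]
  ring

theorem weakStarTendsto_regq
    (hK : ∀ᶠ s in 𝓝[>] (0 : ℝ), IsKernelPair Ω x₀ s (η₁ s) (η₂ s)) (hΩ : IsCompact Ω)
    (D : DiffOp d n k) (hμ : μ.IsOn (timeSpace Ω)) (G₀ G₁ : MatMeasure (Space d) n n) :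
    WeakStarTendsto (timeSpace Ω) (fun s => (regTriple Ω x₀ s (η₁ s) (η₂ s) D μ G₀ G₁).q) μ.q := by
  intro φ hφ
  have hφ' := continuousOn_entry hφ
  have hQ := isCompact_timeSpace hΩ
  obtain ⟨r₁, r₂, r₃⟩ := μ.hasMatDensity_ref
  rw [r₂.pairing_eq_of_continuousOn hQ (Triple.ae_mem_ref hQ.measurableSet hμ) hφ']
  have h : Tendsto (fun s => ∑ i, ∑ j, ((1 - s) * (∫ z in timeSpace Ω, φ z i j *
        refMoll x₀ s (η₁ s) (η₂ s) μ (density μ.q μ.ref) z i j))) (𝓝[>] 0)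
      (𝓝 (∑ i, ∑ j, (1 * (∫ z, φ z i j * density μ.q μ.ref z i j ∂μ.ref)))) :=
    tendsto_finsetSum _ fun i _ => tendsto_finsetSum _ fun j _ =>
      tendsto_one_sub_nhdsGT.mul (tendsto_setIntegral_mul_refMoll hK hΩ hμ (hφ' i j)
        (r₂.integrable i j))
  simp only [one_mul] at h
  refine h.congr' ?_
  filter_upwards [hK] with s K
  rw [(K.hasMatDensity_regTriple hΩ D μ G₀ G₁).2.1.pairing_eq_of_continuousOn hQ
    (restrict_compl_self volume hQ.measurableSet) hφ']
  refine Finset.sum_congr rfl fun i _ => Finset.sum_congr rfl fun j _ => ?_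
  rw [← integral_const_mul]
  refine integral_congr_ae (ae_of_all _ fun z => ?_)
  simp only [regq, Matrix.smul_apply, smul_eq_mul]
  ring

theorem weakStarTendsto_regR
    (hK : ∀ᶠ s in 𝓝[>] (0 : ℝ), IsKernelPair Ω x₀ s (η₁ s) (η₂ s)) (hΩ : IsCompact Ω)
    (D : DiffOp d n k) (hμ : μ.IsOn (timeSpace Ω)) (G₀ G₁ : MatMeasure (Space d) n n) :
    WeakStarTendsto (timeSpace Ω) (fun s => (regTriple Ω x₀ s (η₁ s) (η₂ s) D μ G₀ G₁).R) μ.R := by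
  intro φ hφ
  have hφ' := continuousOn_entry hφ
  have hQ := isCompact_timeSpace hΩ
  obtain ⟨r₁, r₂, r₃⟩ := μ.hasMatDensity_ref
  rw [r₃.pairing_eq_of_continuousOn hQ (Triple.ae_mem_ref hQ.measurableSet hμ) hφ']
  have h : Tendsto (fun s => ∑ i, ∑ j, ((∫ z in timeSpace Ω, φ z i j *
        refMoll x₀ s (η₁ s) (η₂ s) μ (density μ.R μ.ref) z i j) +
      s * (∫ z in timeSpace Ω, φ z i j * refMoll x₀ s (η₁ s) (η₂ s) μ
        (fun w => D.zerothAdj (density μ.q μ.ref w)) z i j))) (𝓝[>] 0)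
      (𝓝 (∑ i, ∑ j, ((∫ z, φ z i j * density μ.R μ.ref z i j ∂μ.ref) +
        0 * ∫ z, φ z i j * D.zerothAdj (density μ.q μ.ref z) i j ∂μ.ref))) :=
    tendsto_finsetSum _ fun i _ => tendsto_finsetSum _ fun j _ =>
      (tendsto_setIntegral_mul_refMoll hK hΩ hμ (hφ' i j) (r₃.integrable i j)).add
        (tendsto_self_nhdsGT.mul (tendsto_setIntegral_mul_refMoll hK hΩ hμ (hφ' i j)
          (integrable_zerothAdj D μ i j)))
  simp only [zero_mul, add_zero] at h
  refine h.congr' ?_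
  filter_upwards [hK] with s K
  rw [(K.hasMatDensity_regTriple hΩ D μ G₀ G₁).2.2.pairing_eq_of_continuousOn hQ
    (restrict_compl_self volume hQ.measurableSet) hφ']
  refine Finset.sum_congr rfl fun i _ => Finset.sum_congr rfl fun j _ => ?_
  have hI : ∀ {f : ℝ × Space d → ℝ}, Continuous f →
      Integrable (fun z => φ z i j * f z) (volume.restrict (timeSpace Ω)) := fun hf =>
    ((hφ' i j).mul hf.continuousOn).integrableOn_compact hQ
  have i₁ := hI (K.prod.isSmooth_matMoll r₃.integrable i j).continuous
  have i₂ := (hI (K.prod.isSmooth_matMoll (integrable_zerothAdj D μ) i j).continuous).const_mul s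
  rw [← integral_const_mul, ← integral_add i₁ i₂]
  refine integral_congr_ae (ae_of_all _ fun z => ?_)
  simp only [regR, regError, Matrix.add_apply, Matrix.smul_apply, smul_eq_mul]
  ring

/-- The lower bound is weak* lower semicontinuity, the upper bound is `exists_action_regTriple_le`.
-/
theorem tendsto_action_regTriple {Λ₁ : Mat k k} {Λ₂ : Mat n n} (hΛ₁ : Λ₁.PosSemidef)
    (hΛ₂ : Λ₂.PosDef)
    (hK : ∀ᶠ s in 𝓝[>] (0 : ℝ), IsKernelPair Ω x₀ s (η₁ s) (η₂ s)) (hΩ : IsCompact Ω)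
    (D : DiffOp d n k) (hμ : μ.IsOn (timeSpace Ω)) (hG₀ : IsPSDMeasureOn Ω G₀)
    (hG₁ : IsPSDMeasureOn Ω G₁) (hfin : action Λ₁ Λ₂ (timeSpace Ω) μ < ⊤) :
    Tendsto (fun s => action Λ₁ Λ₂ (timeSpace Ω) (regTriple Ω x₀ s (η₁ s) (η₂ s) D μ G₀ G₁))
      (𝓝[>] 0) (𝓝 (action Λ₁ Λ₂ (timeSpace Ω) μ)) := by
  obtain ⟨C, hC⟩ := exists_action_regTriple_le (x₀ := x₀) hΩ hΛ₁ hΛ₂ D hμ hG₀ hG₁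
  have h₁ : Tendsto (fun s : ℝ => ENNReal.ofReal (1 - s)⁻¹ * action Λ₁ Λ₂ (timeSpace Ω) μ +
      ENNReal.ofReal (C * √s)) (𝓝[>] 0) (𝓝 (action Λ₁ Λ₂ (timeSpace Ω) μ)) := by
    have h₂ := ENNReal.tendsto_ofReal (tendsto_one_sub_nhdsGT.inv₀ one_ne_zero)
    have h₃ := ENNReal.tendsto_ofReal (tendsto_sqrt_nhdsGT.const_mul C)
    have := (ENNReal.Tendsto.mul_const h₂ (Or.inr hfin.ne)).add h₃
    simpa using this
  refine tendsto_order.2 ⟨fun M hM => ?_, fun M hM => ?_⟩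
  · exact eventually_lt_action hΛ₁ hΛ₂ (isCompact_timeSpace hΩ).measurableSet hμ
      (hK.mono fun s K => K.isOn_regTriple hΩ hμ hG₀ hG₁)
      (weakStarTendsto_regG hK hΩ D hμ hG₀ hG₁) (weakStarTendsto_regq hK hΩ D hμ G₀ G₁)
      (weakStarTendsto_regR hK hΩ D hμ G₀ G₁) hM
  · filter_upwards [hK, h₁.eventually (gt_mem_nhds hM)] with s K hs
    exact (hC s _ _ K).trans_lt hs

end Weak

end WBTransport

end

noncomputable section

namespace WBTransport

/-! ### Strong convergence of mollifications -/

section L1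

variable {E : Type} [NormedAddCommGroup E] [NormedSpace ℝ E] [MeasureSpace E]
  [FiniteDimensional ℝ E] [BorelSpace E] [(volume : Measure E).IsAddHaarMeasure]
  {S : Set E} {c : E} {s : ℝ} {η : E → ℝ}

theorem sub_contract_eq (z y : E) :
    z - contract c s y = (z - c + (1 - s) • c) - (1 - s) • y := by
  rw [contract, smul_sub]
  abel

theorem IsMollifier.integrable_comp_contract (h : IsMollifier S c s η) (z : E) :
    Integrable fun y => η (z - contract c s y) := by
  simp only [sub_contract_eq]
  exact (h.integrable_kernel.comp_sub_left (z - c + (1 - s) • c)).comp_smul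
    (sub_pos.2 h.lt_one).ne'

/-- In the variable `y` the kernel has mass `(1 - s)^(-N)`, not one, because the contraction
concentrates Lebesgue measure. This correction factor has to be tracked in the strong convergence.
-/
theorem IsMollifier.integral_comp_contract (h : IsMollifier S c s η) (z : E) :
    ∫ y, η (z - contract c s y) = ((1 - s) ^ Module.finrank ℝ E)⁻¹ := by
  simp only [sub_contract_eq]
  rw [Measure.integral_comp_smul_of_nonneg volume (fun y => η (z - c + (1 - s) • c - y)) (1 - s)
    (hR := (sub_pos.2 h.lt_one).le), integral_sub_left_eq_self, h.integral_eq_one, smul_eq_mul,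
    mul_one]

theorem IsMollifier.setIntegral_abs_moll_volume_le (h : IsMollifier S c s η) (hS : IsCompact S)
    {f : E → ℝ} (hf : Integrable f) :
    ∫ z in S, |moll c s η volume f z| ≤ ∫ w, |f w| := by
  have hi : Integrable (moll c s η volume fun w => |f w|) (volume.restrict S) :=
    (h.contDiff_moll hf.abs).continuous.continuousOn.integrableOn_compact hS
  refine (integral_mono_of_nonneg (ae_of_all _ fun _ => abs_nonneg _) hi
    (ae_of_all _ fun z => h.abs_moll_le f z)).trans ?_
  have h₁ := h.lintegral_ofReal_moll_le hf.abs (fun _ => abs_nonneg _) S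
  rw [← ofReal_integral_eq_lintegral_ofReal hi
    (ae_of_all _ (h.moll_nonneg (ae_of_all _ fun _ => abs_nonneg _)))] at h₁
  exact (ENNReal.ofReal_le_ofReal_iff (integral_nonneg fun _ => abs_nonneg _)).1 h₁

variable {η : ℝ → E → ℝ}

/-- Uniform continuity of `g` controls the oscillation over the support of the kernel; the excess
mass tends to zero and multiplies the bounded value `g x`. -/
theorem eventually_abs_moll_sub_le (hS : IsCompact S)
    (hη : ∀ᶠ s in 𝓝[>] (0 : ℝ), IsMollifier S c s (η s))
    (hηs : ∀ᶠ s in 𝓝[>] (0 : ℝ), ∀ y, η s y ≠ 0 → ‖y‖ ≤ s) {g : E → ℝ} (hg : Continuous g)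
    (hgc : HasCompactSupport g) {δ : ℝ} (hδ : 0 < δ) :
    ∀ᶠ s in 𝓝[>] (0 : ℝ), ∀ x ∈ S, |moll c s (η s) volume g x - g x| ≤ δ := by
  obtain ⟨B, hB⟩ := hgc.exists_bound_of_continuous hg
  obtain ⟨R, hR⟩ := hS.exists_bound_of_continuousOn (f := fun x => x - c) (by fun_prop)
  have hB0 : 0 ≤ B := (norm_nonneg _).trans (hB 0)
  obtain ⟨ρ, hρ, hgρ⟩ := Metric.uniformContinuous_iff.1
    (hgc.uniformContinuous_of_continuous hg) (δ / 4) (by positivity)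
  set N := Module.finrank ℝ E
  have hlim : Tendsto (fun s : ℝ => ((1 - s) ^ N)⁻¹) (𝓝[>] 0) (𝓝 1) := by
    have h : ContinuousAt (fun s : ℝ => ((1 - s) ^ N)⁻¹) 0 := by
      refine ContinuousAt.inv₀ (by fun_prop) (by simp)
    have := h.tendsto.mono_left (nhdsWithin_le_nhds (s := Set.Ioi 0))
    simpa using this
  have hid : Tendsto (fun s : ℝ => s) (𝓝[>] 0) (𝓝 0) := tendsto_self_nhdsGT
  have e₁ : ∀ᶠ s in 𝓝[>] (0 : ℝ), s < 1 / 2 := hid.eventually (gt_mem_nhds (by norm_num))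
  have e₂ : ∀ᶠ s in 𝓝[>] (0 : ℝ), s * (2 * (|R| + 1)) + s < ρ := by
    have : Tendsto (fun s : ℝ => s * (2 * (|R| + 1)) + s) (𝓝[>] 0) (𝓝 0) := by
      simpa using (hid.mul_const (2 * (|R| + 1))).add hid
    exact this.eventually (gt_mem_nhds hρ)
  have e₃ : ∀ᶠ s in 𝓝[>] (0 : ℝ), ((1 - s) ^ N)⁻¹ < 2 := hlim.eventually (gt_mem_nhds (by norm_num))
  have e₄ : ∀ᶠ s in 𝓝[>] (0 : ℝ), |((1 - s) ^ N)⁻¹ - 1| * B < δ / 2 := by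
    have : Tendsto (fun s : ℝ => |((1 - s) ^ N)⁻¹ - 1| * B) (𝓝[>] 0) (𝓝 0) := by
      have := ((hlim.sub_const 1).abs).mul_const B
      simpa using this
    exact this.eventually (gt_mem_nhds (by positivity))
  filter_upwards [hη, hηs, e₁, e₂, e₃, e₄] with s h hsupp hs₁ hs₂ hs₃ hs₄ x hx
  have hs0 := h.pos
  have hk := h.integrable_comp_contract x
  have hkg : Integrable fun y => η s (x - contract c s y) * g y :=
    h.integrable_mul (hg.integrable_of_hasCompactSupport hgc) x
  have hmass := h.integral_comp_contract x
  have key : |moll c s (η s) volume g x - ((1 - s) ^ N)⁻¹ * g x| ≤ ((1 - s) ^ N)⁻¹ * (δ / 4) := by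
    rw [moll, ← hmass, ← integral_mul_const, ← integral_mul_const,
      ← integral_sub hkg (hk.mul_const _), ← Real.norm_eq_abs]
    refine norm_integral_le_of_norm_le (hk.mul_const _) (ae_of_all _ fun y => ?_)
    rw [← mul_sub, norm_mul, Real.norm_of_nonneg (h.nonneg _)]
    by_cases hy : η s (x - contract c s y) = 0
    · simp [hy]
    · refine mul_le_mul_of_nonneg_left ?_ (h.nonneg _)
      have h₁ : ‖x - contract c s y‖ ≤ s := hsupp _ hy
      -- For `s < 1/2` the points seen by the kernel stay in a fixed ball around `c`, so the
      -- contraction displaces them by `O(s)`.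
      have h₂ : ‖y - c‖ ≤ 2 * (|R| + 1) := by
        have h₃ : (1 - s) * ‖y - c‖ ≤ |R| + s := by
          have e : (1 - s) • (y - c) = (x - c) - (x - contract c s y) := by
            rw [contract]
            abel
          rw [← Real.norm_of_nonneg (sub_pos.2 h.lt_one).le, ← norm_smul, e]
          exact (norm_sub_le _ _).trans (add_le_add ((hR x hx).trans (le_abs_self R)) h₁)
        nlinarith [norm_nonneg (y - c)]
      have h₄ := dist_contract_add_le c hs0.le y (x - contract c s y)
      rw [add_sub_cancel, dist_comm] at h₄
      have h₅ : dist y x < ρ := by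
        refine (h₄.trans (add_le_add ?_ h₁)).trans_lt hs₂
        exact mul_le_mul_of_nonneg_left h₂ hs0.le
      exact (hgρ h₅).le
  have h₆ : |((1 - s) ^ N)⁻¹ * g x - g x| ≤ δ / 2 := by
    have : ((1 - s) ^ N)⁻¹ * g x - g x = (((1 - s) ^ N)⁻¹ - 1) * g x := by ring
    rw [this, abs_mul]
    exact (mul_le_mul_of_nonneg_left (hB x) (abs_nonneg _)).trans hs₄.le
  have h₇ := abs_sub_le (moll c s (η s) volume g x) (((1 - s) ^ N)⁻¹ * g x) (g x)
  nlinarith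

/-- Approximate `f` in `L¹` by a continuous `g` of compact support. The mollification does not
increase the `L¹` norm of `f - g`, and for `g` the convergence is uniform on `S`. -/
theorem tendsto_setIntegral_abs_moll_sub (hS : IsCompact S)
    (hη : ∀ᶠ s in 𝓝[>] (0 : ℝ), IsMollifier S c s (η s))
    (hηs : ∀ᶠ s in 𝓝[>] (0 : ℝ), ∀ y, η s y ≠ 0 → ‖y‖ ≤ s) {f : E → ℝ} (hf : Integrable f) :
    Tendsto (fun s => ∫ x in S, |moll c s (η s) volume f x - f x|) (𝓝[>] 0) (𝓝 0) := by
  have := FiniteDimensional.proper_real E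
  refine tendsto_order.2 ⟨fun a ha => Eventually.of_forall fun s =>
    ha.trans_le (integral_nonneg fun _ => abs_nonneg _), fun ε hε => ?_⟩
  obtain ⟨g, hgc, hfg, hg, hgi⟩ := hf.exists_hasCompactSupport_integral_sub_le
    (show 0 < ε / 4 by positivity)
  set V := volume.real S with hV
  have hV0 : 0 ≤ V := measureReal_nonneg
  filter_upwards [hη, eventually_abs_moll_sub_le hS hη hηs hg hgc
    (show 0 < ε / (4 * (V + 1)) by positivity)] with s h hs
  have hSm := hS.measurableSet
  have hfgi : Integrable fun x => f x - g x := hf.sub hgi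
  have i₁ : Integrable (fun x => |moll c s (η s) volume (fun x => f x - g x) x|)
      (volume.restrict S) :=
    (h.contDiff_moll hfgi).continuous.abs.continuousOn.integrableOn_compact hS
  have i₂ : Integrable (fun x => |moll c s (η s) volume g x - g x|) (volume.restrict S) :=
    ((h.contDiff_moll hgi).continuous.sub hg).abs.continuousOn.integrableOn_compact hS
  have i₃ : Integrable (fun x => |f x - g x|) (volume.restrict S) := hfgi.abs.restrict
  have hm : ∀ x, moll c s (η s) volume f x =
      moll c s (η s) volume (fun x => f x - g x) x + moll c s (η s) volume g x := fun x => by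
    rw [← h.moll_add hfgi hgi]
    simp only [sub_add_cancel]
  have h₁ : ∫ x in S, |moll c s (η s) volume f x - f x| ≤
      ∫ x in S, (|moll c s (η s) volume (fun x => f x - g x) x| +
        |moll c s (η s) volume g x - g x|) + |f x - g x| := by
    refine integral_mono_of_nonneg (ae_of_all _ fun _ => abs_nonneg _) ((i₁.add i₂).add i₃)
      (ae_of_all _ fun x => ?_)
    simp only [hm]
    have e : moll c s (η s) volume (fun x => f x - g x) x + moll c s (η s) volume g x - f x =
        moll c s (η s) volume (fun x => f x - g x) x + (moll c s (η s) volume g x - g x) +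
          -(f x - g x) := by ring
    rw [e]
    refine (abs_add_le _ _).trans (add_le_add (abs_add_le _ _) ?_)
    rw [abs_neg]
  have h₂ := h.setIntegral_abs_moll_volume_le hS hfgi
  have h₃ : ∫ x in S, |f x - g x| ≤ ∫ x, |f x - g x| :=
    setIntegral_le_integral hfgi.abs (ae_of_all _ fun _ => abs_nonneg _)
  have h₄ : ∫ x in S, |moll c s (η s) volume g x - g x| ≤ ε / (4 * (V + 1)) * V := by
    have : ∫ x in S, |moll c s (η s) volume g x - g x| ≤ ∫ x in S, ε / (4 * (V + 1)) := by
      refine integral_mono_of_nonneg (ae_of_all _ fun _ => abs_nonneg _)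
        (integrableOn_const hS.measure_lt_top.ne) ?_
      filter_upwards [ae_restrict_mem hSm] with x hx using hs x hx
    refine this.trans_eq ?_
    rw [setIntegral_const, smul_eq_mul, mul_comm]
  have h₅ : ε / (4 * (V + 1)) * V ≤ ε / 4 := by
    rw [div_mul_eq_mul_div, div_le_div_iff₀ (by positivity) (by positivity)]
    nlinarith
  have h₆ : ∫ x, |f x - g x| ≤ ε / 4 := hfg
  have e₁ : ∫ x in S, (|moll c s (η s) volume (fun x => f x - g x) x| +
        |moll c s (η s) volume g x - g x|) + |f x - g x| =
      (∫ x in S, |moll c s (η s) volume (fun x => f x - g x) x|) +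
        (∫ x in S, |moll c s (η s) volume g x - g x|) + ∫ x in S, |f x - g x| := by
    rw [← integral_add i₁ i₂]
    exact integral_add (i₁.add i₂) i₃
  linarith

end L1

/-! ### Strong convergence of absolutely continuous end points. -/

section EndPoints

variable {d n k : ℕ} {Ω : Set (Space d)} {x₀ : Space d} {η₁ : ℝ → ℝ → ℝ}
  {η₂ : ℝ → Space d → ℝ} {μ : Triple d n k} {G : MatMeasure (Space d) n n}

theorem dominating_absolutelyContinuous_of_vectorMeasure {X : Type} [MeasurableSpace X]
    {m m' : ℕ} {ν : MatMeasure X m m'} {lam : Measure X}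
    (h : ν ≪ᵥ lam.toENNRealVectorMeasure) : dominating ν ≪ lam := by
  intro E hE
  simp only [dominating, Measure.coe_finsetSum, Finset.sum_apply, Finset.sum_eq_zero_iff]
  intro i _ j _
  have h₁ : entry ν i j ≪ᵥ lam.toENNRealVectorMeasure := fun E hE => by
    rw [entry_apply, h hE]
    rfl
  rw [SignedMeasure.absolutelyContinuous_ennreal_iff] at h₁
  have h₂ : lam.toENNRealVectorMeasure.ennrealToMeasure = lam :=
    VectorMeasure.equivMeasure.right_inv lam
  rw [h₂] at h₁
  exact h₁ hE

theorem dominating_absolutelyContinuous_restrict (hΩ : IsCompact Ω) (hG : IsPSDMeasureOn Ω G)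
    (h : G ≪ᵥ (volume : Measure (Space d)).toENNRealVectorMeasure) :
    dominating G ≪ volume.restrict Ω := by
  have h₀ : (dominating G).restrict Ω = dominating G :=
    Measure.restrict_eq_self_of_ae_mem (dominating_compl hΩ hG)
  rw [← h₀]
  exact (dominating_absolutelyContinuous_of_vectorMeasure h).restrict Ω

/-- Changing the reference measure from `dominating G` to Lebesgue measure makes the `L¹`
convergence theorem applicable. -/
theorem endMoll_eq_moll_volume (hΩ : IsCompact Ω) (h : dominating G ≪ volume.restrict Ω) (s : ℝ)
    (η : Space d → ℝ) (x : Space d) (i j : Fin n) :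
    endMoll x₀ s η G x i j = moll x₀ s η volume
      (Ω.indicator fun y => density G (volume.restrict Ω) y i j) x := by
  have : IsFiniteMeasure ((volume : Measure (Space d)).restrict Ω) :=
    isFiniteMeasure_restrict.2 hΩ.measure_lt_top.ne
  have hd := (hasMatDensity_density h).ae_eq_rnDeriv_mul
    (hasMatDensity_density (ν := G) Measure.AbsolutelyContinuous.rfl) h
  have e₁ : endMoll x₀ s η G x i j = ∫ y, η (x - contract x₀ s y) *
      density G (dominating G) y i j ∂dominating G := rfl
  have e₂ : ∀ y, η (x - contract x₀ s y) *
      Ω.indicator (fun y => density G (volume.restrict Ω) y i j) y =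
      Ω.indicator (fun y => η (x - contract x₀ s y) * density G (volume.restrict Ω) y i j) y :=
    fun y => (Set.indicator_mul_right Ω (fun y => η (x - contract x₀ s y)) _).symm
  rw [e₁, moll]
  simp only [e₂]
  rw [integral_indicator hΩ.measurableSet, ← integral_rnDeriv_smul h]
  refine integral_congr_ae ?_
  filter_upwards [hd] with y hy
  rw [hy, Matrix.smul_apply, smul_eq_mul, smul_eq_mul]
  ring

theorem abs_one_apply_le (i j : Fin n) : |(1 : Mat n n) i j| ≤ 1 := by
  by_cases hij : i = j
  · rw [hij, Matrix.one_apply_eq, abs_one]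
  · rw [Matrix.one_apply_ne hij, abs_zero]
    exact zero_le_one

theorem tendsto_integral_endReg_sub
    (hK : ∀ᶠ s in 𝓝[>] (0 : ℝ), IsKernelPair Ω x₀ s (η₁ s) (η₂ s)) (hΩ : IsCompact Ω)
    (hμ : μ.IsOn (timeSpace Ω)) (h : dominating G ≪ volume.restrict Ω) :
    Tendsto (fun s => ∫ x in Ω, ∑ i, ∑ j,
      |endReg x₀ s (η₂ s) μ G x i j - density G (volume.restrict Ω) x i j|) (𝓝[>] 0) (𝓝 0) := by
  have : IsFiniteMeasure ((volume : Measure (Space d)).restrict Ω) :=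
    isFiniteMeasure_restrict.2 hΩ.measure_lt_top.ne
  have hA := (hasMatDensity_density h).integrable
  set A := density G (volume.restrict Ω)
  have hf : ∀ i j, Integrable (Ω.indicator fun y => A y i j) := fun i j =>
    (integrable_indicator_iff hΩ.measurableSet).2 (hA i j)
  have h₁ : ∀ i j, Tendsto (fun s => ∫ x in Ω, |endMoll x₀ s (η₂ s) G x i j - A x i j|)
      (𝓝[>] 0) (𝓝 0) := fun i j => by
    refine (tendsto_setIntegral_abs_moll_sub hΩ (hK.mono fun _ K => K.space)
      (hK.mono fun _ K => K.space_supp) (hf i j)).congr fun s => ?_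
    refine integral_congr_ae ?_
    filter_upwards [ae_restrict_mem hΩ.measurableSet] with x hx
    rw [endMoll_eq_moll_volume hΩ h, Set.indicator_of_mem hx]
  have h₂ := tendsto_setIntegral_mul_background (μ := μ) hK hΩ hμ
    (φ := fun _ => 1) continuousOn_const
  have h₃ : Tendsto (fun s => ∑ i : Fin n, ∑ j : Fin n,
      ((∫ x in Ω, |endMoll x₀ s (η₂ s) G x i j - A x i j|) +
        ∫ x in Ω, 1 * background x₀ s (η₂ s) μ x)) (𝓝[>] 0)
      (𝓝 (∑ _i : Fin n, ∑ _j : Fin n, ((0 : ℝ) + 0))) :=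
    tendsto_finsetSum _ fun i _ => tendsto_finsetSum _ fun j _ => (h₁ i j).add h₂
  simp only [add_zero, Finset.sum_const_zero] at h₃
  refine squeeze_zero' (Eventually.of_forall fun s => integral_nonneg fun x =>
    Finset.sum_nonneg fun i _ => Finset.sum_nonneg fun j _ => abs_nonneg _) ?_ h₃
  filter_upwards [hK] with s K
  have hE : ∀ i j, Integrable (fun x => endReg x₀ s (η₂ s) μ G x i j) (volume.restrict Ω) :=
    (K.isSmooth_endReg μ G).integrable hΩ
  have hM : ∀ i j, Integrable (fun x => endMoll x₀ s (η₂ s) G x i j) (volume.restrict Ω) :=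
    (K.isSmooth_endMoll G).integrable hΩ
  have hb : Integrable (fun x => 1 * background x₀ s (η₂ s) μ x) (volume.restrict Ω) :=
    ((K.contDiff_background μ).continuous.continuousOn.integrableOn_compact hΩ).const_mul 1
  have hEA : ∀ i j, Integrable (fun x => |endReg x₀ s (η₂ s) μ G x i j - A x i j|)
      (volume.restrict Ω) := fun i j => ((hE i j).sub (hA i j)).abs
  have hMA : ∀ i j, Integrable (fun x => |endMoll x₀ s (η₂ s) G x i j - A x i j|)
      (volume.restrict Ω) := fun i j => ((hM i j).sub (hA i j)).abs
  rw [integral_finsetSum _ fun i _ => integrable_finsetSum _ fun j _ => hEA i j]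
  refine Finset.sum_le_sum fun i _ => ?_
  rw [integral_finsetSum _ fun j _ => hEA i j]
  refine Finset.sum_le_sum fun j _ => ?_
  rw [← integral_add (hMA i j) hb]
  refine integral_mono (hEA i j) ((hMA i j).add hb) fun x => ?_
  have hb0 : 0 ≤ background x₀ s (η₂ s) μ x := K.time.pos.le.trans (K.le_background μ x)
  have e : endReg x₀ s (η₂ s) μ G x i j - A x i j = (endMoll x₀ s (η₂ s) G x i j - A x i j) +
      background x₀ s (η₂ s) μ x * (1 : Mat n n) i j := by
    simp only [endReg, Matrix.add_apply, Matrix.smul_apply, smul_eq_mul]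
    ring
  rw [e]
  refine (abs_add_le _ _).trans (add_le_add le_rfl ?_)
  rw [abs_mul, abs_of_nonneg hb0, one_mul]
  exact mul_le_of_le_one_right hb0 (abs_one_apply_le i j)

end EndPoints

end WBTransport

end

noncomputable section

namespace WBTransport

/-! ### The distance of measures with nearby densities -/

section Interpolation

variable {d n k : ℕ} {Ω : Set (Space d)} {A B : Space d → Mat n n}

/-- The entrywise `ℓ¹` distance of two densities. -/
def densityGap (A B : Space d → Mat n n) (x : Space d) : ℝ := ∑ i, ∑ j, |B x i j - A x i j|

theorem densityGap_nonneg (A B : Space d → Mat n n) (x : Space d) : 0 ≤ densityGap A B x :=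
  Finset.sum_nonneg fun _ _ => Finset.sum_nonneg fun _ _ => abs_nonneg _

theorem abs_sub_le_densityGap (A B : Space d → Mat n n) (x : Space d) (i j : Fin n) :
    |B x i j - A x i j| ≤ densityGap A B x :=
  (Finset.single_le_sum (f := fun j => |B x i j - A x i j|) (fun _ _ => abs_nonneg _)
    (Finset.mem_univ j)).trans
    (Finset.single_le_sum (f := fun i => ∑ j, |B x i j - A x i j|)
      (fun _ _ => Finset.sum_nonneg fun _ _ => abs_nonneg _) (Finset.mem_univ i))

theorem integrable_densityGap {lam : Measure (Space d)}
    (hA : ∀ i j, Integrable (fun x => A x i j) lam)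
    (hB : ∀ i j, Integrable (fun x => B x i j) lam) : Integrable (densityGap A B) lam :=
  integrable_finsetSum _ fun i _ => integrable_finsetSum _ fun j _ => ((hB i j).sub (hA i j)).abs

/-- A monotone transition from `0` to `1`, flat at both ends. -/
def smoothStep (t : ℝ) : ℝ := 3 * t ^ 2 - 2 * t ^ 3

/-- A bump that vanishes to second order at `0` and `1`. -/
def bump (t : ℝ) : ℝ := t ^ 2 * (1 - t) ^ 2

theorem hasDerivAt_smoothStep (t : ℝ) : HasDerivAt smoothStep (6 * t * (1 - t)) t := by
  have := ((hasDerivAt_pow 2 t).const_mul 3).sub ((hasDerivAt_pow 3 t).const_mul 2)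
  refine this.congr_deriv ?_
  norm_num
  ring

theorem hasDerivAt_bump (t : ℝ) : HasDerivAt bump (2 * t * (1 - t) * (1 - 2 * t)) t := by
  have := (hasDerivAt_pow 2 t).mul (((hasDerivAt_id t).const_sub 1).pow 2)
  refine this.congr_deriv ?_
  norm_num
  ring

/-- The density of the interpolating measure. -/
def interpG (A B : Space d → Mat n n) (z : ℝ × Space d) : Mat n n :=
  ((1 - smoothStep z.1) • A z.2 + smoothStep z.1 • B z.2) +
    (bump z.1 * densityGap A B z.2) • (1 : Mat n n)

/-- The time derivative of the interpolating density. -/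
def interpR (A B : Space d → Mat n n) (z : ℝ × Space d) : Mat n n :=
  (6 * z.1 * (1 - z.1)) • (B z.2 - A z.2) +
    (2 * z.1 * (1 - z.1) * (1 - 2 * z.1) * densityGap A B z.2) • (1 : Mat n n)

/-- The interpolation between two measures with given densities. -/
def interpTriple (k : ℕ) (Ω : Set (Space d)) (A B : Space d → Mat n n) : Triple d n k where
  G := matWithDensity (volume.restrict (timeSpace Ω)) (interpG A B)
  q := matWithDensity (volume.restrict (timeSpace Ω)) fun _ => 0
  R := matWithDensity (volume.restrict (timeSpace Ω)) (interpR A B)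

theorem abs_interpR_le {z : ℝ × Space d} (hz : z ∈ timeSpace Ω) (i j : Fin n) :
    |interpR A B z i j| ≤ 8 * z.1 * (1 - z.1) * densityGap A B z.2 := by
  obtain ⟨h0, h1⟩ := hz.1
  have e0 := densityGap_nonneg A B z.2
  have hp : 0 ≤ z.1 * (1 - z.1) := mul_nonneg h0 (sub_nonneg.2 h1)
  have e : interpR A B z i j = (6 * z.1 * (1 - z.1)) * (B z.2 i j - A z.2 i j) +
      (2 * z.1 * (1 - z.1) * (1 - 2 * z.1) * densityGap A B z.2) * (1 : Mat n n) i j := rfl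
  rw [e]
  have h₁ : |(6 * z.1 * (1 - z.1)) * (B z.2 i j - A z.2 i j)| ≤
      6 * (z.1 * (1 - z.1)) * densityGap A B z.2 := by
    rw [abs_mul, mul_assoc 6, abs_of_nonneg (by positivity)]
    exact mul_le_mul_of_nonneg_left (abs_sub_le_densityGap A B _ i j) (by positivity)
  have h₂ : |(2 * z.1 * (1 - z.1) * (1 - 2 * z.1) * densityGap A B z.2) * (1 : Mat n n) i j| ≤
      2 * (z.1 * (1 - z.1)) * densityGap A B z.2 := by
    rw [abs_mul]
    refine (mul_le_of_le_one_right (abs_nonneg _) (abs_one_apply_le i j)).trans ?_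
    rw [abs_mul, abs_of_nonneg e0, mul_assoc 2, abs_mul, abs_of_nonneg (a := 2 * (z.1 * (1 - z.1)))
      (by positivity)]
    refine mul_le_mul_of_nonneg_right (mul_le_of_le_one_right (by positivity) ?_) e0
    rw [abs_le]
    constructor <;> linarith
  refine (abs_add_le _ _).trans ((add_le_add h₁ h₂).trans_eq ?_)
  ring

variable {G₀ G₁ : MatMeasure (Space d) n n}

theorem hasMatDensity_interpTriple (k : ℕ) (hΩ : IsCompact Ω)
    (hA : ∀ i j, Integrable (fun x => A x i j) (volume.restrict Ω))
    (hB : ∀ i j, Integrable (fun x => B x i j) (volume.restrict Ω)) :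
    HasMatDensity (interpTriple k Ω A B).G (volume.restrict (timeSpace Ω)) (interpG A B) ∧
      HasMatDensity (interpTriple k Ω A B).q (volume.restrict (timeSpace Ω)) (fun _ => 0) ∧
      HasMatDensity (interpTriple k Ω A B).R (volume.restrict (timeSpace Ω)) (interpR A B) := by
  have he := integrable_densityGap hA hB
  have hI : ∀ {a : ℝ → ℝ} {f : Space d → ℝ}, Continuous a → Integrable f (volume.restrict Ω) →
      Integrable (fun z => a z.1 * f z.2) (volume.restrict (timeSpace Ω)) := fun ha hf =>
    integrable_continuousOn_mul_snd hΩ (ha.comp continuous_fst).continuousOn hf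
  have hσ : Continuous smoothStep := by unfold smoothStep; fun_prop
  have hw : Continuous bump := by unfold bump; fun_prop
  refine ⟨hasMatDensity_matWithDensity fun i j => ?_, hasMatDensity_matWithDensity fun i j => ?_,
    hasMatDensity_matWithDensity fun i j => ?_⟩
  · exact ((hI (continuous_const.sub hσ) (hA i j)).add (hI hσ (hB i j))).add
      ((hI hw he).mul_const _)
  · exact integrable_zero _ _ _
  · exact (hI (a := fun t => 6 * t * (1 - t)) (by fun_prop) ((hB i j).sub (hA i j))).add
      ((hI (a := fun t => 2 * t * (1 - t) * (1 - 2 * t)) (by fun_prop) he).mul_const _)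

/-- Since `q = 0` and `interpR` is the time derivative of `interpG`, this is integration by parts in
time. The summands of `interpG` have product form and are treated separately; `bump` contributes
nothing at the end points. -/
theorem interpTriple_mem_CE (hΩ : IsCompact Ω) (h0 : volume (Ω \ interior Ω) = 0)
    (D : DiffOp d n k) (h₀ : HasMatDensity G₀ (volume.restrict Ω) A)
    (h₁ : HasMatDensity G₁ (volume.restrict Ω) B) (hA : ∀ x, (A x).IsSymm)
    (hB : ∀ x, (B x).IsSymm) : interpTriple k Ω A B ∈ CE Ω D G₀ G₁ := by
  have hQ := isCompact_timeSpace hΩ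
  have hresQ := restrict_compl_self volume hQ.measurableSet
  have hresΩ := restrict_compl_self volume hΩ.measurableSet
  obtain ⟨d₁, d₂, d₃⟩ := hasMatDensity_interpTriple k hΩ h₀.integrable h₁.integrable
  refine ⟨⟨d₁.livesOn hQ.measurableSet hresQ, d₂.livesOn hQ.measurableSet hresQ,
    d₃.livesOn hQ.measurableSet hresQ, d₁.isSymmValued fun z => ?_⟩, fun Φ Φ' hΦ _ => ?_⟩
  · exact (((hA z.2).smul _).add ((hB z.2).smul _)).add (Matrix.isSymm_one.smul _)
  have he := integrable_densityGap h₀.integrable h₁.integrable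
  have hdir : ∀ i j, ContinuousOn (fun z => Φ' z i j (1, 0)) (timeSpace Ω) := fun i j =>
    (hΦ i j).2.1.clm_apply continuousOn_const
  have hcut : ∀ (τ : ℝ), τ ∈ Set.Icc (0 : ℝ) 1 → ∀ i j,
      ContinuousOn (fun x => Φ (τ, x) i j) Ω := fun τ hτ i j =>
    (hΦ i j).1.comp (by fun_prop) fun x hx => ⟨hτ, hx⟩
  have p₁ : pairing (interpTriple k Ω A B).G (dirDeriv (1, 0) Φ') =
      ∑ i, ∑ j, ∫ z in timeSpace Ω, Φ' z i j (1, 0) * interpG A B z i j :=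
    d₁.pairing_eq_of_continuousOn hQ hresQ hdir
  have p₂ : pairing (interpTriple k Ω A B).q (D.apply Φ Φ') = 0 := by
    rw [d₂.pairing_eq_of_continuousOn hQ hresQ (hΦ.continuousOn_apply D)]
    refine Finset.sum_eq_zero fun a _ => Finset.sum_eq_zero fun b _ => ?_
    rw [← integral_zero]
    exact integral_congr_ae (ae_of_all _ fun z => mul_zero _)
  have p₃ := d₃.pairing_eq_of_continuousOn hQ hresQ fun i j => (hΦ i j).1
  rw [p₁, p₂, p₃, h₁.pairing_eq_of_continuousOn hΩ hresΩ (hcut 1 ⟨zero_le_one, le_rfl⟩),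
    h₀.pairing_eq_of_continuousOn hΩ hresΩ (hcut 0 ⟨le_rfl, zero_le_one⟩), add_zero]
  simp only [← Finset.sum_add_distrib, ← Finset.sum_sub_distrib]
  refine Finset.sum_congr rfl fun i _ => Finset.sum_congr rfl fun j _ => ?_
  have hbp : ∀ {a a' : ℝ → ℝ} (_ : ∀ t, HasDerivAt a (a' t) t) (_ : Continuous a')
      {f : Space d → ℝ} (_ : Integrable f (volume.restrict Ω)),
      Integrable (fun z => Φ' z i j (1, 0) * (a z.1 * f z.2) + Φ z i j * (a' z.1 * f z.2))
        (volume.restrict (timeSpace Ω)) := by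
    intro a a' ha ha' f hf
    have hac : Continuous a := continuous_iff_continuousAt.2 fun t => (ha t).continuousAt
    have i₁ := integrable_continuousOn_mul_snd hΩ
      ((hdir i j).mul (hac.comp continuous_fst).continuousOn) hf
    have i₂ := integrable_continuousOn_mul_snd hΩ
      ((hΦ i j).1.mul (ha'.comp continuous_fst).continuousOn) hf
    refine (i₁.add i₂).congr (ae_of_all _ fun z => ?_)
    simp only [Pi.add_apply, Pi.mul_apply, Function.comp_apply]
    ring
  have hσ₀ : ∀ t, HasDerivAt (fun t => 1 - smoothStep t) (-(6 * t * (1 - t))) t := fun t =>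
    (hasDerivAt_smoothStep t).const_sub 1
  have cσ₀ : Continuous fun t : ℝ => -(6 * t * (1 - t)) := by fun_prop
  have cσ : Continuous fun t : ℝ => 6 * t * (1 - t) := by fun_prop
  have cw : Continuous fun t : ℝ => 2 * t * (1 - t) * (1 - 2 * t) := by fun_prop
  have hδ : Integrable (fun x => densityGap A B x * (1 : Mat n n) i j) (volume.restrict Ω) :=
    he.mul_const _
  have k₁ := integral_by_parts_time hΩ h0 (hΦ i j).1 (hΦ i j).2.1 (hΦ i j).2.2 hσ₀ cσ₀
    (h₀.integrable i j)
  have k₂ := integral_by_parts_time hΩ h0 (hΦ i j).1 (hΦ i j).2.1 (hΦ i j).2.2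
    hasDerivAt_smoothStep cσ (h₁.integrable i j)
  have k₃ := integral_by_parts_time hΩ h0 (hΦ i j).1 (hΦ i j).2.1 (hΦ i j).2.2
    hasDerivAt_bump cw hδ
  have s0 : smoothStep 0 = 0 := by norm_num [smoothStep]
  have s1 : smoothStep 1 = 1 := by norm_num [smoothStep]
  have b0 : bump 0 = 0 := by norm_num [bump]
  have b1 : bump 1 = 0 := by norm_num [bump]
  simp only [s0, s1, b0, b1, sub_self, sub_zero, zero_mul, mul_zero, one_mul, integral_zero,
    zero_sub] at k₁ k₂ k₃
  have i₁ := hbp hσ₀ cσ₀ (h₀.integrable i j)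
  have i₂ := hbp hasDerivAt_smoothStep cσ (h₁.integrable i j)
  have i₃ := hbp hasDerivAt_bump cw hδ
  rw [← integral_add (integrable_continuousOn_mul hQ hresQ (hdir i j) (d₁.integrable i j))
    (integrable_continuousOn_mul hQ hresQ (hΦ i j).1 (d₃.integrable i j))]
  have e : ∀ z, Φ' z i j (1, 0) * interpG A B z i j + Φ z i j * interpR A B z i j =
      ((Φ' z i j (1, 0) * ((1 - smoothStep z.1) * A z.2 i j) +
        Φ z i j * (-(6 * z.1 * (1 - z.1)) * A z.2 i j)) +
      (Φ' z i j (1, 0) * (smoothStep z.1 * B z.2 i j) +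
        Φ z i j * (6 * z.1 * (1 - z.1) * B z.2 i j))) +
      (Φ' z i j (1, 0) * (bump z.1 * (densityGap A B z.2 * (1 : Mat n n) i j)) +
        Φ z i j * (2 * z.1 * (1 - z.1) * (1 - 2 * z.1) *
          (densityGap A B z.2 * (1 : Mat n n) i j))) := fun z => by
    simp only [interpG, interpR, Matrix.add_apply, Matrix.sub_apply, Matrix.smul_apply,
      smul_eq_mul]
    ring
  simp only [e]
  refine (integral_add (i₁.add i₂) i₃).trans ?_
  refine (congrArg₂ (· + ·) (integral_add i₁ i₂) rfl).trans ?_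
  rw [k₁, k₂, k₃]
  ring

/-- The convex combination of `A` and `B` costs nothing, and the multiple of the identity pays for
`interpR`. No lower bound on `A` or `B` is needed. -/
theorem exists_WB_le {Λ₁ : Mat k k} {Λ₂ : Mat n n} (hΛ₁ : Λ₁.PosSemidef) (hΛ₂ : Λ₂.PosDef)
    (hΩ : IsCompact Ω) (h0 : volume (Ω \ interior Ω) = 0) (D : DiffOp d n k) :
    ∃ C : ℝ, ∀ (G₀ G₁ : MatMeasure (Space d) n n) (A B : Space d → Mat n n),
      HasMatDensity G₀ (volume.restrict Ω) A → HasMatDensity G₁ (volume.restrict Ω) B →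
      (∀ x, (A x).IsSymm) → (∀ x, (B x).IsSymm) →
      (∀ᵐ x ∂volume.restrict Ω, (A x).PosSemidef) → (∀ᵐ x ∂volume.restrict Ω, (B x).PosSemidef) →
      WB Ω D Λ₁ Λ₂ G₀ G₁ ≤ ENNReal.ofReal (C * ∫ x in Ω, densityGap A B x) ^ (1 / 2 : ℝ) := by
  obtain ⟨C, hC, hbound⟩ := exists_actionDensity_scalar_le (n := n) hΛ₁ hΛ₂
  refine ⟨C * 64, fun G₀ G₁ A B h₀ h₁ hA hB hpA hpB => ?_⟩
  have hQ := isCompact_timeSpace hΩ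
  have he := integrable_densityGap h₀.integrable h₁.integrable
  have hCE := interpTriple_mem_CE (k := k) hΩ h0 D h₀ h₁ hA hB
  obtain ⟨d₁, d₂, d₃⟩ := hasMatDensity_interpTriple k hΩ h₀.integrable h₁.integrable
  refine ENNReal.rpow_le_rpow ((iInf₂_le _ hCE).trans ?_) (by norm_num)
  rw [action_eq_lintegral hΛ₁ hΛ₂ hCE.1.2.2.2 d₁ d₂ d₃ _ hQ.measurableSet,
    Measure.restrict_restrict hQ.measurableSet, Set.inter_self]
  have hsnd : ∀ {p : Space d → Prop}, (∀ᵐ x ∂volume.restrict Ω, p x) →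
      ∀ᵐ z ∂(volume : Measure (ℝ × Space d)).restrict (timeSpace Ω), p z.2 := fun hp => by
    rw [volume_restrict_timeSpace]
    exact Measure.quasiMeasurePreserving_snd.ae hp
  have hpt : ∀ᵐ z ∂(volume : Measure (ℝ × Space d)).restrict (timeSpace Ω),
      actionDensity Λ₁ Λ₂ (interpG A B z) 0 (interpR A B z) ≤
        ENNReal.ofReal (C * 64 * densityGap A B z.2) := by
    filter_upwards [hsnd hpA, hsnd hpB, ae_restrict_mem hQ.measurableSet] with z hzA hzB hz
    obtain ⟨ht0, ht1⟩ := hz.1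
    have e0 := densityGap_nonneg A B z.2
    have hσ0 : 0 ≤ smoothStep z.1 := by
      have : smoothStep z.1 = z.1 ^ 2 * (3 - 2 * z.1) := by rw [smoothStep]; ring
      rw [this]
      exact mul_nonneg (sq_nonneg _) (by linarith)
    have hσ1 : 0 ≤ 1 - smoothStep z.1 := by
      have : 1 - smoothStep z.1 = (1 - z.1) ^ 2 * (1 + 2 * z.1) := by rw [smoothStep]; ring
      rw [this]
      exact mul_nonneg (sq_nonneg _) (by linarith)
    have hP : ((1 - smoothStep z.1) • A z.2 + smoothStep z.1 • B z.2).PosSemidef :=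
      (hzA.smul_real hσ1).add (hzB.smul_real hσ0)
    have hb : 0 ≤ bump z.1 := mul_nonneg (sq_nonneg _) (sq_nonneg _)
    have e : actionDensity Λ₁ Λ₂ (interpG A B z) 0 (interpR A B z) =
        actionDensity Λ₁ Λ₂ (((1 - smoothStep z.1) • A z.2 + smoothStep z.1 • B z.2) +
          (bump z.1 * densityGap A B z.2) • (1 : Mat n n)) (0 + 0) (0 + interpR A B z) := by
      rw [add_zero, zero_add]
      rfl
    rw [e]
    refine (actionDensity_add_le hΛ₁ hΛ₂ hP.isSymm_real (Matrix.isSymm_one.smul _) _ _ _ _).trans ?_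
    rw [actionDensity_zero_zero hP, zero_add, mul_assoc]
    -- The squared bound `(8 t (1 - t) gap)²` equals `bump t * gap` times `64 * gap`. This is why
    -- `bump` vanishes to second order where `interpR` vanishes to first order.
    refine hbound _ (8 * z.1 * (1 - z.1) * densityGap A B z.2) (64 * densityGap A B z.2) _
      (mul_nonneg hb e0) (by positivity) (fun i j => abs_interpR_le hz i j) (le_of_eq ?_)
    rw [bump]
    ring
  refine (lintegral_mono_ae hpt).trans (le_of_eq ?_)
  have hi : Integrable (fun z : ℝ × Space d => C * 64 * densityGap A B z.2)
      (volume.restrict (timeSpace Ω)) :=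
    integrable_continuousOn_mul_snd hΩ (φ := fun _ => C * 64) continuousOn_const he
  rw [← ofReal_integral_eq_lintegral_ofReal hi
    (ae_of_all _ fun z => mul_nonneg (by positivity) (densityGap_nonneg A B z.2)),
    integral_const_mul, volume_restrict_timeSpace, integral_fun_snd]
  simp

end Interpolation

/-! ### Convergence of the end points in the distance and in total variation. -/

section Conclusion

variable {d n k : ℕ} {Ω : Set (Space d)} {x₀ : Space d} {η₁ : ℝ → ℝ → ℝ}
  {η₂ : ℝ → Space d → ℝ} {μ : Triple d n k} {G : MatMeasure (Space d) n n}

theorem tendsto_integral_densityGap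
    (hK : ∀ᶠ s in 𝓝[>] (0 : ℝ), IsKernelPair Ω x₀ s (η₁ s) (η₂ s)) (hΩ : IsCompact Ω)
    (hμ : μ.IsOn (timeSpace Ω)) (hG : IsPSDMeasureOn Ω G)
    (h : G ≪ᵥ (volume : Measure (Space d)).toENNRealVectorMeasure) (C : ℝ) :
    Tendsto (fun s => ENNReal.ofReal (C * ∫ x in Ω, densityGap (density G (volume.restrict Ω))
      (endReg x₀ s (η₂ s) μ G) x)) (𝓝[>] 0) (𝓝 0) := by
  have h₁ := ENNReal.tendsto_ofReal ((tendsto_integral_endReg_sub (μ := μ) hK hΩ hμ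
    (dominating_absolutelyContinuous_restrict hΩ hG h)).const_mul C)
  rwa [mul_zero, ENNReal.ofReal_zero] at h₁

theorem tendsto_WB_regEnd {Λ₁ : Mat k k} {Λ₂ : Mat n n} (hΛ₁ : Λ₁.PosSemidef) (hΛ₂ : Λ₂.PosDef)
    (hK : ∀ᶠ s in 𝓝[>] (0 : ℝ), IsKernelPair Ω x₀ s (η₁ s) (η₂ s)) (hΩ : IsCompact Ω)
    (h0 : volume (Ω \ interior Ω) = 0) (D : DiffOp d n k)
    (hμ : μ.IsOn (timeSpace Ω)) (hG : IsPSDMeasureOn Ω G)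
    (h : G ≪ᵥ (volume : Measure (Space d)).toENNRealVectorMeasure) :
    Tendsto (fun s => WB Ω D Λ₁ Λ₂ G (regEnd Ω x₀ s (η₂ s) μ G)) (𝓝[>] 0) (𝓝 0) := by
  obtain ⟨C, hC⟩ := exists_WB_le hΛ₁ hΛ₂ hΩ h0 D
  have : IsFiniteMeasure ((volume : Measure (Space d)).restrict Ω) :=
    isFiniteMeasure_restrict.2 hΩ.measure_lt_top.ne
  have hd := hasMatDensity_density (dominating_absolutelyContinuous_restrict hΩ hG h)
  have hs := density_isSymm hG.isSymmValued ((volume : Measure (Space d)).restrict Ω)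
  have h₁ := ((ENNReal.continuous_rpow_const (y := 1 / 2)).tendsto 0).comp
    (tendsto_integral_densityGap hK hΩ hμ hG h C)
  rw [ENNReal.zero_rpow_of_pos (by norm_num)] at h₁
  refine tendsto_of_tendsto_of_tendsto_of_le_of_le' tendsto_const_nhds h₁
    (Eventually.of_forall fun _ => zero_le) ?_
  filter_upwards [hK] with s K
  exact hC _ _ _ _ hd (K.hasMatDensity_regEnd hΩ μ G) hs
    (fun x => (K.endReg_posSemidef hG x).isSymm_real) (hd.ae_posSemidef hG.2 hs)
    (ae_of_all _ (K.endReg_posSemidef hG))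

theorem tendsto_tvNorm_sub_regEnd
    (hK : ∀ᶠ s in 𝓝[>] (0 : ℝ), IsKernelPair Ω x₀ s (η₁ s) (η₂ s)) (hΩ : IsCompact Ω)
    (hμ : μ.IsOn (timeSpace Ω)) (hG : IsPSDMeasureOn Ω G)
    (h : G ≪ᵥ (volume : Measure (Space d)).toENNRealVectorMeasure) :
    Tendsto (fun s => tvNorm (G - regEnd Ω x₀ s (η₂ s) μ G)) (𝓝[>] 0) (𝓝 0) := by
  have : IsFiniteMeasure ((volume : Measure (Space d)).restrict Ω) :=
    isFiniteMeasure_restrict.2 hΩ.measure_lt_top.ne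
  have hd := hasMatDensity_density (dominating_absolutelyContinuous_restrict hΩ hG h)
  refine tendsto_of_tendsto_of_tendsto_of_le_of_le' tendsto_const_nhds
    (tendsto_integral_densityGap hK hΩ hμ hG h 1) (Eventually.of_forall fun _ => zero_le) ?_
  filter_upwards [hK] with s K
  refine (tvNorm_le (hd.sub (K.hasMatDensity_regEnd hΩ μ G))).trans (le_of_eq ?_)
  rw [one_mul]
  congr 1
  refine integral_congr_ae (ae_of_all _ fun x => ?_)
  exact Finset.sum_congr rfl fun i _ => Finset.sum_congr rfl fun j _ => abs_sub_comm _ _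

end Conclusion

end WBTransport

end

theorem mainTheorem4 {d n k : ℕ} (hd : 0 < d) (hn : 0 < n) (hk : 0 < k)
    (Ω : Set (WBTransport.Space d)) (hΩ : IsCompact Ω) (hstar : WBTransport.StarShaped Ω)
    (Λ₁ : WBTransport.Mat k k) (hΛ₁ : Λ₁.PosSemidef)
    (Λ₂ : WBTransport.Mat n n) (hΛ₂ : Λ₂.PosDef)
    (D : WBTransport.DiffOp d n k) (hD : D.Splits)
    (G₀ G₁ : WBTransport.MatMeasure (WBTransport.Space d) n n)
    (hG₀ : WBTransport.IsPSDMeasureOn Ω G₀) (hG₁ : WBTransport.IsPSDMeasureOn Ω G₁)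
    (μ : WBTransport.Triple d n k) (hμ : μ ∈ WBTransport.CEfin Ω D Λ₁ Λ₂ G₀ G₁) :
    ∃ (με : ℝ → WBTransport.Triple d n k)
      (G₀ε G₁ε : ℝ → WBTransport.MatMeasure (WBTransport.Space d) n n),
      (∃ ε₀ > 0, ∀ ε ∈ Set.Ioo 0 ε₀,
        WBTransport.IsPSDMeasureOn Ω (G₀ε ε) ∧ WBTransport.IsPSDMeasureOn Ω (G₁ε ε) ∧
        με ε ∈ WBTransport.CEfin Ω D Λ₁ Λ₂ (G₀ε ε) (G₁ε ε) ∧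
        (∃ g₀ : WBTransport.Space d → WBTransport.Mat n n,
          WBTransport.IsSmooth g₀ ∧ WBTransport.HasDensityOn Ω (G₀ε ε) g₀) ∧
        (∃ g₁ : WBTransport.Space d → WBTransport.Mat n n,
          WBTransport.IsSmooth g₁ ∧ WBTransport.HasDensityOn Ω (G₁ε ε) g₁) ∧
        (∃ (g : ℝ × WBTransport.Space d → WBTransport.Mat n n) (c : ℝ),
          WBTransport.IsSmooth g ∧ WBTransport.HasDensityOn (WBTransport.timeSpace Ω) (με ε).G g ∧
          0 < c ∧ ∀ z ∈ WBTransport.timeSpace Ω,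
            (g z - c • (1 : WBTransport.Mat n n)).PosSemidef) ∧
        (∃ q : ℝ × WBTransport.Space d → WBTransport.Mat n k,
          WBTransport.IsSmooth q ∧ WBTransport.HasDensityOn (WBTransport.timeSpace Ω) (με ε).q q) ∧
        (∃ r : ℝ × WBTransport.Space d → WBTransport.Mat n n,
          WBTransport.IsSmooth r ∧ WBTransport.HasDensityOn (WBTransport.timeSpace Ω) (με ε).R r)) ∧
      WBTransport.WeakStarTendsto (WBTransport.timeSpace Ω) (fun ε => (με ε).G) μ.G ∧
      WBTransport.WeakStarTendsto (WBTransport.timeSpace Ω) (fun ε => (με ε).q) μ.q ∧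
      WBTransport.WeakStarTendsto (WBTransport.timeSpace Ω) (fun ε => (με ε).R) μ.R ∧
      Tendsto (fun ε => WBTransport.action Λ₁ Λ₂ (WBTransport.timeSpace Ω) (με ε)) (𝓝[>] 0)
        (𝓝 (WBTransport.action Λ₁ Λ₂ (WBTransport.timeSpace Ω) μ)) ∧
      WBTransport.WeakStarTendsto Ω G₀ε G₀ ∧
      WBTransport.WeakStarTendsto Ω G₁ε G₁ ∧
      (G₀ ≪ᵥ (volume : Measure (WBTransport.Space d)).toENNRealVectorMeasure →
        G₁ ≪ᵥ (volume : Measure (WBTransport.Space d)).toENNRealVectorMeasure →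
        Tendsto (fun ε => WBTransport.WB Ω D Λ₁ Λ₂ G₀ (G₀ε ε)) (𝓝[>] 0) (𝓝 0) ∧
        Tendsto (fun ε => WBTransport.WB Ω D Λ₁ Λ₂ G₁ (G₁ε ε)) (𝓝[>] 0) (𝓝 0) ∧
        Tendsto (fun ε => WBTransport.tvNorm (G₀ - G₀ε ε)) (𝓝[>] 0) (𝓝 0) ∧
        Tendsto (fun ε => WBTransport.tvNorm (G₁ - G₁ε ε)) (𝓝[>] 0) (𝓝 0)) := by
  obtain ⟨hCE, hfin⟩ := hμ
  have hon := hCE.1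
  obtain ⟨x₀, r, hball⟩ := hstar.exists_ball
  have h0 := hball.volume_diff_interior hΩ
  -- Kernels are fixed for every `s` in `(0, 1)`, so `ε = s` and `ε₀ = 1` work; for other `s` the
  -- values are irrelevant.
  choose! η₁ η₂ hη using fun s (hs : s ∈ Set.Ioo (0 : ℝ) 1) => hball.exists_isKernelPair hs.1 hs.2
  have hK : ∀ᶠ s in 𝓝[>] (0 : ℝ), WBTransport.IsKernelPair Ω x₀ s (η₁ s) (η₂ s) := by
    filter_upwards [Ioo_mem_nhdsGT zero_lt_one] with s hs using hη s hs
  have hpos := WBTransport.ae_nonneg_quadratic_of_action hΛ₁ hΛ₂ hΩ hon hfin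
  have hact := WBTransport.tendsto_action_regTriple hΛ₁ hΛ₂ hK hΩ D hon hG₀ hG₁ hfin
  obtain ⟨C, hC⟩ := WBTransport.exists_action_regTriple_le (x₀ := x₀) hΩ hΛ₁ hΛ₂ D hon hG₀ hG₁
  refine ⟨fun s => WBTransport.regTriple Ω x₀ s (η₁ s) (η₂ s) D μ G₀ G₁,
    fun s => WBTransport.regEnd Ω x₀ s (η₂ s) μ G₀,
    fun s => WBTransport.regEnd Ω x₀ s (η₂ s) μ G₁, ⟨1, one_pos, fun s hs => ?_⟩,
    WBTransport.weakStarTendsto_regG hK hΩ D hon hG₀ hG₁,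
    WBTransport.weakStarTendsto_regq hK hΩ D hon G₀ G₁,
    WBTransport.weakStarTendsto_regR hK hΩ D hon G₀ G₁, hact,
    WBTransport.weakStarTendsto_regEnd hK hΩ hon hG₀,
    WBTransport.weakStarTendsto_regEnd hK hΩ hon hG₁, fun hac₀ hac₁ =>
    ⟨WBTransport.tendsto_WB_regEnd hΛ₁ hΛ₂ hK hΩ h0 D hon hG₀ hac₀,
      WBTransport.tendsto_WB_regEnd hΛ₁ hΛ₂ hK hΩ h0 D hon hG₁ hac₁,
      WBTransport.tendsto_tvNorm_sub_regEnd hK hΩ hon hG₀ hac₀,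
      WBTransport.tendsto_tvNorm_sub_regEnd hK hΩ hon hG₁ hac₁⟩⟩
  have K := hη s hs
  obtain ⟨d₁, d₂, d₃⟩ := K.hasMatDensity_regTriple hΩ D μ G₀ G₁
  -- The quantitative bound also shows that the regularized action is finite for each fixed `s`.
  have hle := (hC s _ _ K).trans_lt (ENNReal.add_lt_top.2
    ⟨ENNReal.mul_lt_top ENNReal.ofReal_lt_top hfin, ENNReal.ofReal_lt_top⟩)
  exact ⟨K.isPSDMeasureOn_regEnd hΩ hG₀, K.isPSDMeasureOn_regEnd hΩ hG₁,
    ⟨K.regTriple_mem_CE hΩ h0 hG₀ hG₁ hCE, hle⟩,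
    ⟨_, K.isSmooth_endReg μ G₀, (K.hasMatDensity_regEnd hΩ μ G₀).hasDensityOn⟩,
    ⟨_, K.isSmooth_endReg μ G₁, (K.hasMatDensity_regEnd hΩ μ G₁).hasDensityOn⟩,
    ⟨_, s, K.isSmooth_regG μ G₀ G₁, d₁.hasDensityOn, K.time.pos,
      fun z hz => K.regG_sub_posSemidef hon hpos hG₀ hG₁ hz⟩,
    ⟨_, K.isSmooth_regq μ, d₂.hasDensityOn⟩, ⟨_, K.isSmooth_regR D μ, d₃.hasDensityOn⟩⟩
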